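/- Let $d\ge 2$ and $\beta>d$. For constants $C_0,C_1,C_2,\dots$ let $\mathbf S=\mathbf S(\beta,(C_m))$ be the set of all $a\in C^\infty(\mathbb R^d;\mathbb C)$ such that $$|\nabla^m a(\xi)|\le C_m(1+|\xi|^2)^{-\beta/2},\qquad \xi\in\mathbb R^d,\ m=0,1,2,\dots .$$ For $\alpha>0$ and bounded $b$, let $\mathrm{Op}_\alpha(b)$ be the bounded operator on $L^2(\mathbb R^d)$ given on Schwartz functions by $$(\mathrm{Op}_\alpha(b)u)(x)=\Big(\frac{\alpha}{2\pi}\Big)^{d}\iint e^{i\alpha\xi\cdot(x-y)}b(\xi)u(y)\,dy\,d\xi .$$ For $\Lambda\subset\mathbb R^d$ put $W_\alpha(b;\Lambda)=\chi_\Lambda\mathrm{Op}_\alpha(b)\chi_\Lambda$ and, with $g_p(t)=t^p$, $p=1,2,\dots$, $$D_\alpha(a,\Lambda;g_p)=\chi_\Lambda\, W_\alpha(a;\Lambda)^p\,\chi_\Lambda-W_\alpha(a^p;\Lambda).$$ For a function $g:\mathbb C\to\mathbb C$ and a unit vector $e\in\mathbb R^d$ put $$U(s_1,s_2;g)=\int_0^1\frac{g((1-t)s_1+ts_2)-[(1-t)g(s_1)+tg(s_2)]}{t(1-t)}\,dt,$$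 $$\mathcal A_d(a,e;g)=\frac1{8\pi^2}\lim_{\epsilon\downarrow0}\int_{\mathbb R^d}\int_{|t|>\epsilon}\frac{U(a(\xi),a(\xi+te);g)}{t^2}\,dt\,d\xi .$$ A *basic $C^1$ domain* is a set $\Lambda\subset\mathbb R^d$ which, in suitable Cartesian coordinates $x=(\hat x,x_d)$, has the form $\{x_d>\Phi(\hat x)\}$ with a globally Lipschitz function $\Phi\in C^1(\mathbb R^{d-1})$. A *basic piecewise $C^1$ domain* is defined in the same way, with a globally Lipschitz function $\Phi$ on $\mathbb R^{d-1}$ that is $C^1$ on the complement of the union of finitely many $(d-2)$-dimensional Lipschitz surfaces $L_1,\dots,L_N\subset\mathbb R^{d-1}$; here a $(d-2)$-dimensional Lipschitz surface is a closed set that, near each of its points, coincides in suitable Cartesian coordinates with the graph of a Lipschitz function of $d-2$ variables (for $d=2$: a closed discrete set of points). For such $\Lambda$ and $\varphi\in C_0^\infty(\mathbb R^d;\mathbb C)$ put $$\mathcal B_d(a,\varphi;\partial\Lambda,g)=\frac1{(2\pi)^{d-1}}\int_{\partial\Lambda}\varphi(x)\,\mathcal A_d(a,n_x;g)\,dS_x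 ,$$ where $n_x$ is the unit normal to $\partial\Lambda$ at $x$ (defined for almost every $x$). **Theorem.** Let $\Lambda$ be a basic $C^1$ domain or a basic piecewise $C^1$ domain, let $\varphi\in C_0^\infty(\mathbb R^d;\mathbb C)$ and $p\in\{1,2,\dots\}$. Then for every $a\in\mathbf S$ the limit defining $\mathcal A_d(a,e;g_p)$ exists for all unit vectors $e$, the integral defining $\mathcal B_d(a,\varphi;\partial\Lambda,g_p)$ converges absolutely, the operator $\varphi D_\alpha(a,\Lambda;g_p)$ is trace class for all $\alpha>0$, and $$\operatorname{tr}\big(\varphi D_\alpha(a,\Lambda;g_p)\big)=\alpha^{d-1}\mathcal B_d(a,\varphi;\partial\Lambda,g_p)+o(\alpha^{d-1}),\qquad\alpha\to\infty,$$ uniformly in $a\in\mathbf S$: for every $\varepsilon>0$ there is $\alpha_0>0$, depending only on $\varepsilon,d,\beta,(C_m),\Lambda,\varphi,p$, such that $$\big|\operatorname{tr}(\varphi D_\alpha(a,\Lambda;g_p))-\alpha^{d-1}\mathcal B_d(a,\varphi;\partial\Lambda,g_p)\big|\le\varepsilon\,\alpha^{d-1}\qquad\text{for all }\alpha\ge\alpha_0,\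 a\in\mathbf S .$$ -/

import Mathlib

open MeasureTheory Filter Topology
open scoped ContDiff ENNReal

noncomputable section

/-! ### Trace class operators and the trace -/

section TraceClass

variable {H : Type*} [NormedAddCommGroup H] [InnerProductSpace ℂ H]

/-- `T u = ∑ ⟪x n, u⟫ y n` for all `u`, where `∑ ‖x n‖ ‖y n‖ < ∞`. -/
def IsNuclearDecomposition (T : H →L[ℂ] H) (x y : ℕ → H) : Prop :=
  Summable (fun n => ‖x n‖ * ‖y n‖) ∧ ∀ u, HasSum (fun n => inner ℂ (x n) u • y n) (T u)

/-- Trace class (equivalently, on a Hilbert space, nuclear) operators: absolutely convergent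
sums of operators of rank one. -/
def IsTraceClass (T : H →L[ℂ] H) : Prop :=
  ∃ x y : ℕ → H, IsNuclearDecomposition T x y

/-- The trace of a trace class operator can be computed in any orthonormal basis, and from any
decomposition into operators of rank one. -/
theorem hasSum_opTrace_aux {ι : Type*} (b : HilbertBasis ι ℂ H) {T : H →L[ℂ] H} {x y : ℕ → H}
    (h : IsNuclearDecomposition T x y) :
    HasSum (fun i => inner ℂ (b i) (T (b i))) (∑' n, inner ℂ (x n) (y n)) := by
  obtain ⟨hs, hT⟩ := h
  have hn : ∀ n, HasSum (fun i => inner ℂ (x n) (b i) * inner ℂ (b i) (y n))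
      (inner ℂ (x n) (y n)) := fun n => b.hasSum_inner_mul_inner (x n) (y n)
  have hle : ∀ n, ∑' i, ‖inner ℂ (x n) (b i) * inner ℂ (b i) (y n)‖ ≤ ‖x n‖ * ‖y n‖ := by
    intro n
    refine Real.tsum_le_of_sum_le (fun i => norm_nonneg _) fun s => ?_
    have h1 := b.orthonormal.sum_inner_products_le (x n) (s := s)
    have h2 := b.orthonormal.sum_inner_products_le (y n) (s := s)
    calc ∑ i ∈ s, ‖inner ℂ (x n) (b i) * inner ℂ (b i) (y n)‖
        = ∑ i ∈ s, ‖inner ℂ (b i) (x n)‖ * ‖inner ℂ (b i) (y n)‖ := by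
          refine Finset.sum_congr rfl fun i _ => ?_
          rw [norm_mul, norm_inner_symm]
      _ ≤ √(∑ i ∈ s, ‖inner ℂ (b i) (x n)‖ ^ 2) * √(∑ i ∈ s, ‖inner ℂ (b i) (y n)‖ ^ 2) :=
          Real.sum_mul_le_sqrt_mul_sqrt _ _ _
      _ ≤ √(‖x n‖ ^ 2) * √(‖y n‖ ^ 2) := by gcongr
      _ = ‖x n‖ * ‖y n‖ := by
          rw [Real.sqrt_sq (norm_nonneg _), Real.sqrt_sq (norm_nonneg _)]
  have hsum : Summable fun q : ℕ × ι =>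
      inner ℂ (x q.1) (b q.2) * inner ℂ (b q.2) (y q.1) := by
    refine Summable.of_norm ((summable_prod_of_nonneg fun q => norm_nonneg _).2 ⟨fun n => ?_, ?_⟩)
    · exact (hn n).summable.norm
    · exact hs.of_nonneg_of_le (fun n => tsum_nonneg fun i => norm_nonneg _) hle
  have h1 := hsum.hasSum.prod_fiberwise hn
  rw [h1.tsum_eq]
  have h2 := (Equiv.prodComm ι ℕ).hasSum_iff.2 hsum.hasSum
  refine h2.prod_fiberwise fun i => ?_
  have h3 := (innerSL ℂ (b i)).hasSum (hT (b i))
  simpa [inner_smul_right] using h3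

variable [CompleteSpace H]

/-- The trace `∑ ⟪b i, T (b i)⟫` over an orthonormal basis `b`. For a trace class operator the
sum converges absolutely and does not depend on `b`, see `hasSum_opTrace`. -/
def opTrace (T : H →L[ℂ] H) : ℂ :=
  ∑' i, inner ℂ ((exists_hilbertBasis ℂ H).choose_spec.choose i)
    (T ((exists_hilbertBasis ℂ H).choose_spec.choose i))

/-- The trace of a trace class operator can be computed in any orthonormal basis. -/
theorem hasSum_opTrace {ι : Type*} (b : HilbertBasis ι ℂ H) {T : H →L[ℂ] H}
    (h : IsTraceClass T) : HasSum (fun i => inner ℂ (b i) (T (b i))) (opTrace T) := by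
  obtain ⟨x, y, h⟩ := h
  rw [opTrace, (hasSum_opTrace_aux _ h).tsum_eq]
  exact hasSum_opTrace_aux b h

end TraceClass

/-! ### Truncated Wiener-Hopf operators on `ℝ^d` -/

/-- `ℝ^d` with the Euclidean norm. -/
abbrev Euc (d : ℕ) : Type := EuclideanSpace ℝ (Fin d)

/-- The complex Hilbert space `L²(ℝ^d)`. -/
abbrev L2 (d : ℕ) : Type := Lp ℂ 2 (volume : Measure (Euc d))

open Classical in
/-- The operator of multiplication by a bounded measurable function `m` on `L²(ℝ^d)`
(and `0` if `m` is not essentially bounded and measurable). -/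
def mulOp {d : ℕ} (m : Euc d → ℂ) : L2 d →L[ℂ] L2 d :=
  if h : MemLp m ∞ (volume : Measure (Euc d)) then
    (ContinuousLinearMap.mul ℂ ℂ).holderL volume ∞ 2 2 h.toLp
  else 0

/-- The indicator function of a set, with complex values. -/
def chi {d : ℕ} (S : Set (Euc d)) : Euc d → ℂ := S.indicator 1

/-- The operator `Op_α(a)`, that is
`(Op_α(a) u)(x) = (α / 2π)^d ∫∫ exp(i α ξ · (x - y)) a(ξ) u(y) dy dξ`.
As the Fourier transform of Mathlib is `û(ν) = ∫ exp(-2 π i ν · y) u(y) dy`, the substitution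
`α ξ = 2 π ν` shows that this is the Fourier multiplier `ν ↦ a(2 π ν / α)`. -/
def pdo {d : ℕ} (α : ℝ) (a : Euc d → ℂ) : L2 d →L[ℂ] L2 d :=
  ((Lp.fourierTransformₗᵢ (Euc d) ℂ).symm.toContinuousLinearEquiv : L2 d →L[ℂ] L2 d) ∘L
    mulOp (fun ν => a ((2 * Real.pi / α) • ν)) ∘L
      ((Lp.fourierTransformₗᵢ (Euc d) ℂ).toContinuousLinearEquiv : L2 d →L[ℂ] L2 d)

/-- The truncated Wiener-Hopf operator `W_α(a; Λ) = χ_Λ Op_α(a) χ_Λ`. -/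
def wienerHopf {d : ℕ} (α : ℝ) (a : Euc d → ℂ) (Λ : Set (Euc d)) : L2 d →L[ℂ] L2 d :=
  mulOp (chi Λ) ∘L pdo α a ∘L mulOp (chi Λ)

/-- The monomial `g_p(t) = t^p`. -/
def gPow (p : ℕ) : ℂ → ℂ := fun t => t ^ p

/-- `D_α(a, Λ; g_p) = χ_Λ g_p(W_α(a; Λ)) χ_Λ - W_α(g_p ∘ a; Λ)` with `g_p(t) = t^p`. -/
def diffOp {d : ℕ} (α : ℝ) (a : Euc d → ℂ) (Λ : Set (Euc d)) (p : ℕ) : L2 d →L[ℂ] L2 d :=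
  mulOp (chi Λ) ∘L (wienerHopf α a Λ ^ p) ∘L mulOp (chi Λ) - wienerHopf α (gPow p ∘ a) Λ

/-- Smooth symbols with `|∇^m a(ξ)| ≤ C_m ⟨ξ⟩^(-β)` for all `m`, where
`⟨ξ⟩ = (1 + |ξ|²)^(1/2)`. -/
def symbolClass (d : ℕ) (β : ℝ) (C : ℕ → ℝ) : Set (Euc d → ℂ) :=
  {a | ContDiff ℝ ∞ a ∧
    ∀ (m : ℕ) (ξ : Euc d), ‖iteratedFDeriv ℝ m a ξ‖ ≤ C m * √(1 + ‖ξ‖ ^ 2) ^ (-β)}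

/-! ### Basic domains -/

/-- The point `(x', t)` of `ℝ^(n+1)`, where `x' ∈ ℝ^n`. -/
def withLast {n : ℕ} (x' : Euc n) (t : ℝ) : Euc (n + 1) :=
  WithLp.toLp 2 (Fin.snoc (α := fun _ => ℝ) x'.ofLp t)

/-- The first `n` coordinates of a point of `ℝ^(n+1)`. -/
def hat {n : ℕ} (x : Euc (n + 1)) : Euc n := WithLp.toLp 2 (fun i => x i.castSucc)

/-- The epigraph of `Φ` in the Cartesian coordinates `e x = (x', x_d)`, `d = n + 1`. -/
def epigraph {n : ℕ} (e : Euc (n + 1) ≃ᵃⁱ[ℝ] Euc (n + 1)) (Φ : Euc n → ℝ) :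
    Set (Euc (n + 1)) :=
  {x | Φ (hat (e x)) < e x (Fin.last n)}

/-- `Φ` is globally Lipschitz and `C¹`, so that its epigraph is a basic `C¹` domain. -/
def IsBasicC1 {n : ℕ} (Φ : Euc n → ℝ) : Prop :=
  (∃ K, LipschitzWith K Φ) ∧ ContDiff ℝ 1 Φ

/-- A (closed, `n`-dimensional) Lipschitz surface in `ℝ^(n+1)`: near each of its points it is
the graph of a Lipschitz function in suitable Cartesian coordinates. For `n = 0` this is a closed
discrete set of points. -/
def IsLipschitzSurface {n : ℕ} (L : Set (Euc (n + 1))) : Prop :=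
  IsClosed L ∧ ∀ z ∈ L, ∃ r > 0, ∃ (e : Euc (n + 1) ≃ᵃⁱ[ℝ] Euc (n + 1)) (Ψ : Euc n → ℝ),
    (∃ K, LipschitzWith K Ψ) ∧
      ∀ x ∈ Metric.ball z r, x ∈ L ↔ e x (Fin.last n) = Ψ (hat (e x))

/-- `Φ` is globally Lipschitz on `ℝ^(n+1)`, and `C¹` away from finitely many `n`-dimensional
Lipschitz surfaces, so that its epigraph is a basic piecewise `C¹` domain in `ℝ^(n+2)`. -/
def IsBasicPiecewiseC1 {n : ℕ} (Φ : Euc (n + 1) → ℝ) : Prop :=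
  (∃ K, LipschitzWith K Φ) ∧ ∃ (N : ℕ) (L : Fin N → Set (Euc (n + 1))),
    (∀ j, IsLipschitzSurface (L j)) ∧ ContDiffOn ℝ 1 Φ (⋃ j, L j)ᶜ

/-- The point of the boundary of `epigraph e Φ` above `x'`. -/
def bdryPoint {n : ℕ} (e : Euc (n + 1) ≃ᵃⁱ[ℝ] Euc (n + 1)) (Φ : Euc n → ℝ) (x' : Euc n) :
    Euc (n + 1) :=
  e.symm (withLast x' (Φ x'))

/-- The density `(1 + |∇Φ(x')|²)^(1/2)` of the surface measure of the graph of `Φ` with respect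
to `dx'`. -/
def surfaceDensity {n : ℕ} (Φ : Euc n → ℝ) (x' : Euc n) : ℝ := √(1 + ‖gradient Φ x'‖ ^ 2)

/-- The unit normal to the boundary of `epigraph e Φ` at the point above `x'`, that is the vector
`(-∇Φ(x'), 1) / (1 + |∇Φ(x')|²)^(1/2)` of the coordinates `e`. -/
def unitNormal {n : ℕ} (e : Euc (n + 1) ≃ᵃⁱ[ℝ] Euc (n + 1)) (Φ : Euc n → ℝ) (x' : Euc n) :
    Euc (n + 1) :=
  e.linearIsometryEquiv.symm ((surfaceDensity Φ x')⁻¹ • withLast (-gradient Φ x') 1)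

/-! ### The asymptotic coefficient -/

/-- `U(s₁, s₂; g)`. -/
def coeffU (g : ℂ → ℂ) (s₁ s₂ : ℂ) : ℂ :=
  ∫ t in (0 : ℝ)..1,
    (g ((1 - t) * s₁ + t * s₂) - ((1 - t) * g s₁ + t * g s₂)) / (t * (1 - t))

/-- The truncated integral, over `|t| > ε`, in the definition of `A_d(a, θ; g)`. -/
def truncA {d : ℕ} (a : Euc d → ℂ) (θ : Euc d) (g : ℂ → ℂ) (ε : ℝ) : ℂ :=
  ∫ ξ : Euc d, ∫ t in {t : ℝ | ε < |t|}, coeffU g (a ξ) (a (ξ + t • θ)) / (t : ℂ) ^ 2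

/-- The principal value `A_d(a, θ; g)`. -/
def coeffA {d : ℕ} (a : Euc d → ℂ) (θ : Euc d) (g : ℂ → ℂ) : ℂ :=
  1 / (8 * (Real.pi : ℂ) ^ 2) * limUnder (𝓝[>] (0 : ℝ)) (truncA a θ g)

/-- The integrand `φ(x) A_d(a, n_x; g) dS_x / dx'` at the boundary point `x` above `x'`. -/
def bdryIntegrand {n : ℕ} (a φ : Euc (n + 1) → ℂ) (e : Euc (n + 1) ≃ᵃⁱ[ℝ] Euc (n + 1))
    (Φ : Euc n → ℝ) (g : ℂ → ℂ) (x' : Euc n) : ℂ :=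
  φ (bdryPoint e Φ x') * coeffA a (unitNormal e Φ x') g * (surfaceDensity Φ x' : ℂ)

/-- `B_d(a, φ; ∂Λ, g) = (2π)^(1-d) ∫_{∂Λ} φ(x) A_d(a, n_x; g) dS_x` for `Λ = epigraph e Φ`,
`d = n + 1`. -/
def coeffB {n : ℕ} (a φ : Euc (n + 1) → ℂ) (e : Euc (n + 1) ≃ᵃⁱ[ℝ] Euc (n + 1))
    (Φ : Euc n → ℝ) (g : ℂ → ℂ) : ℂ :=
  1 / (2 * (Real.pi : ℂ)) ^ n * ∫ x' : Euc n, bdryIntegrand a φ e Φ g x'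

end

open scoped FourierTransform ComplexConjugate

/-! ### Multiplication operators -/

/-! Put `K = 𝓕⁻ a`, `κ = α / (2π)`, `p = q + 2` (for `p = 1` everything vanishes). Up to a dilation
by `κ`, `Op_α(a)` is convolution with `K`. Writing the trace as the integral of the kernel over the
diagonal gives `κ^d` times the integral over increments `v_0, …, v_q` of the cyclic product `K(v_0)
⋯ K(v_q) K(-∑ v)` against `∫ φ(x) χ_Λ(x) (∏_j χ_Λ(x + κ⁻¹ S_j) - 1) dx`, where `S_1, …, S_{q+1}` are
the partial sums of `v` (`trace_diffOp`). Repeated integration by parts bounds `K` by any negative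
power of `1 + |z|`, uniformly over the symbol class (`symbolClass.norm_fourierInv_le`).

Geometry. The bracket differs from `0` only if the short closed walk with vertices `x + κ⁻¹ S_j`
leaves `Λ`. In coordinates `x'` along the boundary and `κ⁻¹ s` above it, the bracket times `χ_Λ(x)`
is `-1` exactly for `0 < s ≤ max_j T_j`, with thresholds `T_j` that converge, as `κ → ∞`, to those
of the tangent half-space wherever `Φ` is differentiable. This is almost everywhere, by Rademacher's
theorem. The Lipschitz constant bounds the thresholds by a multiple of `∑ |v_i|`, so dominated
convergence applies (`tendsto_integral_layer_sub`). The volume element costs one factor `κ⁻¹`, which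
leaves `κ^(d-1)`. The symbol enters the bound on the error only through the constant in the decay of
`K`, hence uniformity. In the limit the integral over `s` yields minus the running maximum of the
projections of the walk on the normal (`integral_limitLayer`).

Algebra. It remains to identify `𝒜_d(a, θ; g_p)` with minus the mean `E` of `max(0, S_1·θ, …,
S_{p-1}·θ)`, where `E` is integration against the complex cyclic product (`coeffA_eq`). This product
is symmetric in the increments, so Spitzer's argument gives `E max = ∑_k k⁻¹ E (S_k·θ)⁺`. The
closing increment `-∑ v` is exchangeable with the others, so single increments have mean zero and `E
(S_k·θ)⁺ = E |S_k·θ| / 2` (`cycMean_runMax`). On the other side `U` is an explicit polynomial for a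
monomial (`coeffU_gPow`), Fourier inversion turns `∫ a^(p-k) a(· - tθ)^k` into `E exp(2πi t S_k·θ)`,
and `∫ (1 - cos ts) / t² dt = π |s|` produces the same sum of `E |S_k·θ|` (`tendsto_truncA`). -/

theorem mulOp_coeFn {d : ℕ} {m : Euc d → ℂ} (hm : MemLp m ∞ volume) (u : L2 d) :
    mulOp m u =ᵐ[volume] fun x => m x * u x := by
  have h1 : mulOp m = (ContinuousLinearMap.mul ℂ ℂ).holderL volume ∞ 2 2 hm.toLp := by
    rw [mulOp, dif_pos hm]
  rw [h1]
  have h2 := (ContinuousLinearMap.mul ℂ ℂ).coeFn_holder (r := 2) hm.toLp u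
  refine EventuallyEq.trans h2 ?_
  filter_upwards [hm.coeFn_toLp] with x hx
  simp [hx]

theorem mulOp_comp {d : ℕ} {m n : Euc d → ℂ} (hm : MemLp m ∞ volume) (hn : MemLp n ∞ volume) :
    mulOp m ∘L mulOp n = mulOp (fun x => m x * n x) := by
  have hmn : MemLp (fun x => m x * n x) ∞ volume := hn.mul hm
  ext1 u
  apply Lp.ext
  filter_upwards [mulOp_coeFn hm (mulOp n u), mulOp_coeFn hn u, mulOp_coeFn hmn u] with x h1 h2 h3
  rw [ContinuousLinearMap.comp_apply, h1, h2, h3, mul_assoc]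

theorem mulOp_one {d : ℕ} : mulOp (fun _ : Euc d => (1 : ℂ)) = 1 := by
  ext1 u
  apply Lp.ext
  filter_upwards [mulOp_coeFn (memLp_top_const (1 : ℂ)) u] with x h1
  simpa using h1

theorem adjoint_mulOp {d : ℕ} {m : Euc d → ℂ} (hm : MemLp m ∞ volume) :
    ContinuousLinearMap.adjoint (mulOp m) = mulOp (fun x => conj (m x)) := by
  have hm' : MemLp (fun x => conj (m x)) ∞ volume := hm.star
  symm
  rw [ContinuousLinearMap.eq_adjoint_iff]
  intro u v
  rw [L2.inner_def, L2.inner_def]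
  refine integral_congr_ae ?_
  filter_upwards [mulOp_coeFn hm v, mulOp_coeFn hm' u] with x h1 h2
  rw [h1, h2]
  simp
  ring

/-! ### The Fourier transform on `L¹ ∩ L²` -/

/-- The `L²` transform is an abstract extension, while the integral `𝓕⁻ g` is a continuous function.
Both are locally integrable, so it suffices to test them against smooth functions of compact
support. There the transform can be moved to the test function, on one side as tempered
distributions and on the other by Fubini. -/
theorem Lp_fourierInv_eq {d : ℕ} {g : Euc d → ℂ} (h1 : Integrable g volume)
    (h2 : MemLp g 2 volume) :
    (Lp.fourierTransformₗᵢ (Euc d) ℂ).symm h2.toLp =ᵐ[volume] 𝓕⁻ g := by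
  have hL : Continuous fun p : Euc d × Euc d => (-innerₗ (Euc d)) p.1 p.2 := by
    exact continuous_inner.neg
  have hL' : (-innerₗ (Euc d)).flip = -innerₗ (Euc d) := by
    ext x y
    simp [real_inner_comm]
  have hc : Continuous (𝓕⁻ g) := by
    exact VectorFourier.fourierIntegral_continuous Real.continuous_fourierChar hL h1
  refine ae_eq_of_integral_contDiff_smul_eq
    ((Lp.memLp _).locallyIntegrable (by norm_num)) hc.locallyIntegrable ?_
  intro φ hφ hφc
  have hg₁ : HasCompactSupport (Complex.ofRealCLM ∘ φ) := hφc.comp_left rfl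
  have hg₂ : ContDiff ℝ ∞ (Complex.ofRealCLM ∘ φ) := by fun_prop
  let ψ : SchwartzMap (Euc d) ℂ := hg₁.toSchwartzMap hg₂
  have hψ : ∀ x, ψ x = φ x := fun x => by simp [ψ]
  have h3 := congrArg (fun T => T ψ) (Lp.fourierInv_toTemperedDistribution_eq h2.toLp)
  simp only [TemperedDistribution.fourierInv_apply, Lp.toTemperedDistribution_apply] at h3
  have h4 := VectorFourier.integral_fourierIntegral_smul_eq_flip (L := -innerₗ (Euc d))
    (f := (ψ : Euc d → ℂ)) (g := g) (μ := volume) (ν := volume) Real.continuous_fourierChar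
    hL ψ.integrable h1
  rw [hL'] at h4
  calc ∫ x, φ x • (Lp.fourierTransformₗᵢ (Euc d) ℂ).symm h2.toLp x
      = ∫ x, ψ x • (𝓕⁻ h2.toLp : L2 d) x := by
        refine integral_congr_ae (.of_forall fun x => ?_)
        simp only [hψ]
        rfl
    _ = ∫ x, (𝓕⁻ ψ) x • (h2.toLp : L2 d) x := h3.symm
    _ = ∫ x, (𝓕⁻ (ψ : Euc d → ℂ)) x • g x := by
        refine integral_congr_ae ?_
        filter_upwards [h2.coeFn_toLp] with x hx
        rw [hx, ← SchwartzMap.fourierInv_coe]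
    _ = ∫ x, ψ x • (𝓕⁻ g) x := by
        exact h4
    _ = ∫ x, φ x • 𝓕⁻ g x := by
        refine integral_congr_ae (.of_forall fun x => ?_)
        simp [hψ]

/-- The Fourier multiplier with symbol `b`. -/
noncomputable def fourierMul {d : ℕ} (b : Euc d → ℂ) : L2 d →L[ℂ] L2 d :=
  ((Lp.fourierTransformₗᵢ (Euc d) ℂ).symm.toContinuousLinearEquiv : L2 d →L[ℂ] L2 d) ∘L
    mulOp b ∘L ((Lp.fourierTransformₗᵢ (Euc d) ℂ).toContinuousLinearEquiv : L2 d →L[ℂ] L2 d)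

theorem pdo_eq_fourierMul {d : ℕ} (α : ℝ) (a : Euc d → ℂ) :
    pdo α a = fourierMul (fun ν => a ((2 * Real.pi / α) • ν)) := rfl

theorem fourierMul_comp {d : ℕ} {m n : Euc d → ℂ} (hm : MemLp m ∞ volume)
    (hn : MemLp n ∞ volume) :
    fourierMul m ∘L fourierMul n = fourierMul (fun x => m x * n x) := by
  rw [fourierMul, fourierMul, fourierMul, ← mulOp_comp hm hn]
  ext1 u
  simp

theorem fourierMul_one {d : ℕ} : fourierMul (fun _ : Euc d => (1 : ℂ)) = 1 := by
  rw [fourierMul, mulOp_one]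
  ext1 u
  simp

theorem fourierMul_pow {d : ℕ} {m : Euc d → ℂ} (hm : MemLp m ∞ volume) (n : ℕ) :
    fourierMul m ^ n = fourierMul (fun x => m x ^ n) ∧ MemLp (fun x => m x ^ n) ∞ volume := by
  induction n with
  | zero => simpa using ⟨fourierMul_one.symm, memLp_top_const (1 : ℂ)⟩
  | succ n ih =>
    simp_rw [pow_succ]
    refine ⟨?_, hm.mul ih.2⟩
    rw [ih.1, ← fourierMul_comp ih.2 hm]
    rfl

theorem adjoint_fourierMul {d : ℕ} {m : Euc d → ℂ} (hm : MemLp m ∞ volume) :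
    ContinuousLinearMap.adjoint (fourierMul m) = fourierMul (fun x => conj (m x)) := by
  symm
  rw [ContinuousLinearMap.eq_adjoint_iff]
  intro u v
  have h := (ContinuousLinearMap.eq_adjoint_iff _ _).1 (adjoint_mulOp hm).symm
    (Lp.fourierTransformₗᵢ (Euc d) ℂ u) (Lp.fourierTransformₗᵢ (Euc d) ℂ v)
  rw [← (Lp.fourierTransformₗᵢ (Euc d) ℂ).inner_map_map,
    ← (Lp.fourierTransformₗᵢ (Euc d) ℂ).inner_map_map u]
  simpa [fourierMul] using h

theorem Integrable.memLp_two_of_bound {α : Type*} {m0 : MeasurableSpace α} {μ : Measure α}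
    {f : α → ℂ} (hf : Integrable f μ) {C : ℝ} (hC : ∀ x, ‖f x‖ ≤ C) : MemLp f 2 μ := by
  rw [memLp_two_iff_integrable_sq_norm hf.1]
  simp_rw [sq]
  exact hf.norm.bdd_mul hf.1.norm (.of_forall fun x => by simpa using hC x)

/-- The element `y ↦ conj (K (x - y))` of `L²`. -/
noncomputable def kerVec {d : ℕ} {K : Euc d → ℂ} (hK : MemLp K 2 volume) (x : Euc d) : L2 d :=
  MemLp.toLp (fun y => conj (K (x - y)))
    (hK.comp_measurePreserving (volume.measurePreserving_sub_left x)).star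

theorem kerVec_coeFn {d : ℕ} {K : Euc d → ℂ} (hK : MemLp K 2 volume) (x : Euc d) :
    kerVec hK x =ᵐ[volume] fun y => conj (K (x - y)) := MemLp.coeFn_toLp _

theorem inner_kerVec {d : ℕ} {K : Euc d → ℂ} (hK : MemLp K 2 volume) (x : Euc d) {f : L2 d}
    {F : Euc d → ℂ} (hf : f =ᵐ[volume] F) :
    inner ℂ (kerVec hK x) f = ∫ v, K v * F (x - v) := by
  rw [L2.inner_def]
  have h : ∫ y, inner ℂ (kerVec hK x y) (f y) = ∫ y, K (x - y) * F y := by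
    refine integral_congr_ae ?_
    filter_upwards [kerVec_coeFn hK x, hf] with y h1 h2
    rw [h1, h2]
    simp [mul_comm]
  rw [h, ← integral_sub_left_eq_self _ volume x]
  simp

theorem norm_kerVec {d : ℕ} {K : Euc d → ℂ} (hK : MemLp K 2 volume) (x : Euc d) :
    ‖kerVec hK x‖ = ‖kerVec hK 0‖ := by
  have h : ∀ x, ‖kerVec hK x‖ = (eLpNorm K 2 volume).toReal := fun x => by
    rw [kerVec, Lp.norm_toLp]
    congr 1
    rw [← eLpNorm_comp_measurePreserving hK.1 (volume.measurePreserving_sub_left x)]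
    refine eLpNorm_congr_norm_ae (.of_forall fun y => ?_)
    simp
  rw [h, h]

theorem memLp_two_fourierInv {d : ℕ} {g : Euc d → ℂ} (h1 : Integrable g volume)
    (h2 : MemLp g 2 volume) : MemLp (𝓕⁻ g) 2 volume :=
  (memLp_congr_ae (Lp_fourierInv_eq h1 h2)).1 (Lp.memLp _)

/-- By Plancherel: `kerVec hK x` is the inverse transform of the conjugate of `b(ν) exp(2πi ν·x)`,
so pairing it with `f` is the inversion integral of `b · 𝓕 f` at `x`. This makes the multiplier an
operator with explicit kernel vectors, defined at every point `x`. -/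
theorem fourierMul_coeFn {d : ℕ} {b : Euc d → ℂ} (h1 : Integrable b volume) {C : ℝ}
    (hC : ∀ x, ‖b x‖ ≤ C) (hK : MemLp (𝓕⁻ b) 2 volume) (f : L2 d) :
    fourierMul b f =ᵐ[volume] fun x => inner ℂ (kerVec hK x) f := by
  have hb2 : MemLp b 2 volume := Integrable.memLp_two_of_bound h1 hC
  have hbt : MemLp b ∞ volume := memLp_top_of_bound h1.1 C (.of_forall hC)
  set Ff : L2 d := Lp.fourierTransformₗᵢ (Euc d) ℂ f with hFf
  have hg1 : Integrable (fun ν => b ν * Ff ν) volume := hb2.integrable_mul (Lp.memLp Ff)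
  have hg2 : MemLp (fun ν => b ν * Ff ν) 2 volume := (Lp.memLp Ff).mul hbt
  have h3 : fourierMul b f = (Lp.fourierTransformₗᵢ (Euc d) ℂ).symm hg2.toLp := by
    simp only [fourierMul, ContinuousLinearMap.comp_apply]
    change (Lp.fourierTransformₗᵢ (Euc d) ℂ).symm (mulOp b Ff) = _
    congr 1
    apply Lp.ext
    filter_upwards [mulOp_coeFn hbt Ff, hg2.coeFn_toLp] with x hx hx'
    rw [hx, hx']
  rw [h3]
  refine (Lp_fourierInv_eq hg1 hg2).trans (.of_forall fun x => ?_)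
  let bx : Euc d → ℂ := fun ν => conj (b ν) * conj ((Real.fourierChar (inner ℝ ν x) : ℂ))
  have hchar : Continuous fun ν : Euc d => conj ((Real.fourierChar (inner ℝ ν x) : ℂ)) := by
    fun_prop
  have hbx1 : Integrable bx volume := by
    refine (LinearIsometryEquiv.integrable_comp_iff (φ := b) Complex.conjLIE |>.2 h1).mul_bdd (c := 1)
      hchar.aestronglyMeasurable (.of_forall fun ν => ?_)
    exact ((RCLike.norm_conj _).trans (Circle.norm_coe _)).le
  have hbxC : ∀ ν, ‖bx ν‖ ≤ C := fun ν => by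
    rw [norm_mul, RCLike.norm_conj, RCLike.norm_conj, Circle.norm_coe, mul_one]
    exact hC ν
  have hbx2 := Integrable.memLp_two_of_bound hbx1 hbxC
  have h4 : kerVec hK x = (Lp.fourierTransformₗᵢ (Euc d) ℂ).symm hbx2.toLp := by
    apply Lp.ext
    refine (kerVec_coeFn hK x).trans (EventuallyEq.trans ?_ (Lp_fourierInv_eq hbx1 hbx2).symm)
    refine .of_forall fun y => ?_
    simp only [Real.fourierInv_eq, bx]
    rw [← integral_conj]
    refine integral_congr_ae (.of_forall fun ν => ?_)
    simp only [Circle.smul_def, smul_eq_mul, map_mul, inner_sub_right, AddChar.map_sub_eq_div]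
    rw [Circle.coe_div, map_div₀, ← Circle.coe_inv_eq_conj (Real.fourierChar (inner ℝ ν y))]
    simp only [Circle.coe_inv, div_inv_eq_mul]
    ring
  beta_reduce
  rw [h4, ← (Lp.fourierTransformₗᵢ (Euc d) ℂ).inner_map_map, LinearIsometryEquiv.apply_symm_apply,
    ← hFf, L2.inner_def, Real.fourierInv_eq]
  refine integral_congr_ae ?_
  filter_upwards [hbx2.coeFn_toLp] with ν hν
  rw [hν]
  simp [bx, Circle.smul_def]
  ring

/-! ### Products of Hilbert-Schmidt operators -/

section HilbertSchmidt

variable {H : Type*} [NormedAddCommGroup H] [InnerProductSpace ℂ H]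

/-- Orthonormal vectors are at distance `√2`, so balls of radius `1/2` around them are disjoint.
Countability of the basis is needed below to exchange sums with integrals and to index nuclear
decompositions by `ℕ`. -/
theorem Orthonormal.countable_of_secondCountable {ι : Type*} [SecondCountableTopology H]
    {v : ι → H} (hv : Orthonormal ℂ v) : Countable ι := by
  have h : (Set.univ : Set ι).Countable := by
    refine Set.PairwiseDisjoint.countable_of_isOpen (s := fun i => Metric.ball (v i) (1 / 2))
      (fun i _ j _ hij => ?_) (fun i _ => Metric.isOpen_ball)
      (fun i _ => ⟨v i, Metric.mem_ball_self (by norm_num)⟩)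
    refine Metric.ball_disjoint_ball ?_
    have h1 : dist (v i) (v j) ^ 2 = 2 := by
      rw [dist_eq_norm, @norm_sub_sq ℂ, hv.1 i, hv.1 j, hv.2 hij]
      norm_num
    nlinarith [dist_nonneg (x := v i) (y := v j)]
  exact Set.countable_univ_iff.1 h

theorem IsTraceClass.of_countable {ι : Type*} [Countable ι] {T : H →L[ℂ] H} {x y : ι → H}
    (h1 : Summable fun i => ‖x i‖ * ‖y i‖) (h2 : ∀ u, HasSum (fun i => inner ℂ (x i) u • y i) (T u)) :
    IsTraceClass T := by
  obtain ⟨f, hf⟩ := exists_injective_nat ι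
  refine ⟨Function.extend f x 0, Function.extend f y 0, ?_, fun u => ?_⟩
  · convert (summable_extend_zero hf).2 h1 using 1
    ext n
    by_cases hn : ∃ i, f i = n
    · obtain ⟨i, rfl⟩ := hn
      simp [hf.extend_apply]
    · simp [Function.extend_apply' _ _ _ hn]
  · convert (hasSum_extend_zero hf).2 (h2 u) using 1
    ext n
    by_cases hn : ∃ i, f i = n
    · obtain ⟨i, rfl⟩ := hn
      simp [hf.extend_apply]
    · simp [Function.extend_apply' _ _ _ hn]

theorem HilbertBasis.tsum_enorm_inner_sq {ι : Type*} (b : HilbertBasis ι ℂ H) (u : H) :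
    ∑' i, ‖inner ℂ (b i) u‖ₑ ^ 2 = ‖u‖ₑ ^ 2 := by
  have h1 := b.hasSum_inner_mul_inner u u
  have h2 : HasSum (fun i => ‖inner ℂ (b i) u‖ ^ 2) (‖u‖ ^ 2) := by
    have h3 := Complex.reCLM.hasSum h1
    convert h3 using 1
    · ext i
      rw [Complex.reCLM_apply, ← inner_conj_symm u, ← Complex.normSq_eq_conj_mul_self,
        Complex.ofReal_re, Complex.normSq_eq_norm_sq]
    · simp [inner_self_eq_norm_sq_to_K, ← Complex.ofReal_pow]
  have h3 : ∀ i, ‖inner ℂ (b i) u‖ₑ ^ 2 = ENNReal.ofReal (‖inner ℂ (b i) u‖ ^ 2) := fun i => by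
    rw [ENNReal.ofReal_pow (norm_nonneg _), ofReal_norm]
  simp_rw [h3]
  rw [← ENNReal.ofReal_tsum_of_nonneg (fun i => by positivity) h2.summable, h2.tsum_eq,
    ENNReal.ofReal_pow (norm_nonneg _), ofReal_norm]

/-- Both sides are the double sum of the squared matrix entries, by Parseval. In `ℝ≥0∞` the order of
summation can be exchanged freely. -/
theorem tsum_enorm_adjoint_sq [CompleteSpace H] {ι κ : Type*} (b : HilbertBasis ι ℂ H) (c : HilbertBasis κ ℂ H)
    (A : H →L[ℂ] H) :
    ∑' i, ‖ContinuousLinearMap.adjoint A (c i)‖ₑ ^ 2 = ∑' i, ‖A (b i)‖ₑ ^ 2 := by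
  simp_rw [← b.tsum_enorm_inner_sq (ContinuousLinearMap.adjoint A _), ← c.tsum_enorm_inner_sq (A _)]
  rw [ENNReal.tsum_comm]
  refine tsum_congr fun i => tsum_congr fun j => ?_
  rw [ContinuousLinearMap.adjoint_inner_right, ← ofReal_norm, norm_inner_symm, ofReal_norm]

theorem summable_norm_sq_of_tsum_enorm {H : Type*} [NormedAddCommGroup H] {ι : Type*} {f : ι → H} (h : ∑' i, ‖f i‖ₑ ^ 2 ≠ ⊤) :
    Summable fun i => ‖f i‖ ^ 2 := by
  have h1 := ENNReal.summable_toReal h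
  simpa using h1

/-- Expanding `B u` in the basis gives `A* B u = ∑ ⟪B* b_i, u⟫ A* b_i`, a nuclear decomposition
since both families are square summable. -/
theorem isTraceClass_adjoint_comp [CompleteSpace H] {ι : Type*} [Countable ι] (b : HilbertBasis ι ℂ H)
    {A B : H →L[ℂ] H} (hA : ∑' i, ‖A (b i)‖ₑ ^ 2 ≠ ⊤) (hB : ∑' i, ‖B (b i)‖ₑ ^ 2 ≠ ⊤) :
    IsTraceClass (ContinuousLinearMap.adjoint A ∘L B) := by
  rw [← tsum_enorm_adjoint_sq b b] at hA hB
  have hA' := summable_norm_sq_of_tsum_enorm hA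
  have hB' := summable_norm_sq_of_tsum_enorm hB
  refine IsTraceClass.of_countable (x := fun i => ContinuousLinearMap.adjoint B (b i))
    (y := fun i => ContinuousLinearMap.adjoint A (b i)) ?_ fun u => ?_
  · refine (hA'.add hB').of_nonneg_of_le (fun i => by positivity) fun i => ?_
    nlinarith [sq_nonneg (‖ContinuousLinearMap.adjoint B (b i)‖ -
      ‖ContinuousLinearMap.adjoint A (b i)‖), sq_nonneg (‖ContinuousLinearMap.adjoint B (b i)‖),
      sq_nonneg (‖ContinuousLinearMap.adjoint A (b i)‖)]
  · have h := (ContinuousLinearMap.adjoint A).hasSum (b.hasSum_repr (B u))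
    simpa [b.repr_apply_apply, ContinuousLinearMap.adjoint_inner_left] using h

end HilbertSchmidt

/-! ### Carleman operators -/

/-- A bounded operator of the form `u ↦ (z ↦ ⟪s z, u⟫)` with square integrable `s`. -/
theorem exists_carleman {d : ℕ} {s : Euc d → L2 d}
    (hm : ∀ u, AEStronglyMeasurable (fun z => inner ℂ (s z) u) volume) {g : Euc d → ℝ}
    (hg : MemLp g 2 volume) (hsg : ∀ z, ‖s z‖ ≤ g z) :
    ∃ A : L2 d →L[ℂ] L2 d, ∀ u, A u =ᵐ[volume] fun z => inner ℂ (s z) u := by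
  have hbd : ∀ u, ∀ z, ‖inner ℂ (s z) u‖ ≤ ‖u‖ * ‖g z‖ := fun u z => by
    refine (norm_inner_le_norm _ _).trans ?_
    rw [mul_comm]
    gcongr
    exact (hsg z).trans (le_abs_self _)
  have hL : ∀ u, MemLp (fun z => inner ℂ (s z) u) 2 volume := fun u =>
    hg.of_le_mul (hm u) (.of_forall (hbd u))
  refine ⟨LinearMap.mkContinuous
    { toFun := fun u => (hL u).toLp
      map_add' := fun u v => ?_
      map_smul' := fun c u => ?_ } ‖hg.toLp‖ fun u => ?_, fun u => ?_⟩
  · rw [← MemLp.toLp_add]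
    congr 1
    ext z
    simp [inner_add_right]
  · rw [RingHom.id_apply, ← MemLp.toLp_const_smul]
    congr 1
    ext z
    simp [inner_smul_right]
  · rw [mul_comm]
    refine Lp.norm_le_mul_norm_of_ae_le_mul (c := ‖u‖) ?_
    filter_upwards [(hL u).coeFn_toLp, hg.coeFn_toLp] with z h1 h2
    simp only [LinearMap.coe_mk, AddHom.coe_mk]
    rw [h1, h2]
    exact hbd u z
  · exact (hL u).coeFn_toLp

/-- By Tonelli and Parseval the Hilbert-Schmidt norm squared is `∫ ‖s z‖² dz`. -/
theorem tsum_enorm_carleman {d : ℕ} {s : Euc d → L2 d} {g : Euc d → ℝ}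
    (hg : MemLp g 2 volume) (hsg : ∀ z, ‖s z‖ ≤ g z) {A : L2 d →L[ℂ] L2 d}
    (hA : ∀ u, A u =ᵐ[volume] fun z => inner ℂ (s z) u) {ι : Type*} [Countable ι]
    (b : HilbertBasis ι ℂ (L2 d)) : ∑' i, ‖A (b i)‖ₑ ^ 2 ≠ ⊤ := by
  have h1 : ∀ u : L2 d, ‖u‖ₑ ^ 2 = ∫⁻ z, ‖u z‖ₑ ^ 2 := fun u => by
    have h2 := eLpNorm_nnreal_pow_eq_lintegral (f := u) (μ := volume) (p := 2) (by norm_num)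
    simp only [NNReal.coe_ofNat, ENNReal.coe_ofNat] at h2
    rw [Lp.enorm_def]
    exact_mod_cast h2
  have h3 : ∀ i, ‖A (b i)‖ₑ ^ 2 = ∫⁻ z, ‖inner ℂ (s z) (b i)‖ₑ ^ 2 := fun i => by
    rw [h1]
    refine lintegral_congr_ae ?_
    filter_upwards [hA (b i)] with z hz
    rw [hz]
  have h4 : ∑' i, ‖A (b i)‖ₑ ^ 2 = ∫⁻ z, ‖s z‖ₑ ^ 2 := by
    simp_rw [h3]
    rw [← lintegral_tsum]
    · refine lintegral_congr fun z => ?_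
      rw [← b.tsum_enorm_inner_sq]
      refine tsum_congr fun i => ?_
      rw [← ofReal_norm, norm_inner_symm, ofReal_norm]
    · intro i
      exact (((Lp.memLp _).1.congr (hA (b i))).enorm).pow_const 2
  rw [h4]
  have h5 : ∫⁻ z, ‖s z‖ₑ ^ 2 ≤ ∫⁻ z, ‖g z‖ₑ ^ 2 := by
    refine lintegral_mono fun z => ?_
    gcongr
    exact enorm_le_iff_norm_le.2 ((hsg z).trans (le_abs_self _))
  refine (h5.trans_lt ?_).ne
  have h2 := eLpNorm_nnreal_pow_eq_lintegral (f := g) (μ := volume) (p := 2) (by norm_num)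
  simp only [NNReal.coe_ofNat, ENNReal.coe_ofNat] at h2
  have h6 : ∫⁻ z, ‖g z‖ₑ ^ 2 = eLpNorm g 2 volume ^ 2 := by exact_mod_cast h2.symm
  rw [h6]
  exact ENNReal.pow_lt_top hg.2

theorem L2.norm_sq_eq_integral {d : ℕ} (u : L2 d) : ‖u‖ ^ 2 = ∫ z, ‖u z‖ ^ 2 := by
  have h := L2.inner_def (𝕜 := ℂ) u u
  rw [inner_self_eq_norm_sq_to_K] at h
  simp only [inner_self_eq_norm_sq_to_K, Complex.coe_algebraMap, ← Complex.ofReal_pow] at h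
  rw [integral_complex_ofReal] at h
  exact_mod_cast h

theorem L2.integrable_norm_sq {d : ℕ} (u : L2 d) : Integrable (fun z => ‖u z‖ ^ 2) volume :=
  (memLp_two_iff_integrable_sq_norm (Lp.memLp u).1).1 (Lp.memLp u)

/-- The trace of a product of two integral operators. -/
theorem trace_carleman {d : ℕ} {P R : L2 d →L[ℂ] L2 d} {s r : Euc d → L2 d}
    (hP : ∀ u, P u =ᵐ[volume] fun z => inner ℂ (s z) u)
    (hR : ∀ u, R u =ᵐ[volume] fun z => inner ℂ (r z) u)
    {w : Euc d → ℝ} (hw : Continuous w) (hw0 : ∀ z, 0 < w z) {g h : Euc d → ℝ}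
    (hg : MemLp g 2 volume) (hsg : ∀ z, w z * ‖s z‖ ≤ g z)
    (hh : MemLp h 2 volume) (hrh : ∀ z, (w z)⁻¹ * ‖r z‖ ≤ h z) :
    IsTraceClass (ContinuousLinearMap.adjoint P ∘L R) ∧
      opTrace (ContinuousLinearMap.adjoint P ∘L R) = ∫ z, inner ℂ (r z) (s z) := by
  have hwi : Continuous fun z => (w z)⁻¹ := hw.inv₀ fun z => (hw0 z).ne'
  have hmP : ∀ u, AEStronglyMeasurable (fun z => inner ℂ (s z) u) volume := fun u =>
    (Lp.memLp _).1.congr (hP u)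
  have hmR : ∀ u, AEStronglyMeasurable (fun z => inner ℂ (r z) u) volume := fun u =>
    (Lp.memLp _).1.congr (hR u)
  have hsg' : ∀ z, ‖((w z : ℝ) : ℂ) • s z‖ ≤ g z := fun z => by
    rw [norm_smul, Complex.norm_real, Real.norm_of_nonneg (hw0 z).le]
    exact hsg z
  have hrh' : ∀ z, ‖((w z : ℝ) : ℂ)⁻¹ • r z‖ ≤ h z := fun z => by
    rw [norm_smul, norm_inv, Complex.norm_real, Real.norm_of_nonneg (hw0 z).le]
    exact hrh z
  have hmA : ∀ u, AEStronglyMeasurable (fun z => inner ℂ (((w z : ℝ) : ℂ) • s z) u) volume := by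
    intro u
    simp only [inner_smul_left, Complex.conj_ofReal]
    exact (Complex.continuous_ofReal.comp hw).aestronglyMeasurable.mul (hmP u)
  have hmB : ∀ u, AEStronglyMeasurable (fun z => inner ℂ (((w z : ℝ) : ℂ)⁻¹ • r z) u) volume := by
    intro u
    simp only [inner_smul_left, Complex.conj_ofReal, ← Complex.ofReal_inv]
    exact (Complex.continuous_ofReal.comp hwi).aestronglyMeasurable.mul (hmR u)
  obtain ⟨A, hA⟩ := exists_carleman hmA hg hsg'
  obtain ⟨B, hB⟩ := exists_carleman hmB hh hrh'
  have hwz : ∀ z, ((w z : ℝ) : ℂ) ≠ 0 := fun z => by exact_mod_cast (hw0 z).ne'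
  -- The weights `w` and `w⁻¹` cancel pointwise in the pairing. Hence `R` itself need not be
  -- Hilbert-Schmidt: decay is borrowed from `P`.
  have hT : ContinuousLinearMap.adjoint P ∘L R = ContinuousLinearMap.adjoint A ∘L B := by
    ext1 u
    refine ext_inner_left ℂ fun v => ?_
    simp only [ContinuousLinearMap.comp_apply, ContinuousLinearMap.adjoint_inner_right]
    rw [L2.inner_def, L2.inner_def]
    refine integral_congr_ae ?_
    filter_upwards [hP v, hR u, hA v, hB u] with z h1 h2 h3 h4
    rw [h1, h2, h3, h4]
    simp only [inner_smul_left, map_inv₀, Complex.conj_ofReal, RCLike.inner_apply, map_mul]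
    field_simp [hwz z]
  obtain ⟨o, b, -⟩ := exists_hilbertBasis ℂ (L2 d)
  have : Fact ((2 : ℝ≥0∞) ≠ ⊤) := ⟨by norm_num⟩
  have : Countable o := b.orthonormal.countable_of_secondCountable
  have hA2 := tsum_enorm_carleman hg hsg' hA b
  have hB2 := tsum_enorm_carleman hh hrh' hB b
  have htc := isTraceClass_adjoint_comp b hA2 hB2
  rw [hT]
  refine ⟨htc, ?_⟩
  have h1 := hasSum_opTrace b htc
  refine h1.unique ?_
  have h2 : ∀ i, inner ℂ (b i) ((ContinuousLinearMap.adjoint A ∘L B) (b i))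
      = ∫ z, inner ℂ (A (b i) z) (B (b i) z) := fun i => by
    rw [ContinuousLinearMap.comp_apply, ContinuousLinearMap.adjoint_inner_right, L2.inner_def]
  have h3' : ∀ i, (fun z => inner ℂ (A (b i) z) (B (b i) z))
      =ᵐ[volume] fun z => inner ℂ (r z) (b i) * inner ℂ (b i) (s z) := fun i => by
    filter_upwards [hA (b i), hB (b i)] with z h3 h4
    rw [h3, h4]
    simp only [inner_smul_left, map_inv₀, Complex.conj_ofReal, RCLike.inner_apply, map_mul,
      inner_conj_symm]
    field_simp [hwz z]
  have h4 : (fun i => inner ℂ (b i) ((ContinuousLinearMap.adjoint A ∘L B) (b i)))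
      = fun i => ∫ z, inner ℂ (r z) (b i) * inner ℂ (b i) (s z) := by
    ext i
    rw [h2, integral_congr_ae (h3' i)]
  rw [h4]
  -- The sum over the basis is taken under the integral, where Parseval turns it into `⟪r z, s z⟫`.
  -- The norms are summable because `‖A b_i‖² + ‖B b_i‖²` is.
  have h5 := hasSum_integral_of_summable_integral_norm (μ := volume)
    (F := fun i z => inner ℂ (r z) (b i) * inner ℂ (b i) (s z)) (fun i => ?_) ?_
  · simp only [b.tsum_inner_mul_inner] at h5
    exact h5
  · exact (L2.integrable_inner _ _).congr (h3' i)
  · refine ((summable_norm_sq_of_tsum_enorm hA2).add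
      (summable_norm_sq_of_tsum_enorm hB2)).of_nonneg_of_le
      (fun i => integral_nonneg fun z => norm_nonneg _) fun i => ?_
    rw [L2.norm_sq_eq_integral, L2.norm_sq_eq_integral,
      ← integral_add (L2.integrable_norm_sq _) (L2.integrable_norm_sq _)]
    refine integral_mono_ae ((L2.integrable_inner _ _).congr (h3' i)).norm
      ((L2.integrable_norm_sq _).add (L2.integrable_norm_sq _)) ?_
    filter_upwards [h3' i] with z hz
    rw [← hz]
    refine (norm_inner_le_norm _ _).trans ?_
    nlinarith [sq_nonneg (‖A (b i) z‖ - ‖B (b i) z‖), sq_nonneg (‖A (b i) z‖),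
      sq_nonneg (‖B (b i) z‖)]

/-! ### Decay of the kernels -/

/-- The weight `(1 + |z|)^(-N)`. -/
noncomputable def decay {V : Type*} [NormedAddCommGroup V] (N : ℕ) (z : V) : ℝ :=
  ((1 + ‖z‖) ^ N)⁻¹

section decay

variable {V : Type*} [NormedAddCommGroup V]

theorem decay_pos (N : ℕ) (z : V) : 0 < decay N z := by
  unfold decay; positivity

theorem decay_le_one (N : ℕ) (z : V) : decay N z ≤ 1 := by
  unfold decay
  exact inv_le_one_of_one_le₀ (one_le_pow₀ (by linarith [norm_nonneg z]))

theorem continuous_decay (N : ℕ) : Continuous (decay N : V → ℝ) := by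
  unfold decay
  refine Continuous.inv₀ (by fun_prop) fun z => ?_
  positivity

theorem decay_add (M N : ℕ) (z : V) : decay (M + N) z = decay M z * decay N z := by
  unfold decay
  rw [pow_add, mul_inv]

theorem pow_mul_decay (M N : ℕ) (z : V) : (1 + ‖z‖) ^ M * decay (M + N) z = decay N z := by
  rw [decay_add, ← mul_assoc, decay, mul_inv_cancel₀ (by positivity), one_mul]

theorem decay_sub_le (N : ℕ) (x z : V) {r : ℝ} (hx : ‖x‖ ≤ r) :
    decay N (x - z) ≤ (1 + r) ^ N * decay N z := by
  have hr : 0 ≤ r := (norm_nonneg x).trans hx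
  unfold decay
  rw [inv_le_iff_one_le_mul₀ (by positivity), mul_assoc, mul_comm, mul_assoc,
    inv_mul_eq_div, one_le_div (by positivity), ← mul_pow]
  gcongr
  have h1 : ‖z‖ ≤ ‖x‖ + ‖x - z‖ := by
    have := norm_sub_le x (x - z)
    simpa using this
  nlinarith [norm_nonneg (x - z), norm_nonneg z, norm_nonneg x]

theorem integrable_decay {d N : ℕ} (h : d < N) : Integrable (decay N : Euc d → ℝ) volume := by
  have h1 := integrable_one_add_norm (E := Euc d) (μ := volume) (r := N)
    (by simpa using h)
  convert h1 using 2 with z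
  rw [decay, Real.rpow_neg (by positivity), Real.rpow_natCast]

theorem memLp_two_decay {d N : ℕ} (h : d < N) : MemLp (decay N : Euc d → ℝ) 2 volume := by
  rw [memLp_two_iff_integrable_sq (continuous_decay N).aestronglyMeasurable]
  have h1 : ∀ z : Euc d, decay N z ^ 2 = decay (N + N) z := fun z => by rw [decay_add, sq]
  simp_rw [h1]
  exact integrable_decay (by omega)

end decay

/-! ### Integrability of symbols and decay of their kernels, uniformly over the class -/

section symbolClass

variable {d : ℕ} {β : ℝ} {C : ℕ → ℝ}

theorem integrable_bracket (hβ : (d : ℝ) < β) :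
    Integrable (fun ξ : Euc d => √(1 + ‖ξ‖ ^ 2) ^ (-β)) volume := by
  have h := integrable_rpow_neg_one_add_norm_sq (E := Euc d) (μ := volume) (r := β) (by simpa using hβ)
  convert h using 2 with ξ
  rw [Real.sqrt_eq_rpow, ← Real.rpow_mul (by positivity)]
  congr 1
  ring

theorem bracket_le_one (hβ : 0 ≤ β) (ξ : Euc d) : √(1 + ‖ξ‖ ^ 2) ^ (-β) ≤ 1 := by
  refine Real.rpow_le_one_of_one_le_of_nonpos ?_ (by linarith)
  rw [Real.one_le_sqrt]
  nlinarith [sq_nonneg ‖ξ‖]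

theorem symbolClass.norm_le {a : Euc d → ℂ} (ha : a ∈ symbolClass d β C) (ξ : Euc d) :
    ‖a ξ‖ ≤ C 0 * √(1 + ‖ξ‖ ^ 2) ^ (-β) := by
  simpa using ha.2 0 ξ

theorem symbolClass.nonneg {a : Euc d → ℂ} (ha : a ∈ symbolClass d β C) (m : ℕ) : 0 ≤ C m := by
  have h := (norm_nonneg _).trans (ha.2 m 0)
  simpa using h

theorem symbolClass.norm_le_const (hβ : 0 ≤ β) {a : Euc d → ℂ} (ha : a ∈ symbolClass d β C)
    (ξ : Euc d) : ‖a ξ‖ ≤ C 0 :=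
  (symbolClass.norm_le ha ξ).trans
    (mul_le_of_le_one_right (symbolClass.nonneg ha 0) (bracket_le_one hβ ξ))

theorem symbolClass.continuous {a : Euc d → ℂ} (ha : a ∈ symbolClass d β C) : Continuous a :=
  ha.1.continuous

theorem symbolClass.integrable_iteratedFDeriv (hβ : (d : ℝ) < β) {a : Euc d → ℂ}
    (ha : a ∈ symbolClass d β C) (m : ℕ) : Integrable (iteratedFDeriv ℝ m a) volume := by
  refine ((integrable_bracket hβ).const_mul (C m)).mono'
    (ha.1.continuous_iteratedFDeriv (by exact_mod_cast le_top)).aestronglyMeasurable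
    (.of_forall (ha.2 m))

theorem symbolClass.integrable (hβ : (d : ℝ) < β) {a : Euc d → ℂ} (ha : a ∈ symbolClass d β C) :
    Integrable a volume := by
  refine ((integrable_bracket hβ).const_mul (C 0)).mono'
    ha.1.continuous.aestronglyMeasurable (.of_forall (symbolClass.norm_le ha))

/-- Integration by parts trades `‖z‖^n` for derivatives of `a`, which are integrable with bounds `C
m` because `β > d`. The constant depends only on the class, not on `a`; all the uniformity of the
theorem originates here. -/
theorem symbolClass.norm_fourierInv_le (hβ : (d : ℝ) < β) (C : ℕ → ℝ) (N : ℕ) :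
    ∃ c : ℝ, 0 ≤ c ∧ ∀ a ∈ symbolClass d β C, ∀ z, ‖𝓕⁻ a z‖ ≤ c * decay N z := by
  set I := ∫ ξ : Euc d, √(1 + ‖ξ‖ ^ 2) ^ (-β) with hI
  have hI0 : 0 ≤ I := integral_nonneg fun ξ => by positivity
  have key : ∀ n, ∀ a ∈ symbolClass d β C, ∀ z, ‖z‖ ^ n * ‖𝓕⁻ a z‖ ≤
      2 ^ n * ∑ m ∈ Finset.range (n + 1), |C m| * I := by
    intro n a ha z
    have h := Real.pow_mul_norm_iteratedFDeriv_fourier_le (K := 0) (N := ⊤) (f := a)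
      (by exact_mod_cast ha.1) (fun k m hk _ => ?_) (k := 0) (n := n) le_rfl le_top (-z)
    · simp only [norm_neg, norm_iteratedFDeriv_zero, pow_zero, one_mul, Nat.cast_zero, mul_zero,
        zero_add, Finset.range_one, Finset.singleton_product, Finset.sum_map] at h
      rw [Real.fourierInv_eq_fourier_neg]
      refine h.trans ?_
      gcongr with m hm
      simp only [Function.Embedding.coeFn_mk, pow_zero, one_mul]
      rw [hI, ← integral_const_mul]
      refine integral_mono (symbolClass.integrable_iteratedFDeriv hβ ha m).norm
        ((integrable_bracket hβ).const_mul _) fun ξ => (ha.2 m ξ).trans ?_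
      gcongr
      exact le_abs_self _
    · have hk0 : k = 0 := by simpa using hk
      simpa [hk0] using (symbolClass.integrable_iteratedFDeriv hβ ha m).norm
  set B : ℕ → ℝ := fun n => 2 ^ n * ∑ m ∈ Finset.range (n + 1), |C m| * I with hB
  have hB0 : ∀ n, 0 ≤ B n := fun n => by positivity
  refine ⟨2 ^ N * (B 0 + B N), by have := hB0 0; have := hB0 N; positivity, fun a ha z => ?_⟩
  have h0 := key 0 a ha z
  have hN := key N a ha z
  rw [pow_zero, one_mul] at h0
  rw [decay, ← div_eq_mul_inv, le_div_iff₀ (by positivity)]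
  have h1 : (1 + ‖z‖) ^ N ≤ 2 ^ N * (1 + ‖z‖ ^ N) := by
    rcases le_total ‖z‖ 1 with hz | hz
    · calc (1 + ‖z‖) ^ N ≤ 2 ^ N := by gcongr; linarith
        _ ≤ 2 ^ N * (1 + ‖z‖ ^ N) := le_mul_of_one_le_right (by positivity)
            (by linarith [pow_nonneg (norm_nonneg z) N])
    · calc (1 + ‖z‖) ^ N ≤ (2 * ‖z‖) ^ N := by gcongr; linarith
        _ = 2 ^ N * ‖z‖ ^ N := mul_pow _ _ _
        _ ≤ 2 ^ N * (1 + ‖z‖ ^ N) := by gcongr; linarith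
  calc ‖𝓕⁻ a z‖ * (1 + ‖z‖) ^ N ≤ ‖𝓕⁻ a z‖ * (2 ^ N * (1 + ‖z‖ ^ N)) := by gcongr
    _ = 2 ^ N * (‖𝓕⁻ a z‖ + ‖z‖ ^ N * ‖𝓕⁻ a z‖) := by ring
    _ ≤ 2 ^ N * (B 0 + B N) := by gcongr

end symbolClass

theorem continuous_fourierInv {d : ℕ} {a : Euc d → ℂ} (h : Integrable a volume) :
    Continuous (𝓕⁻ a) := by
  have hL : Continuous fun p : Euc d × Euc d => (-innerₗ (Euc d)) p.1 p.2 := by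
    exact continuous_inner.neg
  exact VectorFourier.fourierIntegral_continuous Real.continuous_fourierChar hL h

theorem fourierInv_comp_smul {d : ℕ} (a : Euc d → ℂ) {r : ℝ} (hr : 0 < r) (z : Euc d) :
    𝓕⁻ (fun ν => a (r⁻¹ • ν)) z = (r : ℂ) ^ d * 𝓕⁻ a (r • z) := by
  rw [Real.fourierInv_eq, Real.fourierInv_eq]
  have h := Measure.integral_comp_smul (volume : Measure (Euc d))
    (fun v => Real.fourierChar (inner ℝ v (r • z)) • a v) r⁻¹
  rw [abs_of_pos (by positivity)] at h
  simp only [inner_smul_left, inner_smul_right, RCLike.conj_to_real, finrank_euclideanSpace,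
    Fintype.card_fin, inv_pow, inv_inv, Complex.real_smul,
    mul_inv_cancel_left₀ hr.ne'] at h ⊢
  rw [h]
  push_cast
  rfl

theorem fourierInv_conj {d : ℕ} (a : Euc d → ℂ) (z : Euc d) :
    𝓕⁻ (fun ν => conj (a ν)) z = conj (𝓕⁻ a (-z)) := by
  rw [Real.fourierInv_eq, Real.fourierInv_eq, ← integral_conj]
  refine integral_congr_ae (.of_forall fun ν => ?_)
  simp only [Circle.smul_def, smul_eq_mul, map_mul, inner_neg_right, AddChar.map_neg_eq_inv]
  rw [← Circle.coe_inv_eq_conj, inv_inv]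

/-! ### Iterated convolutions with cut-offs -/

/-- `iterConv K c n F` is `(c 𝒜)^n F`, where `𝒜` is the convolution with `K`. -/
noncomputable def iterConv {V : Type*} [AddCommGroup V] [MeasureSpace V] (K c : V → ℂ) :
    ℕ → (V → ℂ) → V → ℂ
  | 0, F => F
  | n + 1, F => fun z => c z * ∫ v, K v * iterConv K c n F (z - v)

/-- The partial sum of the first `m` entries of `v`. -/
def psum {n : ℕ} {V : Type*} [AddCommMonoid V] (v : Fin n → V) (m : ℕ) : V :=
  ∑ i, if i.val < m then v i else 0

theorem psum_of_le {n m : ℕ} (h : n ≤ m) {V : Type*} [AddCommMonoid V] (v : Fin n → V) :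
    psum v m = ∑ i, v i := by
  refine Finset.sum_congr rfl fun i _ => ?_
  rw [if_pos (by omega)]

theorem psum_snoc {n m : ℕ} (h : m ≤ n) {V : Type*} [AddCommMonoid V] (v : Fin n → V) (x : V) :
    psum (Fin.snoc (α := fun _ => V) v x) m = psum v m := by
  rw [psum, Fin.sum_univ_castSucc]
  simp only [Fin.val_castSucc, Fin.snoc_castSucc, Fin.val_last, Fin.snoc_last]
  rw [if_neg (by omega), add_zero]
  rfl

theorem continuous_psum {n : ℕ} {V : Type*} [AddCommMonoid V] [TopologicalSpace V]
    [ContinuousAdd V] (m : ℕ) : Continuous fun v : Fin n → V => psum v m := by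
  unfold psum
  refine continuous_finsetSum _ fun i _ => ?_
  split_ifs <;> fun_prop

/-! ### Fubini for the last entry of a tuple -/

section integral_snoc

variable {V : Type*} [MeasureSpace V] [SigmaFinite (volume : Measure V)]
  {F : Type*} [NormedAddCommGroup F]

theorem measurePreserving_snoc (n : ℕ) :
    MeasurePreserving (fun p : V × (Fin n → V) => (Fin.snoc (α := fun _ => V) p.2 p.1 : Fin (n + 1) → V))
      volume volume := by
  have h := (volume_preserving_piFinSuccAbove (fun _ : Fin (n + 1) => V) (Fin.last n)).symm
  convert h using 1
  all_goals
    first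
    | rfl
    | funext p
      simp [MeasurableEquiv.piFinSuccAbove]
      rfl

theorem integrable_comp_snoc {n : ℕ} {G : (Fin (n + 1) → V) → F} (hG : Integrable G volume) :
    Integrable (fun p : V × (Fin n → V) => G (Fin.snoc (α := fun _ => V) p.2 p.1))
      (volume.prod volume) :=
  (measurePreserving_snoc n).integrable_comp_of_integrable hG

theorem integral_snoc [NormedSpace ℝ F] {n : ℕ} {G : (Fin (n + 1) → V) → F} (hG : Integrable G volume) :
    ∫ v, G v = ∫ x, ∫ v : Fin n → V, G (Fin.snoc (α := fun _ => V) v x) := by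
  have h := (volume_preserving_piFinSuccAbove (fun _ : Fin (n + 1) => V) (Fin.last n)).symm
  rw [← h.integral_comp' G]
  have h2 : ∀ p : V × (Fin n → V),
      ((MeasurableEquiv.piFinSuccAbove (fun _ : Fin (n + 1) => V) (Fin.last n)).symm p)
        = Fin.snoc (α := fun _ => V) p.2 p.1 := fun p => by
    ext i
    simp [MeasurableEquiv.piFinSuccAbove]
  simp_rw [h2]
  exact integral_prod _ (integrable_comp_snoc hG)

end integral_snoc

theorem integrable_prod_mul_bdd {d n : ℕ} {K : Euc d → ℂ} (hK : Integrable K volume)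
    {g : (Fin n → Euc d) → ℂ} (hg : Measurable g) {B : ℝ} (hB : ∀ v, ‖g v‖ ≤ B) :
    Integrable (fun v : Fin n → Euc d => (∏ i, K (v i)) * g v) volume :=
  (Integrable.fintype_prod (f := fun _ => K) fun _ => hK).mul_bdd hg.aestronglyMeasurable
    (.of_forall hB)

theorem norm_prod_le_one {ι : Type*} (s : Finset ι) {f : ι → ℂ} (hf : ∀ i, ‖f i‖ ≤ 1) :
    ‖∏ i ∈ s, f i‖ ≤ 1 := by
  rw [norm_prod]
  exact Finset.prod_le_one (fun i _ => norm_nonneg _) fun i _ => hf i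

theorem measurable_sum_fin {d n : ℕ} : Measurable fun v : Fin n → Euc d => ∑ i, v i := by
  fun_prop

theorem measurable_psum {d n : ℕ} (m : ℕ) : Measurable fun v : Fin n → Euc d => psum v m :=
  (continuous_psum m).measurable

/-- The walk is parametrized from its innermost point `z - ∑ v` outwards. The outermost convolution
variable is then the last entry of `v`, so adding it leaves the earlier partial sums unchanged and
the induction closes. The factor with `j = n` is the cut-off at `z` itself. -/
theorem iterConv_eq {d : ℕ} {K c F : Euc d → ℂ} (hK : Integrable K volume) (hc : Measurable c)
    (hc1 : ∀ x, ‖c x‖ ≤ 1) (hF : Measurable F) {B : ℝ} (hB : ∀ x, ‖F x‖ ≤ B) (n : ℕ)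
    (z : Euc d) :
    iterConv K c n F z = ∫ v : Fin n → Euc d, (∏ i, K (v i)) *
      ((∏ j : Fin n, c (z - ∑ i, v i + psum v (j + 1))) * F (z - ∑ i, v i)) := by
  induction n generalizing z with
  | zero =>
    rw [integral_unique]
    simp [iterConv, measureReal_def, volume_pi]
  | succ n ih =>
    have hg : Measurable fun v : Fin (n + 1) → Euc d =>
        ((∏ j : Fin (n + 1), c (z - ∑ i, v i + psum v (j + 1))) * F (z - ∑ i, v i)) := by
      refine Measurable.mul (Finset.measurable_prod _ fun j _ => hc.comp ?_) (hF.comp ?_)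
      · exact (measurable_sum_fin.const_sub z).add (measurable_psum _)
      · exact measurable_sum_fin.const_sub z
    rw [integral_snoc (integrable_prod_mul_bdd hK hg (B := B) fun v => ?_)]
    · rw [iterConv]
      beta_reduce
      rw [← integral_const_mul]
      refine integral_congr_ae (.of_forall fun x => ?_)
      beta_reduce
      rw [ih, ← integral_const_mul, ← integral_const_mul]
      refine integral_congr_ae (.of_forall fun v => ?_)
      simp only [Fin.prod_univ_castSucc, Fin.sum_univ_castSucc, Fin.snoc_castSucc, Fin.snoc_last,
        Fin.val_castSucc, Fin.val_last]
      rw [psum_of_le le_rfl, Fin.sum_univ_castSucc]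
      simp only [Fin.snoc_castSucc, Fin.snoc_last, sub_add_cancel]
      have h1 : ∀ j : Fin n, psum (Fin.snoc (α := fun _ => Euc d) v x) (j + 1) = psum v (j + 1) :=
        fun j => psum_snoc (by omega) v x
      have h2 : z - (∑ i, v i + x) = z - x - ∑ i, v i := by abel
      simp_rw [h1, h2]
      ring
    · rw [norm_mul]
      calc _ ≤ 1 * B := by
            gcongr
            · exact norm_prod_le_one _ fun j => hc1 _
            · exact hB _
        _ = B := one_mul B

theorem comp_pow_coeFn {d : ℕ} {b c : Euc d → ℂ} (h1 : Integrable b volume) {C : ℝ}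
    (hC : ∀ x, ‖b x‖ ≤ C) (hK : MemLp (𝓕⁻ b) 2 volume) (hc : MemLp c ∞ volume) (n : ℕ)
    {u : L2 d} {F : Euc d → ℂ} (hu : u =ᵐ[volume] F) :
    ((mulOp c ∘L fourierMul b) ^ n) u =ᵐ[volume] iterConv (𝓕⁻ b) c n F := by
  induction n with
  | zero => simpa [iterConv] using hu
  | succ n ih =>
    rw [pow_succ']
    change mulOp c (fourierMul b (((mulOp c ∘L fourierMul b) ^ n) u)) =ᵐ[volume] _
    filter_upwards [mulOp_coeFn hc (fourierMul b (((mulOp c ∘L fourierMul b) ^ n) u)),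
      fourierMul_coeFn h1 hC hK (((mulOp c ∘L fourierMul b) ^ n) u)] with z h2 h3
    rw [h2, h3, inner_kerVec hK z ih]
    rfl

theorem mul_mul_pow_idempotent {R : Type*} [Monoid R] {X A : R} (hX : X * X = X) (n : ℕ) :
    X * (X * A * X) ^ (n + 1) * X = X * A * (X * A) ^ n * X := by
  have h : (X * A * X) ^ (n + 1) = (X * A) ^ (n + 1) * X := by
    induction n with
    | zero => simp
    | succ n ih =>
      rw [pow_succ, ih, pow_succ (X * A) (n + 1)]
      simp only [mul_assoc]
      rw [← mul_assoc X X, hX]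
  rw [h, pow_succ']
  simp only [mul_assoc]
  rw [hX, ← mul_assoc X X, hX]

theorem memLp_top_chi {d : ℕ} {S : Set (Euc d)} (hS : MeasurableSet S) :
    MemLp (chi S) ∞ volume :=
  memLp_top_of_bound (measurable_one.indicator hS).aestronglyMeasurable 1
    (.of_forall fun x => by
      by_cases hx : x ∈ S <;> simp [chi, hx])

theorem norm_chi_le {d : ℕ} (S : Set (Euc d)) (x : Euc d) : ‖chi S x‖ ≤ 1 := by
  by_cases hx : x ∈ S <;> simp [chi, hx]

theorem measurable_chi {d : ℕ} {S : Set (Euc d)} (hS : MeasurableSet S) :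
    Measurable (chi S) := measurable_one.indicator hS

theorem chi_mul_chi {d : ℕ} (S : Set (Euc d)) (x : Euc d) : chi S x * chi S x = chi S x := by
  by_cases hx : x ∈ S <;> simp [chi, hx]

/-- The idempotent `X = χ` collapses `X (X A X)^p X` to `X A (X A)^(p-1) X`. One factor `A` is split
off on the left: with the compactly supported `φ χ` it forms the Hilbert-Schmidt factor. The free
power is written with cut-off `1` so that both powers are iterated convolutions of the same kind. -/
theorem mulOp_comp_diffOp {d : ℕ} {φ : Euc d → ℂ} (hφ : MemLp φ ∞ volume) {S : Set (Euc d)}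
    (hS : MeasurableSet S) (α : ℝ) {a : Euc d → ℂ} {b : Euc d → ℂ}
    (hab : ∀ ν, b ν = a ((2 * Real.pi / α) • ν)) (hb : MemLp b ∞ volume) (q : ℕ) :
    mulOp φ ∘L diffOp α a S (q + 2) = mulOp (fun x => φ x * chi S x) ∘L fourierMul b ∘L
      (((mulOp (chi S) ∘L fourierMul b) ^ (q + 1) -
        (mulOp (fun _ => 1) ∘L fourierMul b) ^ (q + 1)) ∘L mulOp (chi S)) := by
  have hb' : (fun ν => a ((2 * Real.pi / α) • ν)) = b := funext fun ν => (hab ν).symm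
  have hX : mulOp (chi S) * mulOp (chi S) = mulOp (chi S) := by
    change mulOp (chi S) ∘L mulOp (chi S) = _
    rw [mulOp_comp (memLp_top_chi hS) (memLp_top_chi hS)]
    simp_rw [chi_mul_chi]
  have h2 : pdo α (gPow (q + 2) ∘ a) = fourierMul b ^ (q + 2) := by
    rw [(fourierMul_pow hb (q + 2)).1, pdo_eq_fourierMul]
    simp [gPow, hab]
  rw [← mulOp_comp hφ (memLp_top_chi hS), mulOp_one, diffOp, wienerHopf, wienerHopf, h2,
    pdo_eq_fourierMul, hb']
  have h3 := mul_mul_pow_idempotent (A := fourierMul b) hX (q + 1)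
  set X := mulOp (chi S)
  set A := fourierMul b
  change mulOp φ * (X * ((X * (A * X)) ^ (q + 2) * X) - X * (A ^ (q + 2) * X)) =
    (mulOp φ * X) * (A * (((X * A) ^ (q + 1) - (1 * A) ^ (q + 1)) * X))
  rw [← mul_assoc X _ X, ← mul_assoc X A X, h3, one_mul, pow_succ' A (q + 1)]
  noncomm_ring

/-! ### The trace as a multiple integral -/

/-- On the bounded support of `h` the decay of `K' (z - x)` in `z - x` is decay in `z`, up to a
constant. -/
theorem norm_mulOp_kerVec_le {d : ℕ} {K' h : Euc d → ℂ} (hK' : MemLp K' 2 volume)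
    (hh : MemLp h ∞ volume) (hh2 : MemLp h 2 volume) {c r : ℝ} {N : ℕ}
    (hc : ∀ u, ‖K' u‖ ≤ c * decay N u) (hr : ∀ x, h x ≠ 0 → ‖x‖ ≤ r) (z : Euc d) :
    ‖mulOp h (kerVec hK' z)‖ ≤ c * ((1 + r) ^ N * ‖hh2.toLp‖) * decay N z := by
  have hc0 : 0 ≤ c := by
    have := (norm_nonneg _).trans (hc 0)
    exact nonneg_of_mul_nonneg_left this (decay_pos N 0)
  have h1 : ‖mulOp h (kerVec hK' z)‖ ≤ (c * ((1 + r) ^ N * decay N z)) * ‖hh2.toLp‖ := by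
    refine Lp.norm_le_mul_norm_of_ae_le_mul ?_
    filter_upwards [mulOp_coeFn hh (kerVec hK' z), kerVec_coeFn hK' z, hh2.coeFn_toLp]
      with x h1 h2 h3
    rw [h1, h2, h3, norm_mul, RCLike.norm_conj, mul_comm]
    by_cases hx : h x = 0
    · simp [hx]
    gcongr
    refine (hc _).trans ?_
    gcongr
    have h4 := decay_sub_le N x z (hr x hx)
    rwa [decay, norm_sub_rev, ← decay]
  refine h1.trans (le_of_eq ?_)
  ring

/-- The product is read as `P* R` with `P* = h · A`. The kernel vectors `s z` of `P` decay in `z`,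
those of `R` are only bounded, and `trace_carleman` integrates their pairing. That pairing is `R`
applied to `s z` and evaluated at `z`, hence an iterated convolution. -/
theorem trace_eq_integral_iterConv {d : ℕ} {b : Euc d → ℂ} (hb1 : Integrable b volume) {B : ℝ}
    (hB : ∀ x, ‖b x‖ ≤ B) {c : ℝ} (hc : ∀ z, ‖𝓕⁻ b z‖ ≤ c * decay (2 * d + 2) z)
    {h χ : Euc d → ℂ} (hh : MemLp h ∞ volume) (hh2 : MemLp h 2 volume) {r : ℝ}
    (hr : ∀ x, h x ≠ 0 → ‖x‖ ≤ r) (hχ : MemLp χ ∞ volume) (hχ1 : ∀ x, ‖χ x‖ ≤ 1) (n : ℕ) :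
    IsTraceClass (mulOp h ∘L fourierMul b ∘L (((mulOp χ ∘L fourierMul b) ^ (n + 1) -
        (mulOp (fun _ => 1) ∘L fourierMul b) ^ (n + 1)) ∘L mulOp χ)) ∧
    opTrace (mulOp h ∘L fourierMul b ∘L (((mulOp χ ∘L fourierMul b) ^ (n + 1) -
        (mulOp (fun _ => 1) ∘L fourierMul b) ^ (n + 1)) ∘L mulOp χ)) =
      ∫ z, (iterConv (𝓕⁻ b) χ (n + 1) (fun y => χ y * (h y * 𝓕⁻ b (y - z))) z -
        iterConv (𝓕⁻ b) (fun _ => 1) (n + 1) (fun y => χ y * (h y * 𝓕⁻ b (y - z))) z) := by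
  have hK : MemLp (𝓕⁻ b) 2 volume :=
    memLp_two_fourierInv hb1 (Integrable.memLp_two_of_bound hb1 hB)
  have hbt : MemLp b ∞ volume := memLp_top_of_bound hb1.1 B (.of_forall hB)
  have h1t : MemLp (fun _ : Euc d => (1 : ℂ)) ∞ volume := memLp_top_const _
  set b' : Euc d → ℂ := fun ν => conj (b ν) with hb'
  have hb'1 : Integrable b' volume :=
    LinearIsometryEquiv.integrable_comp_iff (φ := b) Complex.conjLIE |>.2 hb1
  have hb'B : ∀ x, ‖b' x‖ ≤ B := fun x => by simpa [b'] using hB x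
  have hK' : MemLp (𝓕⁻ b') 2 volume :=
    memLp_two_fourierInv hb'1 (Integrable.memLp_two_of_bound hb'1 hb'B)
  have hK'e : ∀ u, 𝓕⁻ b' u = conj (𝓕⁻ b (-u)) := fourierInv_conj b
  have hc' : ∀ u, ‖𝓕⁻ b' u‖ ≤ c * decay (2 * d + 2) u := fun u => by
    rw [hK'e, RCLike.norm_conj]
    simpa [decay] using hc (-u)
  set A := fourierMul b with hA
  set P := fourierMul b' ∘L mulOp (fun x => conj (h x)) with hP
  set R := ((mulOp χ ∘L A) ^ (n + 1) - (mulOp (fun _ => 1) ∘L A) ^ (n + 1)) ∘L mulOp χ with hR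
  have hcomm : ContinuousLinearMap.adjoint P = mulOp h ∘L A := by
    rw [hP, ← adjoint_mulOp hh, ← adjoint_fourierMul hbt, ← ContinuousLinearMap.adjoint_comp,
      ContinuousLinearMap.adjoint_adjoint]
  rw [← ContinuousLinearMap.comp_assoc, ← hcomm]
  set G : (Euc d → ℂ) → L2 d →L[ℂ] L2 d := fun m => ((mulOp m ∘L A) ^ n) ∘L mulOp χ with hG
  set s : Euc d → L2 d := fun z => mulOp h (kerVec hK' z) with hs
  set t : (Euc d → ℂ) → Euc d → L2 d := fun m z =>
    conj (m z) • ContinuousLinearMap.adjoint (G m) (kerVec hK z) with ht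
  have hPs : ∀ u, P u =ᵐ[volume] fun z => inner ℂ (s z) u := fun u => by
    refine (fourierMul_coeFn hb'1 hb'B hK' (mulOp (fun x => conj (h x)) u)).trans
      (.of_forall fun z => ?_)
    simp only [s]
    rw [← adjoint_mulOp hh, ContinuousLinearMap.adjoint_inner_right]
  have hm : ∀ m, MemLp m ∞ volume → ∀ u, (((mulOp m ∘L A) ^ (n + 1)) ∘L mulOp χ) u
      =ᵐ[volume] fun z => inner ℂ (t m z) u := fun m hm u => by
    rw [pow_succ']
    change mulOp m (A (G m u)) =ᵐ[volume] _
    filter_upwards [mulOp_coeFn hm (A (G m u)), fourierMul_coeFn hb1 hB hK (G m u)] with z h1 h2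
    rw [h1, hA, h2]
    simp only [t, inner_smul_left, RCLike.conj_conj, ContinuousLinearMap.adjoint_inner_left]
  have hRt : ∀ u, R u =ᵐ[volume] fun z => inner ℂ (t χ z - t (fun _ => 1) z) u := fun u => by
    have e : R u = (((mulOp χ ∘L A) ^ (n + 1)) ∘L mulOp χ) u -
      (((mulOp (fun _ => 1) ∘L A) ^ (n + 1)) ∘L mulOp χ) u := by
      simp only [hR, ContinuousLinearMap.comp_apply, sub_apply]
    rw [e]
    filter_upwards [hm χ hχ u, hm _ h1t u, Lp.coeFn_sub ((((mulOp χ ∘L A) ^ (n + 1)) ∘L mulOp χ) u)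
      ((((mulOp (fun _ => 1) ∘L A) ^ (n + 1)) ∘L mulOp χ) u)] with z h1 h2 h3
    rw [h3, Pi.sub_apply, h1, h2, inner_sub_left]
  -- The decay of order `2d + 2` of `s` is shared evenly: `w` moves `d + 1` powers to the vectors of
  -- `R`, which leaves both sides square integrable.
  set w : Euc d → ℝ := fun z => (1 + ‖z‖) ^ (d + 1) with hw
  set D := c * ((1 + r) ^ (2 * d + 2) * ‖hh2.toLp‖) with hD
  set M : (Euc d → ℂ) → ℝ := fun m => ‖ContinuousLinearMap.adjoint (G m)‖ * ‖kerVec hK 0‖ with hM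
  have ht1 : ∀ m : Euc d → ℂ, (∀ x, ‖m x‖ ≤ 1) → ∀ z, ‖t m z‖ ≤ M m := fun m hm1 z => by
    simp only [t, norm_smul, RCLike.norm_conj]
    calc _ ≤ 1 * (‖ContinuousLinearMap.adjoint (G m)‖ * ‖kerVec hK z‖) := by
          gcongr
          · exact hm1 z
          · exact ContinuousLinearMap.le_opNorm _ _
      _ = M m := by rw [one_mul, norm_kerVec]
  have key := trace_carleman hPs hRt (w := w) (by fun_prop) (fun z => by positivity)
    (g := fun z => D * decay (d + 1) z) (h := fun z => (M χ + M (fun _ => 1)) * decay (d + 1) z)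
    ((memLp_two_decay (by omega)).const_mul _) (fun z => ?_)
    ((memLp_two_decay (by omega)).const_mul _) (fun z => ?_)
  · refine ⟨key.1, key.2.trans (integral_congr_ae (.of_forall fun z => ?_))⟩
    have hs' : s z =ᵐ[volume] fun y => h y * 𝓕⁻ b (y - z) := by
      filter_upwards [mulOp_coeFn hh (kerVec hK' z), kerVec_coeFn hK' z] with y h1 h2
      rw [h1, h2, hK'e, RCLike.conj_conj, neg_sub]
    have hs'' : mulOp χ (s z) =ᵐ[volume] fun y => χ y * (h y * 𝓕⁻ b (y - z)) := by
      filter_upwards [mulOp_coeFn hχ (s z), hs'] with y h1 h2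
      rw [h1, h2]
    have hin : ∀ m, MemLp m ∞ volume → inner ℂ (t m z) (s z) =
        iterConv (𝓕⁻ b) m (n + 1) (fun y => χ y * (h y * 𝓕⁻ b (y - z))) z := fun m hm => by
      simp only [t, inner_smul_left, RCLike.conj_conj, ContinuousLinearMap.adjoint_inner_left]
      have hGs : G m (s z) = ((mulOp m ∘L fourierMul b) ^ n) (mulOp χ (s z)) := rfl
      rw [hGs, inner_kerVec hK z (comp_pow_coeFn hb1 hB hK hm n hs'')]
      rfl
    beta_reduce
    rw [inner_sub_left, hin χ hχ, hin _ h1t]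
  · have h1 := norm_mulOp_kerVec_le hK' hh hh2 hc' hr z
    calc w z * ‖s z‖ ≤ w z * (D * decay (2 * d + 2) z) := by gcongr
      _ = D * (w z * decay ((d + 1) + (d + 1)) z) := by
        rw [show 2 * d + 2 = (d + 1) + (d + 1) by ring]; ring
      _ = D * decay (d + 1) z := by rw [hw, pow_mul_decay]
  · rw [mul_comm]
    change _ * decay (d + 1) z ≤ _
    have := decay_pos (d + 1) z
    gcongr
    exact (norm_sub_le _ _).trans (add_le_add (ht1 χ hχ1 z) (ht1 _ (by simp) z))

/-- The cyclic product `K (v 0) ⋯ K (v (n - 1)) K (-(v 0 + ⋯ + v (n - 1)))`. -/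
noncomputable def cycProd {d n : ℕ} (K : Euc d → ℂ) (v : Fin n → Euc d) : ℂ :=
  (∏ i, K (v i)) * K (-∑ i, v i)

theorem measurePreserving_shear {d n : ℕ} :
    MeasurePreserving (fun p : (Fin n → Euc d) × Euc d => (p.1, p.2 - ∑ i, p.1 i))
      (volume.prod volume) (volume.prod volume) := by
  refine (MeasurePreserving.id volume).skew_product
    (g := fun (v : Fin n → Euc d) (z : Euc d) => z - ∑ i, v i) ?_ ?_
  · exact measurable_snd.sub (measurable_sum_fin.comp measurable_fst)
  · exact .of_forall fun v => (measurePreserving_sub_right volume (∑ i, v i)).map_eq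

theorem continuous_cycProd {d n : ℕ} {K : Euc d → ℂ} (hK : Continuous K) :
    Continuous (cycProd K : (Fin n → Euc d) → ℂ) := by
  unfold cycProd
  fun_prop

theorem integrable_cycProd {d n : ℕ} {K : Euc d → ℂ} (hKc : Continuous K)
    (hK : Integrable K volume) {B : ℝ} (hB : ∀ x, ‖K x‖ ≤ B) :
    Integrable (cycProd K : (Fin n → Euc d) → ℂ) volume :=
  integrable_prod_mul_bdd hK (g := fun v => K (-∑ i, v i))
    (hKc.measurable.comp measurable_sum_fin.neg) fun _ => hB _

/-- By Fubini and the shear `x = z - ∑ v`: the walk then starts at `x`, and `K (y - z)` becomes the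
closing factor `K (-∑ v)`, free of `x`. -/
theorem integral_iterConv_cyclic {d : ℕ} {K c h : Euc d → ℂ} (hKc : Continuous K)
    (hK : Integrable K volume) {B : ℝ} (hB : ∀ x, ‖K x‖ ≤ B) (hc : Measurable c)
    (hc1 : ∀ x, ‖c x‖ ≤ 1) (hhm : Measurable h) (hh : Integrable h volume) {B' : ℝ}
    (hB' : ∀ x, ‖h x‖ ≤ B') (n : ℕ) :
    Integrable (fun z => iterConv K c n (fun y => h y * K (y - z)) z) volume ∧
    Integrable (fun v : Fin n → Euc d =>
      cycProd K v * ∫ x, h x * ∏ j : Fin n, c (x + psum v (j + 1))) volume ∧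
    ∫ z, iterConv K c n (fun y => h y * K (y - z)) z = ∫ v : Fin n → Euc d,
      cycProd K v * ∫ x, h x * ∏ j : Fin n, c (x + psum v (j + 1)) := by
  set W : (Fin n → Euc d) × Euc d → ℂ := fun p =>
    cycProd K p.1 * (h p.2 * ∏ j : Fin n, c (p.2 + psum p.1 (j + 1))) with hW
  have hWm : Measurable fun p : (Fin n → Euc d) × Euc d =>
      ∏ j : Fin n, c (p.2 + psum p.1 (j + 1)) := by
    refine Finset.measurable_prod _ fun j _ => hc.comp ?_
    exact measurable_snd.add ((measurable_psum _).comp measurable_fst)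
  have hWi : Integrable W (volume.prod volume) := by
    have h1 := ((integrable_cycProd (n := n) hKc hK hB).mul_prod hh).mul_bdd (c := 1)
      hWm.aestronglyMeasurable (.of_forall fun p => norm_prod_le_one _ fun j => hc1 _)
    refine h1.congr (.of_forall fun p => ?_)
    simp only [W]
    ring
  have hWs := measurePreserving_shear.integrable_comp_of_integrable hWi
  have hiter : ∀ z, iterConv K c n (fun y => h y * K (y - z)) z =
      ∫ v : Fin n → Euc d, W (v, z - ∑ i, v i) := fun z => by
    have hBB : ∀ x, ‖h x * K (x - z)‖ ≤ B' * B := fun x => by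
      rw [norm_mul]
      have := (norm_nonneg _).trans (hB' x)
      gcongr
      · exact hB' x
      · exact hB _
    rw [iterConv_eq hK hc hc1 (F := fun y => h y * K (y - z))
      (hhm.mul (hKc.measurable.comp (measurable_id.sub_const z))) hBB]
    refine integral_congr_ae (.of_forall fun v => ?_)
    simp only [W, cycProd]
    rw [show z - ∑ i, v i - z = -∑ i, v i by abel]
    ring
  refine ⟨?_, ?_, ?_⟩
  · simp_rw [hiter]
    exact hWs.integral_prod_right
  · have := hWi.integral_prod_left
    simpa only [W, integral_const_mul] using this
  · simp_rw [hiter]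
    have h2 := integral_integral_swap (f := fun v z => W (v, z - ∑ i, v i)) (μ := volume)
      (ν := volume) hWs
    rw [← h2]
    refine integral_congr_ae (.of_forall fun v => ?_)
    beta_reduce
    rw [integral_sub_right_eq_self (fun x => W (v, x)), ← integral_const_mul]

theorem psum_smul {d n : ℕ} (c : ℝ) (v : Fin n → Euc d) (m : ℕ) :
    psum (c • v) m = c • psum v m := by
  simp only [psum, Finset.smul_sum, smul_ite, smul_zero, Pi.smul_apply]

theorem decay_smul_le {V : Type*} [NormedAddCommGroup V] [NormedSpace ℝ V] (N : ℕ) {κ : ℝ}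
    (hκ : 0 < κ) (z : V) : decay N (κ • z) ≤ (1 + κ⁻¹) ^ N * decay N z := by
  unfold decay
  rw [← div_eq_mul_inv, le_div_iff₀ (by positivity), inv_mul_eq_div, ← div_pow]
  gcongr
  rw [div_le_iff₀ (by positivity), norm_smul, Real.norm_of_nonneg hκ.le]
  have : κ⁻¹ * κ = 1 := inv_mul_cancel₀ hκ.ne'
  have h2 : (1 + κ⁻¹) * (1 + κ * ‖z‖) = 1 + κ⁻¹ + κ * ‖z‖ + (κ⁻¹ * κ) * ‖z‖ := by ring
  rw [h2, this]
  have := inv_pos.2 hκ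
  have := mul_nonneg hκ.le (norm_nonneg z)
  linarith

/-- The `n + 1` factors contribute `κ^(d (n + 1))` and the Jacobian in `n` variables removes `κ^(d
n)`. -/
theorem integral_cycProd_scale {d n : ℕ} (A : Euc d → ℂ) {κ : ℝ} (hκ : 0 < κ)
    (Ψ : (Fin n → Euc d) → ℂ) :
    ∫ v : Fin n → Euc d, cycProd (fun z => (κ : ℂ) ^ d * A (κ • z)) v * Ψ v =
      (κ : ℂ) ^ d * ∫ v : Fin n → Euc d, cycProd A v * Ψ (κ⁻¹ • v) := by
  have h1 : ∀ v : Fin n → Euc d, cycProd (fun z => (κ : ℂ) ^ d * A (κ • z)) v * Ψ v =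
      (κ : ℂ) ^ d * (κ : ℂ) ^ (d * n) * (cycProd A (κ • v) * Ψ (κ⁻¹ • κ • v)) := fun v => by
    rw [inv_smul_smul₀ hκ.ne']
    simp only [cycProd, Finset.prod_mul_distrib, Finset.prod_const, Finset.card_univ,
      Fintype.card_fin, Pi.smul_apply, ← Finset.smul_sum, smul_neg, pow_mul]
    ring
  simp_rw [h1]
  rw [integral_const_mul]
  have h2 := Measure.integral_comp_smul (volume : Measure (Fin n → Euc d))
    (fun v => cycProd A v * Ψ (κ⁻¹ • v)) κ
  rw [h2]
  have h3 : Module.finrank ℝ (Fin n → Euc d) = d * n := by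
    rw [Module.finrank_pi_fintype]
    simp [mul_comm]
  rw [h3, abs_of_pos (by positivity), Complex.real_smul]
  push_cast
  have : (κ : ℂ) ≠ 0 := by exact_mod_cast hκ.ne'
  field_simp

/-- The cyclic integrals with and without cut-offs are subtracted under one integral sign, so that
only walks leaving `S` contribute. -/
theorem trace_diffOp {d : ℕ} {β : ℝ} (hβ : (d : ℝ) < β) {C : ℕ → ℝ} {φ : Euc d → ℂ}
    (hφ : Continuous φ) (hφc : HasCompactSupport φ) {S : Set (Euc d)} (hS : MeasurableSet S)
    {α κ : ℝ} (hα : 0 < α) (hκ : κ = α / (2 * Real.pi)) {a : Euc d → ℂ}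
    (ha : a ∈ symbolClass d β C) (q : ℕ) :
    IsTraceClass (mulOp φ ∘L diffOp α a S (q + 2)) ∧
    opTrace (mulOp φ ∘L diffOp α a S (q + 2)) =
      (κ : ℂ) ^ d * ∫ v : Fin (q + 1) → Euc d, cycProd (𝓕⁻ a) v *
        ∫ x, φ x * chi S x * (∏ j : Fin (q + 1), chi S (x + κ⁻¹ • psum v (j + 1)) - 1) := by
  have hκ0 : 0 < κ := by rw [hκ]; have := Real.pi_pos; positivity
  have hκi : κ⁻¹ = 2 * Real.pi / α := by rw [hκ, inv_div]
  have hβ0 : 0 ≤ β := (Nat.cast_nonneg d).trans hβ.le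
  set b : Euc d → ℂ := fun ν => a (κ⁻¹ • ν) with hb
  have hac := symbolClass.continuous ha
  have hai := symbolClass.integrable hβ ha
  have hb1 : Integrable b volume := hai.comp_smul (by positivity)
  have hbB : ∀ x, ‖b x‖ ≤ C 0 := fun x => symbolClass.norm_le_const hβ0 ha _
  have hbt : MemLp b ∞ volume := memLp_top_of_bound hb1.1 _ (.of_forall hbB)
  have hK : ∀ z, 𝓕⁻ b z = (κ : ℂ) ^ d * 𝓕⁻ a (κ • z) := fourierInv_comp_smul a hκ0
  obtain ⟨c, hc0, hc⟩ := symbolClass.norm_fourierInv_le hβ C (2 * d + 2)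
  have hKc : ∀ z, ‖𝓕⁻ b z‖ ≤ (κ ^ d * (c * (1 + κ⁻¹) ^ (2 * d + 2))) * decay (2 * d + 2) z := by
    intro z
    rw [hK, norm_mul, norm_pow, Complex.norm_real, Real.norm_of_nonneg hκ0.le, mul_assoc, mul_assoc]
    gcongr
    refine (hc a ha _).trans ?_
    gcongr
    exact decay_smul_le _ hκ0 z
  set h : Euc d → ℂ := fun x => φ x * chi S x with hh
  obtain ⟨Bφ, hBφ⟩ := hφ.bounded_above_of_compact_support hφc
  have hhm : Measurable h := hφ.measurable.mul (measurable_chi hS)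
  have hhB : ∀ x, ‖h x‖ ≤ Bφ := fun x => by
    rw [hh, norm_mul]
    exact (mul_le_of_le_one_right (norm_nonneg _) (norm_chi_le S x)).trans (hBφ x)
  have hhi : Integrable h volume :=
    (hφ.integrable_of_hasCompactSupport hφc).mul_bdd (measurable_chi hS).aestronglyMeasurable
      (.of_forall (norm_chi_le S))
  have hht : MemLp h ∞ volume := memLp_top_of_bound hhi.1 _ (.of_forall hhB)
  have hφt : MemLp φ ∞ volume :=
    memLp_top_of_bound hφ.aestronglyMeasurable _ (.of_forall hBφ)
  obtain ⟨r, hr⟩ := hφc.isCompact.isBounded.exists_norm_le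
  have hr' : ∀ x, h x ≠ 0 → ‖x‖ ≤ r := fun x hx =>
    hr x (subset_tsupport _ (left_ne_zero_of_mul hx))
  have hKcont : Continuous (𝓕⁻ b) := continuous_fourierInv hb1
  have hKi : Integrable (𝓕⁻ b) volume :=
    ((integrable_decay (by omega)).const_mul _).mono' hKcont.aestronglyMeasurable (.of_forall hKc)
  have hKB : ∀ x, ‖𝓕⁻ b x‖ ≤ κ ^ d * (c * (1 + κ⁻¹) ^ (2 * d + 2)) := fun x =>
    (hKc x).trans (mul_le_of_le_one_right (by positivity) (decay_le_one _ _))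
  have h1 := mulOp_comp_diffOp hφt hS α (a := a) (b := b) (fun ν => by rw [hb, hκi]) hbt q
  have h2 := trace_eq_integral_iterConv hb1 hbB hKc hht (Integrable.memLp_two_of_bound hhi hhB)
    hr' (memLp_top_chi hS) (norm_chi_le S) q
  rw [← h1] at h2
  refine ⟨h2.1, h2.2.trans ?_⟩
  have h3 : ∀ z, (fun y => chi S y * (h y * 𝓕⁻ b (y - z))) = fun y => h y * 𝓕⁻ b (y - z) :=
    fun z => by
      ext y
      simp only [hh]
      linear_combination (φ y * 𝓕⁻ b (y - z)) * chi_mul_chi S y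
  simp_rw [h3]
  obtain ⟨i1, i2, i3⟩ := integral_iterConv_cyclic hKcont hKi hKB (measurable_chi hS)
    (norm_chi_le S) hhm hhi hhB (q + 1)
  obtain ⟨j1, j2, j3⟩ := integral_iterConv_cyclic hKcont hKi hKB (c := fun _ => 1) measurable_const
    (by simp) hhm hhi hhB (q + 1)
  rw [integral_sub i1 j1, i3, j3, ← integral_sub i2 j2]
  have hKf : 𝓕⁻ b = fun z => (κ : ℂ) ^ d * 𝓕⁻ a (κ • z) := funext hK
  rw [hKf]
  have h4 := integral_cycProd_scale (n := q + 1) (𝓕⁻ a) hκ0 (fun v => ∫ x, h x *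
    (∏ j : Fin (q + 1), chi S (x + psum v (j + 1)) - 1))
  simp only [psum_smul] at h4
  rw [← h4]
  refine integral_congr_ae (.of_forall fun v => ?_)
  beta_reduce
  rw [← mul_sub]
  congr 1
  have hm : Measurable fun x => ∏ j : Fin (q + 1), chi S (x + psum v (j + 1)) :=
    Finset.measurable_prod _ fun j _ => (measurable_chi hS).comp (measurable_id.add_const _)
  have hi : Integrable (fun x => h x * ∏ j : Fin (q + 1), chi S (x + psum v (j + 1))) volume :=
    hhi.mul_bdd hm.aestronglyMeasurable
      (.of_forall fun x => norm_prod_le_one _ fun j => norm_chi_le S _)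
  rw [← integral_sub hi (by simpa using hhi)]
  refine integral_congr_ae (.of_forall fun x => ?_)
  simp only [Finset.prod_const_one]
  ring

/-! ### Maxima of partial sums -/

/-- The maximum of `0` and the first `m` partial sums of `x`. -/
noncomputable def runMax {n : ℕ} (x : Fin n → ℝ) : ℕ → ℝ
  | 0 => 0
  | m + 1 => max (runMax x m) (psum x (m + 1))

theorem psum_zero {n : ℕ} {V : Type*} [AddCommMonoid V] (v : Fin n → V) : psum v 0 = 0 := by
  simp [psum]

theorem psum_succ {n m : ℕ} (h : m < n) {V : Type*} [AddCommMonoid V] (v : Fin n → V) :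
    psum v (m + 1) = psum v m + v ⟨m, h⟩ := by
  have h1 : ∀ i : Fin n, (if i.val < m + 1 then v i else 0) =
      (if i.val < m then v i else 0) + if i = ⟨m, h⟩ then v i else 0 := fun i => by
    by_cases h1 : i.val < m
    · have h2 : i ≠ ⟨m, h⟩ := fun h3 => by rw [h3] at h1; simp at h1
      rw [if_pos (by omega), if_pos h1, if_neg h2, add_zero]
    · by_cases h2 : i = ⟨m, h⟩
      · rw [if_pos (by rw [h2]; simp), if_neg h1, if_pos h2, zero_add]
      · have h3 : i.val ≠ m := fun h3 => h2 (Fin.ext h3)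
        rw [if_neg (by omega), if_neg h1, if_neg h2, add_zero]
  simp_rw [psum, h1, Finset.sum_add_distrib]
  simp

theorem psum_comp_perm {n m : ℕ} {V : Type*} [AddCommMonoid V] (v : Fin n → V)
    (σ : Equiv.Perm (Fin n)) (hσ : ∀ i, (σ i).val < m ↔ i.val < m) :
    psum (v ∘ σ) m = psum v m := by
  rw [psum, psum, ← Equiv.sum_comp σ fun i : Fin n => if i.val < m then v i else 0]
  refine Finset.sum_congr rfl fun i _ => ?_
  simp [hσ i]

theorem runMax_nonneg {n : ℕ} (x : Fin n → ℝ) (m : ℕ) : 0 ≤ runMax x m := by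
  induction m with
  | zero => exact le_rfl
  | succ m ih => exact ih.trans (le_max_left _ _)

theorem psum_le_runMax {n : ℕ} (x : Fin n → ℝ) (m : ℕ) : psum x m ≤ runMax x m := by
  cases m with
  | zero => simp [psum_zero, runMax]
  | succ m => exact le_max_right _ _

theorem norm_psum_le {n : ℕ} {V : Type*} [NormedAddCommGroup V] (v : Fin n → V) (m : ℕ) :
    ‖psum v m‖ ≤ ∑ i, ‖v i‖ := by
  refine (norm_sum_le _ _).trans (Finset.sum_le_sum fun i _ => ?_)
  split_ifs <;> simp

theorem runMax_le {n : ℕ} (x : Fin n → ℝ) (m : ℕ) : runMax x m ≤ ∑ i, |x i| := by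
  induction m with
  | zero => exact Finset.sum_nonneg fun i _ => abs_nonneg _
  | succ m ih => exact max_le ih ((le_abs_self _).trans (norm_psum_le x _))

/-- The path `x` is `y` preceded by the increment `c`: the values `c + (sums of y)` are the sums of
`x` with index at least `1`, and the outer `0` restores index `0`. -/
theorem max_add_runMax {n : ℕ} (x y : Fin n → ℝ) (c : ℝ) (k : ℕ)
    (h : ∀ j ≤ k, psum y j = psum x (j + 1) - c) :
    max 0 (c + runMax y k) = runMax x (k + 1) := by
  induction k with
  | zero =>
    have h0 := h 0 le_rfl
    rw [psum_zero] at h0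
    simp only [runMax, zero_add, add_zero] at h0 ⊢
    rw [show c = psum x 1 by linarith]
  | succ k ih =>
    have ih' := ih fun j hj => h j (by omega)
    rw [runMax, ← max_add_add_left, ← max_assoc, ih', h (k + 1) le_rfl, runMax]
    congr 1
    ring

/-- The pathwise identity behind Spitzer's recursion. If the last sum is positive, the maximum is
attained after at least one step and splits as the first increment plus the maximum of the remaining
path. Otherwise the last sum does not affect the maximum. -/
theorem runMax_rotate {n k : ℕ} (x : Fin (n + 1) → ℝ) (σ : Equiv.Perm (Fin (n + 1)))
    (hk : k < n + 1) (hσ : ∀ i : Fin (n + 1), i.val < k → (σ i).val = i.val + 1) :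
    runMax x (k + 1) = if 0 < psum x (k + 1) then x 0 + runMax (x ∘ σ) k else runMax x k := by
  have hps : ∀ j ≤ k, psum (x ∘ σ) j = psum x (j + 1) - x 0 := by
    intro j
    induction j with
    | zero =>
      intro _
      rw [psum_zero, psum_succ (by omega), psum_zero]
      simp
    | succ j ih =>
      intro hj
      rw [psum_succ (by omega), ih (by omega), psum_succ (m := j + 1) (by omega)]
      have h1 : σ ⟨j, by omega⟩ = ⟨j + 1, by omega⟩ := Fin.ext (hσ ⟨j, by omega⟩ (by simp; omega))
      simp only [Function.comp_apply, h1]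
      ring
  split_ifs with hpos
  · rw [← max_add_runMax x (x ∘ σ) (x 0) k hps, max_eq_right]
    have h1 := psum_le_runMax (x ∘ σ) k
    rw [hps k le_rfl] at h1
    linarith
  · rw [runMax, max_eq_left]
    exact (not_lt.1 hpos).trans (runMax_nonneg _ _)

theorem measurable_runMax {n : ℕ} (m : ℕ) : Measurable fun x : Fin n → ℝ => runMax x m := by
  induction m with
  | zero => exact measurable_const
  | succ m ih => exact ih.max (continuous_psum _).measurable

/-! ### Exchangeable weights -/

theorem integral_comp_perm {n : ℕ} {V : Type*} [MeasureSpace V]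
    [SigmaFinite (volume : Measure V)] (σ : Equiv.Perm (Fin n)) (g : (Fin n → V) → ℂ) :
    ∫ v, g (v ∘ σ) = ∫ v, g v := by
  have h := volume_measurePreserving_piCongrLeft (fun _ : Fin n => V) σ⁻¹
  rw [← h.integral_comp' g]
  congr 1
  funext v
  congr 1
  funext i
  have := MeasurableEquiv.piCongrLeft_apply_apply (β := fun _ : Fin n => V) (e := σ⁻¹) v (σ i)
  simpa using this.symm

theorem cycProd_comp_perm {d n : ℕ} (K : Euc d → ℂ) (v : Fin n → Euc d)
    (σ : Equiv.Perm (Fin n)) : cycProd K (v ∘ σ) = cycProd K v := by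
  simp only [cycProd, Function.comp_apply]
  rw [Equiv.sum_comp σ v, Equiv.prod_comp σ fun i => K (v i)]

theorem one_add_sum_le_prod {ι : Type*} (s : Finset ι) {f : ι → ℝ} (hf : ∀ i, 0 ≤ f i) :
    1 + ∑ i ∈ s, f i ≤ ∏ i ∈ s, (1 + f i) := by
  classical
  induction s using Finset.induction_on with
  | empty => simp
  | insert a s ha ih =>
    rw [Finset.sum_insert ha, Finset.prod_insert ha]
    have h1 : 0 ≤ ∑ i ∈ s, f i := Finset.sum_nonneg fun i _ => hf i
    nlinarith [hf a]

/-- Since `1 + ∑ ‖v i‖ ≤ ∏ (1 + ‖v i‖)`, growth of order `M` in the total length costs `M` powers of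
decay in each factor. -/
theorem pow_mul_prod_decay_le {n : ℕ} {V : Type*} [NormedAddCommGroup V] (M N : ℕ)
    (v : Fin n → V) :
    (1 + ∑ i, ‖v i‖) ^ M * ∏ i, decay (M + N) (v i) ≤ ∏ i, decay N (v i) := by
  have h1 : ∏ i, decay N (v i) = (∏ i, (1 + ‖v i‖)) ^ M * ∏ i, decay (M + N) (v i) := by
    rw [← Finset.prod_pow, ← Finset.prod_mul_distrib]
    exact Finset.prod_congr rfl fun i _ => (pow_mul_decay M N (v i)).symm
  rw [h1]
  have : 0 ≤ ∏ i, decay (M + N) (v i) := Finset.prod_nonneg fun i _ => (decay_pos _ _).le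
  gcongr
  exact one_add_sum_le_prod _ fun i => norm_nonneg _

theorem integrable_prod_decay {d n N : ℕ} (h : d < N) :
    Integrable (fun v : Fin n → Euc d => ∏ i, decay N (v i)) volume :=
  Integrable.fintype_prod (f := fun _ => decay N) fun _ => integrable_decay h

theorem norm_cycProd_le {d n N : ℕ} {K : Euc d → ℂ} {c : ℝ} (hK : ∀ z, ‖K z‖ ≤ c * decay N z)
    (v : Fin n → Euc d) : ‖cycProd K v‖ ≤ c ^ (n + 1) * ∏ i, decay N (v i) := by
  have hc : 0 ≤ c := nonneg_of_mul_nonneg_left ((norm_nonneg _).trans (hK 0)) (decay_pos N 0)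
  rw [cycProd, norm_mul, norm_prod]
  calc _ ≤ (∏ i, c * decay N (v i)) * c := by
        gcongr with i
        · exact Finset.prod_nonneg fun i _ => mul_nonneg hc (decay_pos _ _).le
        · exact hK _
        · exact (hK _).trans (mul_le_of_le_one_right hc (decay_le_one _ _))
    _ = _ := by rw [Finset.prod_mul_distrib]; simp; ring

/-- Functions of linear growth are integrable against a cyclic product of decaying functions. -/
theorem integrable_cycProd_mul {d n N M : ℕ} (hN : M + d < N) {K : Euc d → ℂ} (hKc : Continuous K)
    {c : ℝ} (hK : ∀ z, ‖K z‖ ≤ c * decay N z) {f : (Fin n → Euc d) → ℂ}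
    (hf : AEStronglyMeasurable f volume) {B : ℝ} (hB : ∀ v, ‖f v‖ ≤ B * (1 + ∑ i, ‖v i‖) ^ M) :
    Integrable (fun v => cycProd K v * f v) volume := by
  obtain ⟨N', rfl⟩ : ∃ N', N = M + N' := ⟨N - M, by omega⟩
  have hB0 : 0 ≤ B := by
    have := (norm_nonneg _).trans (hB 0)
    simpa using this
  have hc : 0 ≤ c := nonneg_of_mul_nonneg_left ((norm_nonneg _).trans (hK 0)) (decay_pos _ 0)
  refine ((integrable_prod_decay (n := n) (d := d) (N := N') (by omega)).const_mul
    (c ^ (n + 1) * B)).mono'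
    ((continuous_cycProd hKc).aestronglyMeasurable.mul hf) (.of_forall fun v => ?_)
  rw [norm_mul]
  have h0 : 0 ≤ ∏ i, decay (M + N') (v i) := Finset.prod_nonneg fun i _ => (decay_pos _ _).le
  calc _ ≤ (c ^ (n + 1) * ∏ i, decay (M + N') (v i)) * (B * (1 + ∑ i, ‖v i‖) ^ M) := by
        gcongr
        · exact norm_cycProd_le hK v
        · exact hB v
    _ = c ^ (n + 1) * B * ((1 + ∑ i, ‖v i‖) ^ M * ∏ i, decay (M + N') (v i)) := by ring
    _ ≤ _ := by
        gcongr
        exact pow_mul_prod_decay_le M N' v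

/-! ### The expectation of the maximum of the partial sums -/

section expectation

variable {d n N : ℕ} {K : Euc d → ℂ} {c : ℝ}

/-- The coordinates of `v` in the direction `θ`. -/
noncomputable def dirCoord (θ : Euc d) (v : Fin n → Euc d) : Fin n → ℝ := fun i => inner ℝ (v i) θ

theorem continuous_dirCoord (θ : Euc d) : Continuous (dirCoord θ : (Fin n → Euc d) → _) := by
  unfold dirCoord
  fun_prop

theorem dirCoord_comp (θ : Euc d) (v : Fin n → Euc d) (σ : Equiv.Perm (Fin n)) :
    dirCoord θ (v ∘ σ) = dirCoord θ v ∘ σ := rfl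

theorem psum_dirCoord (θ : Euc d) (v : Fin n → Euc d) (m : ℕ) :
    psum (dirCoord θ v) m = inner ℝ (psum v m) θ := by
  simp only [psum, dirCoord, sum_inner]
  refine Finset.sum_congr rfl fun i _ => ?_
  split_ifs <;> simp

theorem sum_abs_dirCoord_le (θ : Euc d) (v : Fin n → Euc d) :
    ∑ i, |dirCoord θ v i| ≤ ‖θ‖ * ∑ i, ‖v i‖ := by
  rw [Finset.mul_sum]
  refine Finset.sum_le_sum fun i _ => ?_
  rw [mul_comm]
  exact abs_real_inner_le_norm _ _

/-- The weighted mean of `f` with respect to the cyclic product of `K`. -/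
noncomputable def cycMean (n : ℕ) (K : Euc d → ℂ) (f : (Fin n → Euc d) → ℝ) : ℂ :=
  ∫ v, cycProd K v * (f v : ℂ)

theorem cycMean_comp_perm (f : (Fin n → Euc d) → ℝ) (σ : Equiv.Perm (Fin n)) :
    cycMean n K (fun v => f (v ∘ σ)) = cycMean n K f := by
  have h := integral_comp_perm σ fun v => cycProd K v * (f v : ℂ)
  simp only [cycProd_comp_perm] at h
  exact h

theorem integrable_cycMean (hN : 1 + d < N) (hKc : Continuous K)
    (hK : ∀ z, ‖K z‖ ≤ c * decay N z) {f : (Fin n → Euc d) → ℝ} (hf : Measurable f) {θ : Euc d}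
    (hB : ∀ v, |f v| ≤ ∑ i, |dirCoord θ v i|) :
    Integrable (fun v => cycProd K v * (f v : ℂ)) volume := by
  refine integrable_cycProd_mul (M := 1) (B := ‖θ‖) hN hKc hK
    (Complex.measurable_ofReal.comp hf).aestronglyMeasurable fun v => ?_
  rw [Complex.norm_real]
  refine (hB v).trans ((sum_abs_dirCoord_le θ v).trans ?_)
  rw [pow_one]
  gcongr
  linarith

theorem cycMean_add {f g : (Fin n → Euc d) → ℝ}
    (hf : Integrable (fun v => cycProd K v * (f v : ℂ)) volume)
    (hg : Integrable (fun v => cycProd K v * (g v : ℂ)) volume) :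
    cycMean n K (fun v => f v + g v) = cycMean n K f + cycMean n K g := by
  rw [cycMean, cycMean, cycMean, ← integral_add hf hg]
  congr 1
  ext v
  push_cast
  ring

theorem cycMean_sum {ι : Type*} (s : Finset ι) {f : ι → (Fin n → Euc d) → ℝ}
    (hf : ∀ i ∈ s, Integrable (fun v => cycProd K v * (f i v : ℂ)) volume) :
    cycMean n K (fun v => ∑ i ∈ s, f i v) = ∑ i ∈ s, cycMean n K (f i) := by
  simp only [cycMean]
  rw [← integral_finsetSum s hf]
  congr 1
  ext v
  push_cast
  rw [Finset.mul_sum]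

theorem abs_dirCoord_le_sum (θ : Euc d) (v : Fin n → Euc d) (i : Fin n) :
    |dirCoord θ v i| ≤ ∑ i, |dirCoord θ v i| :=
  Finset.single_le_sum (f := fun i => |dirCoord θ v i|) (fun _ _ => abs_nonneg _)
    (Finset.mem_univ i)

theorem measurable_psum_dirCoord (θ : Euc d) (m : ℕ) :
    Measurable fun v : Fin n → Euc d => psum (dirCoord θ v) m :=
  ((continuous_psum m).comp (continuous_dirCoord θ)).measurable

theorem measurable_dirCoord_apply (θ : Euc d) (i : Fin n) :
    Measurable fun v : Fin n → Euc d => dirCoord θ v i :=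
  ((continuous_apply i).comp (continuous_dirCoord θ)).measurable

theorem measurableSet_psum_pos (θ : Euc d) (m : ℕ) :
    MeasurableSet {v : Fin n → Euc d | 0 < psum (dirCoord θ v) m} :=
  measurableSet_lt measurable_const (measurable_psum_dirCoord θ m)

/-- Spitzer's recursion. -/
theorem cycMean_runMax_succ (hN : 1 + d < N) (hKc : Continuous K)
    (hK : ∀ z, ‖K z‖ ≤ c * decay N z) (θ : Euc d) {k : ℕ} (hk : k < n + 1) :
    cycMean (n + 1) K (fun v => runMax (dirCoord θ v) (k + 1)) =
      cycMean (n + 1) K (fun v => runMax (dirCoord θ v) k) +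
        1 / (k + 1) * cycMean (n + 1) K (fun v => max 0 (psum (dirCoord θ v) (k + 1))) := by
  have hint : ∀ {f : (Fin (n + 1) → Euc d) → ℝ}, Measurable f →
      (∀ v, |f v| ≤ ∑ i, |dirCoord θ v i|) →
      Integrable (fun v => cycProd K v * (f v : ℂ)) volume := fun hf hB =>
    integrable_cycMean hN hKc hK hf hB
  have hcond : ∀ (v : Fin (n + 1) → Euc d) (x : ℝ), |x| ≤ ∑ i, |dirCoord θ v i| →
      ∀ (P : Prop) [Decidable P], |if P then x else 0| ≤ ∑ i, |dirCoord θ v i| := by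
    intro v x hx P _
    split_ifs
    · exact hx
    · simpa using Finset.sum_nonneg fun i _ => abs_nonneg _
  have hM : ∀ (v : Fin (n + 1) → Euc d) m, |runMax (dirCoord θ v) m| ≤ ∑ i, |dirCoord θ v i| :=
    fun v m => by
      rw [abs_of_nonneg (runMax_nonneg _ _)]
      exact runMax_le _ _
  have hMm : ∀ m, Measurable fun v : Fin (n + 1) → Euc d => runMax (dirCoord θ v) m := fun m =>
    (measurable_runMax m).comp (continuous_dirCoord θ).measurable
  set f1 : Fin (n + 1) → (Fin (n + 1) → Euc d) → ℝ := fun i v =>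
    if 0 < psum (dirCoord θ v) (k + 1) then dirCoord θ v i else 0 with hf1
  set f2 : (Fin (n + 1) → Euc d) → ℝ := fun v =>
    if 0 < psum (dirCoord θ v) (k + 1) then runMax (dirCoord θ v) k else 0 with hf2
  set f3 : (Fin (n + 1) → Euc d) → ℝ := fun v =>
    if 0 < psum (dirCoord θ v) (k + 1) then 0 else runMax (dirCoord θ v) k with hf3
  have i1 : ∀ i, Integrable (fun v => cycProd K v * (f1 i v : ℂ)) volume := fun i =>
    hint ((measurable_dirCoord_apply θ i).ite (measurableSet_psum_pos θ _) measurable_const)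
      fun v => hcond v _ (abs_dirCoord_le_sum θ v i) _
  have i2 : Integrable (fun v => cycProd K v * (f2 v : ℂ)) volume :=
    hint ((hMm k).ite (measurableSet_psum_pos θ _) measurable_const)
      fun v => hcond v _ (hM v k) _
  have i3 : Integrable (fun v => cycProd K v * (f3 v : ℂ)) volume :=
    hint (measurable_const.ite (measurableSet_psum_pos θ _) (hMm k)) fun v => by
      have := hcond v _ (hM v k) (¬ 0 < psum (dirCoord θ v) (k + 1))
      simpa only [f3, ite_not] using this
  set κ : Fin (n + 1) := ⟨k, hk⟩
  -- The cycle `i ↦ i + 1` for `i < k`, `k ↦ 0`, fixing the larger indices. It permutes the first `k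
  -- + 1` increments, hence preserves both the weight and the event that their sum is positive.
  set σ : Equiv.Perm (Fin (n + 1)) := Fin.cycleRange κ with hσ
  have hσ1 : ∀ i : Fin (n + 1), i.val < k → (σ i).val = i.val + 1 := fun i hi =>
    Fin.coe_cycleRange_of_lt (by simpa [κ, Fin.lt_def] using hi)
  have hσ2 : ∀ i : Fin (n + 1), (σ i).val < k + 1 ↔ i.val < k + 1 := fun i => by
    rcases lt_trichotomy i κ with h | h | h
    · have h' : i.val < k := h
      rw [hσ1 i h']
      omega
    · rw [hσ, h, Fin.cycleRange_self]
      simp [κ]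
    · rw [hσ, Fin.cycleRange_of_gt h]
  have hps : ∀ v : Fin (n + 1) → Euc d, psum (dirCoord θ (v ∘ σ)) (k + 1) =
      psum (dirCoord θ v) (k + 1) := fun v => by
    rw [dirCoord_comp, psum_comp_perm _ σ hσ2]
  -- By exchangeability `f2` may be replaced by its rotation, after which the identity is pointwise
  -- `runMax_rotate`.
  have e1 : cycMean (n + 1) K (fun v => runMax (dirCoord θ v) (k + 1)) =
      cycMean (n + 1) K (f1 0) + cycMean (n + 1) K f2 + cycMean (n + 1) K f3 := by
    have i2' : Integrable (fun v => cycProd K v * (f2 (v ∘ σ) : ℂ)) volume := by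
      refine hint (f := fun v => f2 (v ∘ σ)) ?_ fun v => ?_
      · exact ((hMm k).ite (measurableSet_psum_pos θ _) measurable_const).comp
          (measurable_pi_lambda _ fun _ => measurable_pi_apply _)
      · have h1 := hcond (v ∘ σ) _ (hM (v ∘ σ) k) (0 < psum (dirCoord θ (v ∘ σ)) (k + 1))
        refine h1.trans (le_of_eq ?_)
        rw [dirCoord_comp]
        exact Equiv.sum_comp σ fun i => |dirCoord θ v i|
    rw [← cycMean_comp_perm f2 σ, ← cycMean_add (i1 0) i2', ← cycMean_add _ i3]
    · congr 1
      ext v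
      rw [runMax_rotate _ σ hk hσ1]
      simp only [f1, f2, f3, hps]
      split_ifs
      · rw [dirCoord_comp, add_zero]
      · ring
    · refine ((i1 0).add i2').congr (.of_forall fun v => ?_)
      simp only [Pi.add_apply]
      push_cast
      ring
  have e2 : cycMean (n + 1) K (fun v => runMax (dirCoord θ v) k) =
      cycMean (n + 1) K f2 + cycMean (n + 1) K f3 := by
    rw [← cycMean_add i2 i3]
    congr 1
    ext v
    simp only [f2, f3]
    split_ifs <;> ring
  have e3 : ∀ i : Fin (n + 1), i.val < k + 1 → cycMean (n + 1) K (f1 i) = cycMean (n + 1) K (f1 0) := by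
    intro i hi
    rw [← cycMean_comp_perm (f1 0) (Equiv.swap 0 i)]
    congr 1
    ext v
    simp only [f1]
    rw [dirCoord_comp, psum_comp_perm]
    · simp
    · intro j
      rcases eq_or_ne j 0 with rfl | h0
      · simpa using hi
      · rcases eq_or_ne j i with rfl | h1
        · simpa using hi
        · rw [Equiv.swap_apply_of_ne_of_ne h0 h1]
  -- The positive part of the sum is the sum of its `k + 1` increments on the event of positivity,
  -- and all of them have the same mean there.
  have e4 : cycMean (n + 1) K (fun v => max 0 (psum (dirCoord θ v) (k + 1))) =
      (k + 1) * cycMean (n + 1) K (f1 0) := by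
    have h1 : (fun v : Fin (n + 1) → Euc d => max 0 (psum (dirCoord θ v) (k + 1))) =
        fun v => ∑ i ∈ Finset.univ.filter (fun i : Fin (n + 1) => i.val < k + 1), f1 i v := by
      ext v
      simp only [f1]
      split_ifs with h
      · rw [max_eq_right h.le, psum, Finset.sum_filter]
      · rw [max_eq_left (not_lt.1 h), Finset.sum_const_zero]
    rw [h1, cycMean_sum _ fun i _ => i1 i,
      Finset.sum_congr rfl fun i hi => e3 i (Finset.mem_filter.1 hi).2, Finset.sum_const]
    have h2 : (Finset.univ.filter (fun i : Fin (n + 1) => i.val < k + 1)).card = k + 1 := by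
      rw [Fin.card_filter_val_lt, min_eq_right (by omega)]
    rw [h2, nsmul_eq_mul]
    push_cast
    ring
  rw [e1, e2, e4, ← mul_assoc, one_div_mul_cancel (by exact_mod_cast Nat.succ_ne_zero k)]
  ring

theorem integral_snoc_right {G : (Fin (n + 1) → Euc d) → ℂ} (hG : Integrable G volume) :
    ∫ v, G v = ∫ v : Fin n → Euc d, ∫ x, G (Fin.snoc (α := fun _ => Euc d) v x) := by
  rw [integral_snoc hG]
  exact integral_integral_swap (f := fun x v => G (Fin.snoc (α := fun _ => Euc d) v x))
    (integrable_comp_snoc hG)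

/-- The `n + 1` increments and the closing one `-∑ v` are exchangeable under the cyclic product and
add up to zero. Their common mean therefore satisfies `(n + 2) μ = 0`. -/
theorem cycMean_dirCoord (hN : 1 + d < N) (hKc : Continuous K)
    (hK : ∀ z, ‖K z‖ ≤ c * decay N z) (θ : Euc d) (i : Fin (n + 1)) :
    cycMean (n + 1) K (fun v => dirCoord θ v i) = 0 := by
  have hi : ∀ i, Integrable (fun v : Fin (n + 1) → Euc d =>
      cycProd K v * ((dirCoord θ v i : ℝ) : ℂ)) volume := fun i =>
    integrable_cycMean hN hKc hK (measurable_dirCoord_apply θ i) (abs_dirCoord_le_sum θ · i)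
  have e1 : ∀ i, cycMean (n + 1) K (fun v => dirCoord θ v i) =
      cycMean (n + 1) K (fun v => dirCoord θ v (Fin.last n)) := fun i => by
    rw [← cycMean_comp_perm (fun v => dirCoord θ v (Fin.last n)) (Equiv.swap (Fin.last n) i)]
    congr 1
    ext v
    simp [dirCoord_comp]
  have hs : Integrable (fun v : Fin (n + 1) → Euc d =>
      cycProd K v * ((∑ i, dirCoord θ v i : ℝ) : ℂ)) volume :=
    integrable_cycMean hN hKc hK
      (Finset.measurable_sum _ fun i _ => measurable_dirCoord_apply θ i)
      fun v => Finset.abs_sum_le_sum_abs _ _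
  have hsn : Integrable (fun v : Fin (n + 1) → Euc d =>
      -(cycProd K v * ((∑ i, dirCoord θ v i : ℝ) : ℂ))) volume := hs.neg
  have e2 : cycMean (n + 1) K (fun v => dirCoord θ v (Fin.last n)) =
      -cycMean (n + 1) K (fun v => ∑ i, dirCoord θ v i) := by
    rw [cycMean, cycMean, ← integral_neg, integral_snoc_right (hi _), integral_snoc_right hsn]
    refine integral_congr_ae (.of_forall fun v => ?_)
    beta_reduce
    -- This reflection of the last increment swaps it with the closing increment, leaving the weight
    -- unchanged.
    rw [← integral_sub_left_eq_self _ volume (-∑ i, v i)]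
    refine integral_congr_ae (.of_forall fun x => ?_)
    simp only [cycProd, dirCoord, Fin.prod_univ_castSucc, Fin.sum_univ_castSucc,
      Fin.snoc_castSucc, Fin.snoc_last]
    have h1 : -(∑ i, v i + (-∑ i, v i - x)) = x := by abel
    have h2 : -(∑ i, v i + x) = -∑ i, v i - x := by abel
    rw [h1, h2, inner_sub_left, inner_neg_left, sum_inner]
    push_cast
    ring
  rw [cycMean_sum _ fun i _ => hi i, Finset.sum_congr rfl fun i _ => e1 i, Finset.sum_const,
    Finset.card_univ, Fintype.card_fin, nsmul_eq_mul] at e2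
  rw [e1]
  have h3 : ((n : ℂ) + 2) * cycMean (n + 1) K (fun v => dirCoord θ v (Fin.last n)) = 0 := by
    push_cast at e2
    linear_combination e2
  exact (mul_eq_zero.1 h3).resolve_left (by exact_mod_cast Nat.succ_ne_zero (n + 1))

/-- Iterating Spitzer's recursion gives the means of `S⁺ = (|S| + S) / 2`, and `S` has mean zero. -/
theorem cycMean_runMax (hN : 1 + d < N) (hKc : Continuous K)
    (hK : ∀ z, ‖K z‖ ≤ c * decay N z) (θ : Euc d) :
    cycMean (n + 1) K (fun v => runMax (dirCoord θ v) (n + 1)) =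
      ∑ k ∈ Finset.range (n + 1), 1 / (2 * ((k : ℂ) + 1)) *
        cycMean (n + 1) K (fun v => |psum (dirCoord θ v) (k + 1)|) := by
  have hpos : ∀ m, cycMean (n + 1) K (fun v => max 0 (psum (dirCoord θ v) m)) =
      1 / 2 * cycMean (n + 1) K (fun v => |psum (dirCoord θ v) m|) := fun m => by
    have hle : ∀ v : Fin (n + 1) → Euc d, |psum (dirCoord θ v) m| ≤ ∑ i, |dirCoord θ v i| :=
      fun v => by simpa only [Real.norm_eq_abs] using norm_psum_le (dirCoord θ v) m
    have hm := measurable_psum_dirCoord (n := n + 1) θ m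
    have i1 := integrable_cycMean hN hKc hK hm.abs (θ := θ) fun v => by rw [abs_abs]; exact hle v
    have i2 := integrable_cycMean hN hKc hK hm hle
    have e0 : cycMean (n + 1) K (fun v => psum (dirCoord θ v) m) = 0 := by
      have h1 : (fun v : Fin (n + 1) → Euc d => psum (dirCoord θ v) m) =
          fun v => ∑ i ∈ Finset.univ.filter (fun i : Fin (n + 1) => i.val < m), dirCoord θ v i := by
        ext v
        rw [psum, Finset.sum_filter]
      rw [h1, cycMean_sum _ fun i _ => integrable_cycMean hN hKc hK
        (measurable_dirCoord_apply θ i) (abs_dirCoord_le_sum θ · i)]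
      exact Finset.sum_eq_zero fun i _ => cycMean_dirCoord hN hKc hK θ i
    have e1 := cycMean_add i1 i2
    rw [e0, add_zero] at e1
    rw [← e1, cycMean, cycMean, ← integral_const_mul]
    congr 1
    ext v
    rcases le_total 0 (psum (dirCoord θ v) m) with h | h
    · rw [max_eq_right h, abs_of_nonneg h]; push_cast; ring
    · rw [max_eq_left h, abs_of_nonpos h]; push_cast; ring
  have hind : ∀ m ≤ n + 1, cycMean (n + 1) K (fun v => runMax (dirCoord θ v) m) =
      ∑ k ∈ Finset.range m, 1 / (2 * ((k : ℂ) + 1)) *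
        cycMean (n + 1) K (fun v => |psum (dirCoord θ v) (k + 1)|) := by
    intro m
    induction m with
    | zero => intro _; simp [cycMean, runMax]
    | succ m ih =>
      intro hm
      rw [cycMean_runMax_succ hN hKc hK θ (by omega), ih (by omega), Finset.sum_range_succ, hpos]
      congr 1
      rw [← mul_assoc]
      congr 1
      field_simp
  exact hind _ le_rfl

end expectation

/-! ### The integral of `(1 - cos (s t)) / t²` -/

/-- Combines `1 - cos x ≤ x² / 2` near `t = 0` with `1 - cos x ≤ 2` far out. The quadratic growth in
`s` is what later demands two additional powers of decay. -/
theorem one_sub_cos_div_sq_le (s t : ℝ) :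
    ‖(1 - Real.cos (t * s)) / t ^ 2‖ ≤ (s ^ 2 + 2) * (1 + t ^ 2)⁻¹ := by
  have h1 := Real.cos_le_one (t * s)
  have h2 := Real.neg_one_le_cos (t * s)
  have h3 := Real.one_sub_sq_div_two_le_cos (x := t * s)
  rw [Real.norm_of_nonneg (div_nonneg (by linarith) (sq_nonneg t))]
  rcases eq_or_ne t 0 with rfl | ht
  · simp; positivity
  have ht' : 0 < t ^ 2 := by positivity
  rw [← div_eq_mul_inv, div_le_div_iff₀ ht' (by positivity)]
  nlinarith [mul_nonneg ht'.le (by linarith : 0 ≤ 1 + Real.cos (t * s))]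

theorem integral_one_sub_cos_div_sq_mul (s : ℝ) :
    ∫ t : ℝ, (1 - Real.cos (t * s)) / t ^ 2 = |s| * ∫ t : ℝ, (1 - Real.cos t) / t ^ 2 := by
  rcases eq_or_ne s 0 with rfl | hs
  · simp
  have h := Measure.integral_comp_mul_right (fun t : ℝ => (1 - Real.cos t) / t ^ 2) s
  have h1 : ∀ t : ℝ, (1 - Real.cos (t * s)) / t ^ 2 =
      s ^ 2 * ((1 - Real.cos (t * s)) / (t * s) ^ 2) := fun t => by
    rcases eq_or_ne t 0 with rfl | ht
    · simp
    · field_simp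
  simp_rw [h1]
  rw [integral_const_mul, h, smul_eq_mul, abs_inv, ← mul_assoc, ← sq_abs s]
  congr 1
  field_simp

theorem integral_exp_mul_one_sub_cos (t : ℝ) :
    IntegrableOn (fun s : ℝ => Real.exp (-s) * (1 - Real.cos (t * s))) (Set.Ioi 0) ∧
    ∫ s in Set.Ioi (0 : ℝ), Real.exp (-s) * (1 - Real.cos (t * s)) = t ^ 2 / (1 + t ^ 2) := by
  have ha : (-1 + t * Complex.I).re < 0 := by simp
  have h1 := integral_exp_mul_complex_Ioi ha 0
  have i1 := integrableOn_exp_mul_complex_Ioi ha 0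
  have hb : (-1 : ℂ).re < 0 := by simp
  have h2 := integral_exp_mul_complex_Ioi hb 0
  have i2 := integrableOn_exp_mul_complex_Ioi hb 0
  have hre : ∀ s : ℝ, Real.exp (-s) * (1 - Real.cos (t * s)) =
      (Complex.exp (-1 * s) - Complex.exp ((-1 + t * Complex.I) * s)).re := fun s => by
    simp [Complex.exp_re]
    ring
  have i3 := (i2.sub i1).re
  simp_rw [hre]
  refine ⟨i3, ?_⟩
  have h4 := integral_re (i2.sub i1)
  refine h4.trans ?_
  simp only [Pi.sub_apply]
  rw [integral_sub i2 i1, h1, h2]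
  have hne : (1 + t ^ 2) ≠ 0 := by positivity
  simp [Complex.div_re, Complex.normSq]
  field_simp
  ring

/-- By scaling the integral is `c |s|`. Integrating against `exp(-s)` over `s > 0` gives `c ∫ s
exp(-s) ds = c` in one order and `∫ (1 + t²)⁻¹ dt = π` in the other. -/
theorem integral_one_sub_cos_div_sq (s : ℝ) :
    ∫ t : ℝ, (1 - Real.cos (t * s)) / t ^ 2 = Real.pi * |s| := by
  set c := ∫ t : ℝ, (1 - Real.cos t) / t ^ 2 with hc
  suffices h : c = Real.pi by rw [integral_one_sub_cos_div_sq_mul, ← hc, h, mul_comm]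
  set f : ℝ → ℝ → ℝ := fun t s => Real.exp (-s) * ((1 - Real.cos (t * s)) / t ^ 2) with hf
  have hfs : ∀ t s, f t s = (t ^ 2)⁻¹ * (Real.exp (-s) * (1 - Real.cos (t * s))) := fun t s => by
    simp only [f]; ring
  have hfm : Measurable (Function.uncurry f) := by
    simp only [hf, Function.uncurry_def]
    fun_prop
  have hnn : ∀ t s, 0 ≤ f t s := fun t s =>
    mul_nonneg (Real.exp_pos _).le (div_nonneg (by linarith [Real.cos_le_one (t * s)]) (sq_nonneg t))
  have hin : ∀ t ≠ 0, ∫ s in Set.Ioi 0, f t s = (1 + t ^ 2)⁻¹ := fun t ht => by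
    simp_rw [hfs]
    rw [integral_const_mul, (integral_exp_mul_one_sub_cos t).2]
    field_simp
  have hae : (fun t => ∫ s in Set.Ioi 0, f t s) =ᵐ[volume] fun t => (1 + t ^ 2)⁻¹ := by
    filter_upwards [Measure.ae_ne volume (0 : ℝ)] with t ht using hin t ht
  have hi : Integrable (Function.uncurry f) (volume.prod (volume.restrict (Set.Ioi 0))) := by
    rw [integrable_prod_iff hfm.aestronglyMeasurable]
    refine ⟨.of_forall fun t => ?_, ?_⟩
    · simp only [Function.uncurry_apply_pair, hfs]
      exact (integral_exp_mul_one_sub_cos t).1.const_mul _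
    · simp only [Function.uncurry_apply_pair, Real.norm_of_nonneg (hnn _ _)]
      exact integrable_inv_one_add_sq.congr hae.symm
  have h1 := integral_integral_swap hi
  rw [integral_congr_ae hae, integral_univ_inv_one_add_sq] at h1
  rw [h1]
  have h2 : ∀ s ∈ Set.Ioi (0 : ℝ), ∫ t, f t s = c * (s ^ ((2 : ℝ) - 1) * Real.exp (-(1 * s))) := by
    intro s hs
    simp only [hf]
    rw [integral_const_mul, integral_one_sub_cos_div_sq_mul, abs_of_pos hs, ← hc]
    norm_num
    ring
  rw [setIntegral_congr_fun measurableSet_Ioi h2, integral_const_mul,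
    Real.integral_rpow_mul_exp_neg_mul_Ioi (by norm_num) (by norm_num)]
  simp

/-! ### The function `U` for monomials -/

/-- Let `u` be the point of the segment. The numerator is `(1 - t)(u^p - s₁^p) + t (u^p - s₂^p)`,
while `u - s₁ = t (s₂ - s₁)` and `u - s₂ = -(1 - t)(s₂ - s₁)`. Factoring both differences as
geometric sums cancels `t (1 - t)`, and `(s₂ - s₁) u^j` has a primitive because `u' = s₂ - s₁`. -/
theorem coeffU_gPow (n : ℕ) (s₁ s₂ : ℂ) :
    coeffU (gPow (n + 2)) s₁ s₂ = ∑ k ∈ Finset.range (n + 1), 1 / ((k : ℂ) + 1) *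
      (s₁ ^ (k + 1) * s₂ ^ (n + 1 - k) + s₁ ^ (n + 1 - k) * s₂ ^ (k + 1)
        - s₁ ^ (n + 2) - s₂ ^ (n + 2)) := by
  set u : ℝ → ℂ := fun t => (1 - t) * s₁ + t * s₂ with hu
  have hud : ∀ t, HasDerivAt u (s₂ - s₁) t := fun t => by
    have h1 : HasDerivAt (fun t : ℝ => (t : ℂ)) 1 t := Complex.ofRealCLM.hasDerivAt
    have h2 : HasDerivAt u (-1 * s₁ + 1 * s₂) t :=
      ((h1.const_sub 1).mul_const s₁).add (h1.mul_const s₂)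
    exact h2.congr_deriv (by ring)
  have huc : Continuous u := by fun_prop
  have hint : ∀ j : ℕ, ∫ t in (0 : ℝ)..1, (s₂ - s₁) * u t ^ j =
      1 / ((j : ℂ) + 1) * (s₂ ^ (j + 1) - s₁ ^ (j + 1)) := fun j => by
    have hj : (j : ℂ) + 1 ≠ 0 := by exact_mod_cast Nat.succ_ne_zero j
    have h1 : ∀ t ∈ Set.uIcc (0 : ℝ) 1, HasDerivAt (fun t => 1 / ((j : ℂ) + 1) * u t ^ (j + 1))
        ((s₂ - s₁) * u t ^ j) t := fun t _ => by
      refine (((hud t).pow (j + 1)).const_mul (1 / ((j : ℂ) + 1))).congr_deriv ?_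
      rw [Nat.add_sub_cancel]
      push_cast
      field_simp
    rw [intervalIntegral.integral_eq_sub_of_hasDerivAt h1
      ((by fun_prop : Continuous fun t => (s₂ - s₁) * u t ^ j).intervalIntegrable _ _)]
    simp only [u]
    simp
    ring
  have hpt : ∀ t ∈ Set.Ioo (0 : ℝ) 1,
      (gPow (n + 2) ((1 - t) * s₁ + t * s₂) - ((1 - t) * gPow (n + 2) s₁ + t * gPow (n + 2) s₂)) /
        (t * (1 - t)) = ∑ j ∈ Finset.range (n + 2), (s₁ ^ (n + 1 - j) - s₂ ^ (n + 1 - j)) *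
          ((s₂ - s₁) * u t ^ j) := by
    intro t ht
    have ht0 : (t : ℂ) ≠ 0 := by exact_mod_cast ht.1.ne'
    have ht1 : (1 : ℂ) - t ≠ 0 := by
      have : (1 : ℝ) - t ≠ 0 := by linarith [ht.2]
      exact_mod_cast this
    have g1 := (Commute.all (u t) s₁).geom_sum₂_mul (n + 2)
    have g2 := (Commute.all (u t) s₂).geom_sum₂_mul (n + 2)
    have e1 : ∀ s : ℂ, ∑ j ∈ Finset.range (n + 2), u t ^ j * s ^ (n + 2 - 1 - j) =
        ∑ j ∈ Finset.range (n + 2), u t ^ j * s ^ (n + 1 - j) := fun s => rfl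
    rw [e1] at g1 g2
    have e2 : u t - s₁ = t * (s₂ - s₁) := by simp only [u]; ring
    have e3 : u t - s₂ = -((1 - t) * (s₂ - s₁)) := by simp only [u]; ring
    rw [e2] at g1
    rw [e3] at g2
    have e4 : ∑ j ∈ Finset.range (n + 2), (s₁ ^ (n + 1 - j) - s₂ ^ (n + 1 - j)) *
          ((s₂ - s₁) * u t ^ j) =
        (s₂ - s₁) * (∑ j ∈ Finset.range (n + 2), u t ^ j * s₁ ^ (n + 1 - j)) -
        (s₂ - s₁) * (∑ j ∈ Finset.range (n + 2), u t ^ j * s₂ ^ (n + 1 - j)) := by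
      rw [Finset.mul_sum, Finset.mul_sum, ← Finset.sum_sub_distrib]
      exact Finset.sum_congr rfl fun j _ => by ring
    rw [e4, div_eq_iff (mul_ne_zero ht0 ht1)]
    simp only [gPow]
    change u t ^ (n + 2) - _ = _
    linear_combination -(1 - (t : ℂ)) * g1 - (t : ℂ) * g2
  have h1 : coeffU (gPow (n + 2)) s₁ s₂ = ∫ t in (0 : ℝ)..1, ∑ j ∈ Finset.range (n + 2),
      (s₁ ^ (n + 1 - j) - s₂ ^ (n + 1 - j)) * ((s₂ - s₁) * u t ^ j) := by
    -- The open interval avoids the endpoints, where division by zero gives a default value.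
    rw [coeffU, intervalIntegral.integral_of_le zero_le_one, integral_Ioc_eq_integral_Ioo,
      intervalIntegral.integral_of_le zero_le_one, integral_Ioc_eq_integral_Ioo]
    exact setIntegral_congr_fun measurableSet_Ioo hpt
  -- The term `j = n + 1` has `s₁^0 - s₂^0 = 0`, so `n + 1` terms remain.
  rw [h1, intervalIntegral.integral_finsetSum fun j _ =>
    (by fun_prop : Continuous fun t => (s₁ ^ (n + 1 - j) - s₂ ^ (n + 1 - j)) *
      ((s₂ - s₁) * u t ^ j)).intervalIntegrable _ _, Finset.sum_range_succ]
  simp only [intervalIntegral.integral_const_mul, hint, Nat.sub_self, pow_zero, sub_self, zero_mul,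
    intervalIntegral.integral_zero, add_zero]
  refine Finset.sum_congr rfl fun k hk => ?_
  have hk' : n + 2 = (k + 1) + (n + 1 - k) := by have := Finset.mem_range.1 hk; omega
  rw [hk', pow_add, pow_add]
  ring

/-- One factor of every monomial is kept and the others are bounded by `B`. The bound is linear in
the arguments, so it is integrable in `ξ` along with `a`, as Fubini in `truncA_eq` requires. -/
theorem norm_coeffU_gPow_le (n : ℕ) {B : ℝ} {s₁ s₂ : ℂ} (h₁ : ‖s₁‖ ≤ B) (h₂ : ‖s₂‖ ≤ B) :
    ‖coeffU (gPow (n + 2)) s₁ s₂‖ ≤ ((n + 1) * (3 * B ^ (n + 1))) * (‖s₁‖ + ‖s₂‖) := by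
  have hB : 0 ≤ B := (norm_nonneg _).trans h₁
  have hpow : ∀ (s t : ℂ) (i j : ℕ), ‖s‖ ≤ B → ‖t‖ ≤ B → i + j = n + 1 →
      ‖s ^ (i + 1) * t ^ j‖ ≤ B ^ (n + 1) * ‖s‖ := by
    intro s t i j hs ht hij
    rw [norm_mul, norm_pow, norm_pow, ← hij]
    calc ‖s‖ ^ (i + 1) * ‖t‖ ^ j = ‖s‖ ^ i * ‖t‖ ^ j * ‖s‖ := by ring
      _ ≤ B ^ i * B ^ j * ‖s‖ := by gcongr
      _ = _ := by rw [pow_add]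
  rw [coeffU_gPow]
  have hterm : ∀ k ∈ Finset.range (n + 1), ‖1 / ((k : ℂ) + 1) *
      (s₁ ^ (k + 1) * s₂ ^ (n + 1 - k) + s₁ ^ (n + 1 - k) * s₂ ^ (k + 1)
        - s₁ ^ (n + 2) - s₂ ^ (n + 2))‖ ≤ 3 * B ^ (n + 1) * (‖s₁‖ + ‖s₂‖) := by
    intro k hk
    have hk' := Finset.mem_range.1 hk
    have a1 := hpow s₁ s₂ k (n + 1 - k) h₁ h₂ (by omega)
    have a2 := hpow s₂ s₁ k (n + 1 - k) h₂ h₁ (by omega)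
    have a3 := hpow s₁ s₁ (n + 1) 0 h₁ h₁ (by omega)
    have a4 := hpow s₂ s₂ (n + 1) 0 h₂ h₂ (by omega)
    rw [mul_comm (s₂ ^ _)] at a2
    rw [pow_zero, mul_one] at a3 a4
    have h0 : ‖1 / ((k : ℂ) + 1)‖ ≤ 1 := by
      rw [norm_div, norm_one, div_le_one₀]
      · have : ((k : ℂ) + 1) = ((k + 1 : ℕ) : ℂ) := by push_cast; ring
        rw [this, Complex.norm_natCast]
        exact_mod_cast Nat.succ_le_succ (Nat.zero_le k)
      · exact norm_pos_iff.2 (by exact_mod_cast Nat.succ_ne_zero k)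
    rw [norm_mul]
    refine (mul_le_of_le_one_left (norm_nonneg _) h0).trans ?_
    refine (norm_sub_le _ _).trans ((add_le_add_left ((norm_sub_le _ _).trans
      (add_le_add_left (norm_add_le _ _) _)) _).trans ?_)
    have := mul_nonneg (pow_nonneg hB (n + 1)) (norm_nonneg s₁)
    have := mul_nonneg (pow_nonneg hB (n + 1)) (norm_nonneg s₂)
    linarith
  refine (norm_sum_le _ _).trans ((Finset.sum_le_sum hterm).trans (le_of_eq ?_))
  rw [Finset.sum_const, Finset.card_range, nsmul_eq_mul]
  push_cast
  ring

/-! ### The asymptotic coefficient -/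

section coefficient

variable {d n : ℕ} {a : Euc d → ℂ}

theorem fourier_fourierInv_eq_self (hac : Continuous a) (hai : Integrable a volume)
    (hA : Integrable (𝓕⁻ a) volume) : 𝓕 (𝓕⁻ a) = a := by
  refine hac.fourier_fourierInv_eq hai ?_
  have h : 𝓕 a = fun x => 𝓕⁻ a (-x) := by
    ext x
    rw [Real.fourierInv_eq_fourier_neg, neg_neg]
  rw [h]
  exact hA.comp_neg

theorem fourierChar_sum {ι : Type*} (s : Finset ι) (f : ι → ℝ) :
    (Real.fourierChar (∑ i ∈ s, f i) : ℂ) = ∏ i ∈ s, (Real.fourierChar (f i) : ℂ) := by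
  classical
  induction s using Finset.induction_on with
  | empty => simp
  | insert a s ha ih =>
    rw [Finset.sum_insert ha, Finset.prod_insert ha, AddChar.map_add_eq_mul, Circle.coe_mul, ih]

theorem integral_add_sub_sub {α : Type*} {m0 : MeasurableSpace α} {μ : Measure α}
    {f₁ f₂ f₃ f₄ : α → ℂ} (h₁ : Integrable f₁ μ) (h₂ : Integrable f₂ μ) (h₃ : Integrable f₃ μ)
    (h₄ : Integrable f₄ μ) : ∫ x, (f₁ x + f₂ x - f₃ x - f₄ x) ∂μ =
      ∫ x, f₁ x ∂μ + ∫ x, f₂ x ∂μ - ∫ x, f₃ x ∂μ - ∫ x, f₄ x ∂μ := by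
  have h : Integrable (fun x => f₁ x + f₂ x) μ := h₁.add h₂
  have h' : Integrable (fun x => f₁ x + f₂ x - f₃ x) μ := h.sub h₃
  rw [integral_sub h' h₄, integral_sub h h₃, integral_add h₁ h₂]

theorem prod_fourierChar (θ : Euc d) (t : ℝ) (m : ℕ) (v : Fin n → Euc d) (ν : Euc d) :
    ∏ i : Fin n, (Real.fourierChar (-inner ℝ (v i) (ν - if i.val < m then t • θ else 0)) : ℂ) =
      (Real.fourierChar (inner ℝ ν (-∑ i, v i)) : ℂ) *
        (Real.fourierChar (t * psum (dirCoord θ v) m) : ℂ) := by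
  rw [← Circle.coe_mul, ← AddChar.map_add_eq_mul]
  have h : inner ℝ ν (-∑ i, v i) + t * psum (dirCoord θ v) m =
      ∑ i : Fin n, (-inner ℝ (v i) (ν - if i.val < m then t • θ else 0)) := by
    rw [inner_neg_right, inner_sum, psum, Finset.mul_sum, ← Finset.sum_neg_distrib,
      ← Finset.sum_add_distrib]
    refine Finset.sum_congr rfl fun i _ => ?_
    rw [inner_sub_right, real_inner_comm]
    split_ifs
    · simp [dirCoord, inner_smul_right]
      ring
    · simp
  rw [h, fourierChar_sum]

/-- The closing factor is written as a Fourier integral over `ν`. Its phase and that of `psum` split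
over the increments, so for fixed `ν` the integral over `v` is a product of Fourier transforms of
`𝓕⁻ a`, each returning a value of `a`. -/
theorem integral_cycProd_mul_fourierChar (hac : Continuous a) (hai : Integrable a volume)
    (hA : Integrable (𝓕⁻ a) volume) (θ : Euc d) (t : ℝ) (m : ℕ) :
    ∫ v : Fin n → Euc d, cycProd (𝓕⁻ a) v *
        (Real.fourierChar (t * psum (dirCoord θ v) m) : ℂ) =
      ∫ ν, a ν * ∏ i : Fin n, a (ν - if i.val < m then t • θ else 0) := by
  set f : (Fin n → Euc d) → Euc d → ℂ := fun v ν => a ν * ∏ i : Fin n,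
    ((Real.fourierChar (-inner ℝ (v i) (ν - if i.val < m then t • θ else 0)) : ℂ) *
      𝓕⁻ a (v i)) with hf
  have hphase : Continuous fun p : (Fin n → Euc d) × Euc d => ∏ i : Fin n,
      (Real.fourierChar (-inner ℝ (p.1 i) (p.2 - if i.val < m then t • θ else 0)) : ℂ) := by
    fun_prop
  have hfi : Integrable (Function.uncurry f) (volume.prod volume) := by
    have h1 : Integrable (fun v : Fin n → Euc d => ∏ i, 𝓕⁻ a (v i)) volume :=
      Integrable.fintype_prod (f := fun _ => 𝓕⁻ a) fun _ => hA
    refine ((h1.mul_prod hai).mul_bdd (c := 1) hphase.aestronglyMeasurable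
      (.of_forall fun p => norm_prod_le_one _ fun i => (Circle.norm_coe _).le)).congr
      (.of_forall fun p => ?_)
    simp only [hf, Function.uncurry_def, Finset.prod_mul_distrib]
    ring
  have hl : ∀ v : Fin n → Euc d, cycProd (𝓕⁻ a) v *
      (Real.fourierChar (t * psum (dirCoord θ v) m) : ℂ) = ∫ ν, f v ν := fun v => by
    simp only [hf, Finset.prod_mul_distrib, prod_fourierChar]
    rw [cycProd, Real.fourierInv_eq a (-∑ i, v i), mul_assoc, mul_comm (∫ _, _), ← mul_assoc,
      ← integral_const_mul]
    refine integral_congr_ae (.of_forall fun ν => ?_)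
    simp only [Circle.smul_def, smul_eq_mul]
    ring
  simp_rw [hl]
  rw [integral_integral_swap hfi]
  refine integral_congr_ae (.of_forall fun ν => ?_)
  simp only [hf]
  rw [integral_const_mul]
  congr 1
  rw [integral_fintype_prod_volume_eq_prod (𝕜 := ℂ) (fun (i : Fin n) (x : Euc d) =>
    (Real.fourierChar (-inner ℝ x (ν - if i.val < m then t • θ else 0)) : ℂ) * 𝓕⁻ a x)]
  refine Finset.prod_congr rfl fun i _ => ?_
  conv_rhs => rw [← fourier_fourierInv_eq_self hac hai hA]
  rw [Real.fourier_eq]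
  rfl

/-- The increments counted by `psum` give shifted factors. The closing factor is never shifted,
which makes the unshifted exponent `n + 2 - m`. -/
theorem integral_cycProd_mul_fourierChar' (hac : Continuous a) (hai : Integrable a volume)
    (hA : Integrable (𝓕⁻ a) volume) (θ : Euc d) (t : ℝ) {m : ℕ} (hm : m ≤ n + 1) :
    ∫ v : Fin (n + 1) → Euc d, cycProd (𝓕⁻ a) v *
        (Real.fourierChar (t * psum (dirCoord θ v) m) : ℂ) =
      ∫ ν, a ν ^ (n + 2 - m) * a (ν - t • θ) ^ m := by
  rw [integral_cycProd_mul_fourierChar hac hai hA]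
  refine integral_congr_ae (.of_forall fun ν => ?_)
  have h1 : ∀ i : Fin (n + 1), a (ν - if i.val < m then t • θ else 0) =
      if i.val < m then a (ν - t • θ) else a ν := fun i => by split_ifs <;> simp
  simp only [h1, Finset.prod_ite, Finset.prod_const]
  have h2 : (Finset.univ.filter (fun i : Fin (n + 1) => i.val < m)).card = m := by
    rw [Fin.card_filter_val_lt, min_eq_right hm]
  have h3 : (Finset.univ.filter (fun i : Fin (n + 1) => ¬ i.val < m)).card = n + 1 - m := by
    have := Finset.card_filter_add_card_filter_not (s := (Finset.univ : Finset (Fin (n + 1))))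
      (fun i : Fin (n + 1) => i.val < m)
    rw [h2, Finset.card_univ, Fintype.card_fin] at this
    omega
  rw [h2, h3, show n + 2 - m = n + 1 - m + 1 by omega]
  ring

theorem integrable_pow_mul_pow (hac : Continuous a) (hai : Integrable a volume) {B : ℝ}
    (hB : ∀ x, ‖a x‖ ≤ B) (w : Euc d) (i j : ℕ) :
    Integrable (fun ξ => a ξ ^ (i + 1) * a (ξ + w) ^ j) volume := by
  have h : Integrable (fun ξ => a ξ * (a ξ ^ i * a (ξ + w) ^ j)) volume := by
    refine hai.mul_bdd (c := B ^ i * B ^ j)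
      (by fun_prop : Continuous fun ξ => a ξ ^ i * a (ξ + w) ^ j).aestronglyMeasurable
      (.of_forall fun ξ => ?_)
    have := (norm_nonneg _).trans (hB ξ)
    rw [norm_mul, norm_pow, norm_pow]
    gcongr <;> exact hB _
  refine h.congr (.of_forall fun ξ => ?_)
  simp only
  ring

theorem integrable_cycProd_mul_fourierChar (hai : Integrable a volume)
    (hA : Integrable (𝓕⁻ a) volume) {B : ℝ} (hB : ∀ x, ‖𝓕⁻ a x‖ ≤ B) (θ : Euc d) (t : ℝ) (m : ℕ) :
    Integrable (fun v : Fin n → Euc d => cycProd (𝓕⁻ a) v *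
        (Real.fourierChar (t * psum (dirCoord θ v) m) : ℂ)) volume := by
  refine (integrable_cycProd (continuous_fourierInv hai) hA hB).mul_bdd (c := 1) ?_
    (.of_forall fun v => (Circle.norm_coe _).le)
  have h : Continuous fun v : Fin n → Euc d => psum (dirCoord θ v) m :=
    (continuous_psum m).comp (continuous_dirCoord θ)
  exact (by fun_prop : Continuous fun v : Fin n → Euc d =>
    (Real.fourierChar (t * psum (dirCoord θ v) m) : ℂ)).aestronglyMeasurable

theorem fourierChar_add_neg (x : ℝ) :
    (Real.fourierChar x : ℂ) + (Real.fourierChar (-x) : ℂ) - 2 =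
      ((2 * (Real.cos (2 * Real.pi * x) - 1) : ℝ) : ℂ) := by
  rw [Real.fourierChar_apply, Real.fourierChar_apply]
  push_cast
  rw [Complex.cos]
  ring_nf

/-- The mean of `U` over the symbol, in terms of the kernel. -/
theorem integral_coeffU (hac : Continuous a) (hai : Integrable a volume) {B B' : ℝ}
    (hB : ∀ x, ‖a x‖ ≤ B) (hA : Integrable (𝓕⁻ a) volume) (hB' : ∀ x, ‖𝓕⁻ a x‖ ≤ B')
    (θ : Euc d) (t : ℝ) :
    ∫ ξ, coeffU (gPow (n + 2)) (a ξ) (a (ξ + t • θ)) =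
      ∑ k ∈ Finset.range (n + 1), 1 / ((k : ℂ) + 1) * cycMean (n + 1) (𝓕⁻ a) fun v =>
        2 * (Real.cos (2 * Real.pi * (t * psum (dirCoord θ v) (k + 1))) - 1) := by
  simp_rw [coeffU_gPow]
  have hsh : ∀ (f : Euc d → ℂ), ∫ ξ, f (ξ + t • θ) = ∫ ξ, f ξ := fun f =>
    integral_add_right_eq_self f (t • θ)
  have i1 : ∀ k ≤ n, Integrable (fun ξ => a ξ ^ (k + 1) * a (ξ + t • θ) ^ (n + 1 - k)) volume :=
    fun k _ => integrable_pow_mul_pow hac hai hB _ k _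
  have i2 : ∀ k ≤ n, Integrable (fun ξ => a ξ ^ (n + 1 - k) * a (ξ + t • θ) ^ (k + 1)) volume :=
    fun k hk => by
      rw [show n + 1 - k = n - k + 1 by omega]
      exact integrable_pow_mul_pow hac hai hB _ _ _
  have i3 : Integrable (fun ξ => a ξ ^ (n + 2)) volume := by
    simpa using integrable_pow_mul_pow hac hai hB 0 (n + 1) 0
  have i4 : Integrable (fun ξ => a (ξ + t • θ) ^ (n + 2)) volume := i3.comp_add_right (t • θ)
  have hterm : ∀ k ≤ n, Integrable (fun ξ => a ξ ^ (k + 1) * a (ξ + t • θ) ^ (n + 1 - k) +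
      a ξ ^ (n + 1 - k) * a (ξ + t • θ) ^ (k + 1) - a ξ ^ (n + 2) - a (ξ + t • θ) ^ (n + 2)) volume :=
    fun k hk => (((i1 k hk).add (i2 k hk)).sub i3).sub i4
  rw [integral_finsetSum _ fun k hk => (hterm k (by have := Finset.mem_range.1 hk; omega)).const_mul _]
  refine Finset.sum_congr rfl fun k hk => ?_
  have hk' : k ≤ n := by have := Finset.mem_range.1 hk; omega
  rw [integral_const_mul, integral_add_sub_sub (i1 k hk') (i2 k hk') i3 i4,
    hsh fun ξ => a ξ ^ (n + 2)]
  congr 1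
  have c0 := integral_cycProd_mul_fourierChar' (n := n) hac hai hA θ 0 (m := k + 1) (by omega)
  have c1 := integral_cycProd_mul_fourierChar' (n := n) hac hai hA θ t (m := k + 1) (by omega)
  have c2 := integral_cycProd_mul_fourierChar' (n := n) hac hai hA θ (-t) (m := k + 1) (by omega)
  have j0 := integrable_cycProd_mul_fourierChar (n := n + 1) hai hA hB' θ 0 (k + 1)
  have j1 := integrable_cycProd_mul_fourierChar (n := n + 1) hai hA hB' θ t (k + 1)
  have j2 := integrable_cycProd_mul_fourierChar (n := n + 1) hai hA hB' θ (-t) (k + 1)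
  have e1 : ∫ ξ, a ξ ^ (k + 1) * a (ξ + t • θ) ^ (n + 1 - k) =
      ∫ ν, a ν ^ (n + 2 - (k + 1)) * a (ν - t • θ) ^ (k + 1) := by
    rw [← hsh fun ν => a ν ^ (n + 2 - (k + 1)) * a (ν - t • θ) ^ (k + 1)]
    refine integral_congr_ae (.of_forall fun ξ => ?_)
    beta_reduce
    rw [add_sub_cancel_right, mul_comm, show n + 2 - (k + 1) = n + 1 - k by omega]
  have e2 : ∫ ξ, a ξ ^ (n + 1 - k) * a (ξ + t • θ) ^ (k + 1) =
      ∫ ν, a ν ^ (n + 2 - (k + 1)) * a (ν - (-t) • θ) ^ (k + 1) := by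
    refine integral_congr_ae (.of_forall fun ξ => ?_)
    beta_reduce
    rw [neg_smul, sub_neg_eq_add, show n + 2 - (k + 1) = n + 1 - k by omega]
  have e3 : ∫ ξ, a ξ ^ (n + 2) = ∫ ν, a ν ^ (n + 2 - (k + 1)) * a (ν - (0 : ℝ) • θ) ^ (k + 1) := by
    refine integral_congr_ae (.of_forall fun ξ => ?_)
    beta_reduce
    rw [zero_smul, sub_zero, ← pow_add]
    congr 1
    omega
  rw [e1, e2, e3, ← c0, ← c1, ← c2, ← integral_add_sub_sub j1 j2 j0 j0, cycMean]
  refine integral_congr_ae (.of_forall fun v => ?_)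
  beta_reduce
  rw [← fourierChar_add_neg, zero_mul, AddChar.map_zero_eq_one, neg_mul]
  simp only [Circle.coe_one]
  ring

end coefficient

/-! ### The principal value in closed form -/

section coefficient

variable {d n : ℕ} {a : Euc d → ℂ}

theorem measurableSet_lt_abs (ε : ℝ) : MeasurableSet {t : ℝ | ε < |t|} :=
  measurableSet_lt measurable_const measurable_abs

theorem integrableOn_inv_sq {ε : ℝ} (hε : 0 < ε) :
    IntegrableOn (fun t : ℝ => (t ^ 2)⁻¹) {t | ε < |t|} := by
  have h := (integrable_inv_one_add_sq.const_mul (1 + (ε ^ 2)⁻¹)).integrableOn (s := {t : ℝ | ε < |t|})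
  refine h.mono' (by fun_prop : Measurable fun t : ℝ => (t ^ 2)⁻¹).aestronglyMeasurable ?_
  filter_upwards [ae_restrict_mem (measurableSet_lt_abs ε)] with t ht
  have h1 : ε ^ 2 ≤ t ^ 2 := by
    rw [← sq_abs t]
    exact pow_le_pow_left₀ hε.le (le_of_lt ht) 2
  have ht2 : 0 < t ^ 2 := lt_of_lt_of_le (by positivity) h1
  rw [Real.norm_of_nonneg (by positivity), ← div_eq_mul_inv, inv_eq_one_div,
    div_le_div_iff₀ ht2 (by positivity)]
  have h2 : 1 ≤ (ε ^ 2)⁻¹ * t ^ 2 := by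
    rw [inv_mul_eq_div, one_le_div (by positivity)]
    exact h1
  nlinarith

/-- Fubini: `t⁻²` is integrable on `|t| > ε`, and the `ξ`-integral of `|U|` is bounded independently
of `t`. With `ξ` integrated first, `integral_coeffU` applies. -/
theorem truncA_eq (hac : Continuous a) (hai : Integrable a volume) {B : ℝ}
    (hB : ∀ x, ‖a x‖ ≤ B) (θ : Euc d) {ε : ℝ} (hε : 0 < ε) :
    truncA a θ (gPow (n + 2)) ε = ∫ t in {t : ℝ | ε < |t|},
      (∫ ξ, coeffU (gPow (n + 2)) (a ξ) (a (ξ + t • θ))) / (t : ℂ) ^ 2 := by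
  have hUc : Continuous fun p : Euc d × ℝ => coeffU (gPow (n + 2)) (a p.1) (a (p.1 + p.2 • θ)) := by
    simp_rw [coeffU_gPow]
    fun_prop
  have hm : AEStronglyMeasurable (Function.uncurry fun (ξ : Euc d) (t : ℝ) =>
      coeffU (gPow (n + 2)) (a ξ) (a (ξ + t • θ)) / (t : ℂ) ^ 2)
      (volume.prod (volume.restrict {t : ℝ | ε < |t|})) := by
    have h1 : Measurable fun p : Euc d × ℝ => ((p.2 : ℂ)) ^ 2 := by fun_prop
    exact (hUc.measurable.div h1).aestronglyMeasurable
  set D := (n + 1) * (3 * B ^ (n + 1)) with hD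
  have hB0 : 0 ≤ B := (norm_nonneg _).trans (hB 0)
  have hbd : ∀ (ξ : Euc d) (t : ℝ), ‖coeffU (gPow (n + 2)) (a ξ) (a (ξ + t • θ)) / (t : ℂ) ^ 2‖ ≤
      D * (‖a ξ‖ + ‖a (ξ + t • θ)‖) * (t ^ 2)⁻¹ := fun ξ t => by
    rw [norm_div, norm_pow, Complex.norm_real, Real.norm_eq_abs, sq_abs, div_eq_mul_inv]
    gcongr
    exact norm_coeffU_gPow_le n (hB _) (hB _)
  have hi0 : ∀ t : ℝ, Integrable (fun ξ => D * (‖a ξ‖ + ‖a (ξ + t • θ)‖) * (t ^ 2)⁻¹) volume :=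
    fun t => ((hai.norm.add (hai.comp_add_right (t • θ)).norm).const_mul D).mul_const _
  have hi1 : ∀ t : ℝ, Integrable
      (fun ξ => coeffU (gPow (n + 2)) (a ξ) (a (ξ + t • θ)) / (t : ℂ) ^ 2) volume := fun t => by
    refine (hi0 t).mono' ?_ (.of_forall fun ξ => hbd ξ t)
    exact ((hUc.comp (by fun_prop : Continuous fun ξ : Euc d => (ξ, t))).div_const
      _).aestronglyMeasurable
  have hi : Integrable (Function.uncurry fun (ξ : Euc d) (t : ℝ) =>
      coeffU (gPow (n + 2)) (a ξ) (a (ξ + t • θ)) / (t : ℂ) ^ 2)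
      (volume.prod (volume.restrict {t : ℝ | ε < |t|})) := by
    rw [integrable_prod_iff' hm]
    refine ⟨.of_forall hi1, ?_⟩
    refine ((integrableOn_inv_sq hε).const_mul (D * (2 * ∫ ξ, ‖a ξ‖))).mono'
      hm.norm.prod_swap.integral_prod_right' (.of_forall fun t => ?_)
    rw [Real.norm_of_nonneg (integral_nonneg fun _ => norm_nonneg _)]
    refine (integral_mono (hi1 t).norm (hi0 t) fun ξ => hbd ξ t).trans (le_of_eq ?_)
    rw [integral_mul_const, integral_const_mul, integral_add hai.norm
      (hai.comp_add_right (t • θ)).norm, integral_add_right_eq_self (fun ξ => ‖a ξ‖)]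
    ring
  rw [truncA, integral_integral_swap hi]
  refine integral_congr_ae (.of_forall fun t => ?_)
  exact integral_div _ _

theorem integral_cos_sub_one (s : ℝ) :
    ∫ t : ℝ, 2 * (Real.cos (2 * Real.pi * (t * s)) - 1) / t ^ 2 = -(4 * Real.pi ^ 2) * |s| := by
  have h := integral_one_sub_cos_div_sq (2 * Real.pi * s)
  have h1 : ∀ t : ℝ, 2 * (Real.cos (2 * Real.pi * (t * s)) - 1) / t ^ 2 =
      -2 * ((1 - Real.cos (t * (2 * Real.pi * s))) / t ^ 2) := fun t => by
    rw [show 2 * Real.pi * (t * s) = t * (2 * Real.pi * s) by ring]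
    ring
  simp_rw [h1]
  rw [integral_const_mul, h, abs_mul, abs_of_pos (by positivity)]
  ring

theorem integrable_cycProd_mul_cos {N : ℕ} (hN : 2 + d < N) {K : Euc d → ℂ} (hKc : Continuous K)
    {c : ℝ} (hK : ∀ z, ‖K z‖ ≤ c * decay N z) (θ : Euc d) (m : ℕ) :
    Integrable (fun p : ℝ × (Fin n → Euc d) => cycProd K p.2 *
      ((2 * (Real.cos (2 * Real.pi * (p.1 * psum (dirCoord θ p.2) m)) - 1) / p.1 ^ 2 : ℝ) : ℂ))
      (volume.prod volume) := by
  set B := 2 * ((2 * Real.pi) ^ 2 * ‖θ‖ ^ 2 + 2) with hB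
  have hgm : Continuous fun v : Fin n → Euc d => (((1 + ∑ i, ‖v i‖) ^ 2 : ℝ) : ℂ) := by fun_prop
  have h1 := integrable_cycProd_mul (n := n) (M := 2) (B := 1) hN hKc hK
    (f := fun v => (((1 + ∑ i, ‖v i‖) ^ 2 : ℝ) : ℂ)) hgm.aestronglyMeasurable fun v => by
      rw [Complex.norm_real, one_mul, Real.norm_of_nonneg (by positivity)]
  have h2 := (integrable_inv_one_add_sq.const_mul B).mul_prod h1.norm
  have hps : Continuous fun v : Fin n → Euc d => psum (dirCoord θ v) m :=
    (continuous_psum m).comp (continuous_dirCoord θ)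
  refine h2.mono' (Measurable.aestronglyMeasurable ?_) (.of_forall fun p => ?_)
  · have h3 : Measurable fun p : ℝ × (Fin n → Euc d) => cycProd K p.2 :=
      (continuous_cycProd (n := n) hKc).measurable.comp measurable_snd
    have h4 : Measurable fun p : ℝ × (Fin n → Euc d) => psum (dirCoord θ p.2) m :=
      hps.measurable.comp measurable_snd
    refine h3.mul (Complex.measurable_ofReal.comp (Measurable.div ?_ (by fun_prop)))
    exact ((Real.measurable_cos.comp ((measurable_fst.mul h4).const_mul _)).sub_const 1).const_mul 2
  · obtain ⟨t, v⟩ := p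
    simp only [norm_mul]
    set s := psum (dirCoord θ v) m with hs
    have h3 : |s| ≤ ‖θ‖ * (1 + ∑ i, ‖v i‖) := by
      have h4 : |s| ≤ ∑ i, |dirCoord θ v i| := by
        simpa only [Real.norm_eq_abs] using norm_psum_le (dirCoord θ v) m
      refine h4.trans ((sum_abs_dirCoord_le θ v).trans ?_)
      gcongr
      linarith
    have h5 := one_sub_cos_div_sq_le (2 * Real.pi * s) t
    have h6 : (2 * (Real.cos (2 * Real.pi * (t * s)) - 1) / t ^ 2 : ℝ) =
        -2 * ((1 - Real.cos (t * (2 * Real.pi * s))) / t ^ 2) := by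
      rw [show 2 * Real.pi * (t * s) = t * (2 * Real.pi * s) by ring]
      ring
    have h7 : s ^ 2 ≤ ‖θ‖ ^ 2 * (1 + ∑ i, ‖v i‖) ^ 2 := by
      rw [← sq_abs, ← mul_pow]
      exact pow_le_pow_left₀ (abs_nonneg _) h3 2
    have h8 : 1 ≤ (1 + ∑ i, ‖v i‖) ^ 2 := by
      have : 0 ≤ ∑ i, ‖v i‖ := Finset.sum_nonneg fun i _ => norm_nonneg _
      nlinarith
    rw [Complex.norm_real, Complex.norm_real, h6, norm_mul,
      Real.norm_of_nonneg (by positivity : 0 ≤ (1 + ∑ i, ‖v i‖) ^ 2)]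
    have h9 : ‖(-2 : ℝ)‖ * ‖(1 - Real.cos (t * (2 * Real.pi * s))) / t ^ 2‖ ≤
        B * (1 + t ^ 2)⁻¹ * (1 + ∑ i, ‖v i‖) ^ 2 := by
      rw [norm_neg, Real.norm_ofNat]
      calc _ ≤ 2 * (((2 * Real.pi * s) ^ 2 + 2) * (1 + t ^ 2)⁻¹) := by gcongr
        _ = 2 * ((2 * Real.pi) ^ 2 * s ^ 2 + 2 * 1) * (1 + t ^ 2)⁻¹ := by ring
        _ ≤ 2 * ((2 * Real.pi) ^ 2 * (‖θ‖ ^ 2 * (1 + ∑ i, ‖v i‖) ^ 2) +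
            2 * (1 + ∑ i, ‖v i‖) ^ 2) * (1 + t ^ 2)⁻¹ := by gcongr
        _ = _ := by rw [hB]; ring
    calc _ ≤ ‖cycProd K v‖ * (B * (1 + t ^ 2)⁻¹ * (1 + ∑ i, ‖v i‖) ^ 2) := by gcongr
      _ = _ := by ring

theorem tendsto_setIntegral_lt_abs {h : ℝ → ℂ} (hh : Integrable h volume) :
    Tendsto (fun ε => ∫ t in {t : ℝ | ε < |t|}, h t) (𝓝[>] 0) (𝓝 (∫ t, h t)) := by
  simp_rw [← integral_indicator (measurableSet_lt_abs _)]
  refine tendsto_integral_filter_of_dominated_convergence (fun t => ‖h t‖)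
    (.of_forall fun ε => hh.1.indicator (measurableSet_lt_abs ε))
    (.of_forall fun ε => .of_forall fun t => norm_indicator_le_norm_self _ _) hh.norm ?_
  filter_upwards [Measure.ae_ne volume (0 : ℝ)] with t ht
  refine tendsto_const_nhds.congr' ?_
  have : ∀ᶠ ε in 𝓝 (0 : ℝ), ε < |t| := eventually_lt_nhds (abs_pos.2 ht)
  filter_upwards [nhdsWithin_le_nhds this] with ε hε
  rw [Set.indicator_of_mem (by exact hε)]

/-- Existence and value of the principal value in the definition of `coeffA`. -/
theorem tendsto_truncA (hac : Continuous a) (hai : Integrable a volume) {B : ℝ}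
    (hB : ∀ x, ‖a x‖ ≤ B) {N : ℕ} (hN : 2 + d < N) {c : ℝ}
    (hc : ∀ z, ‖𝓕⁻ a z‖ ≤ c * decay N z) (θ : Euc d) :
    Tendsto (truncA a θ (gPow (n + 2))) (𝓝[>] 0) (𝓝 (-(8 * (Real.pi : ℂ) ^ 2) *
      cycMean (n + 1) (𝓕⁻ a) fun v => runMax (dirCoord θ v) (n + 1))) := by
  have hAc := continuous_fourierInv hai
  have hA : Integrable (𝓕⁻ a) volume :=
    ((integrable_decay (by omega)).const_mul c).mono' hAc.aestronglyMeasurable (.of_forall hc)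
  have hc0 : 0 ≤ c := nonneg_of_mul_nonneg_left ((norm_nonneg _).trans (hc 0)) (decay_pos _ 0)
  have hAB : ∀ x, ‖𝓕⁻ a x‖ ≤ c := fun x =>
    (hc x).trans (mul_le_of_le_one_right hc0 (decay_le_one _ _))
  set h : ℕ → ℝ → ℂ := fun k t => ∫ v : Fin (n + 1) → Euc d, cycProd (𝓕⁻ a) v *
    ((2 * (Real.cos (2 * Real.pi * (t * psum (dirCoord θ v) (k + 1))) - 1) / t ^ 2 : ℝ) : ℂ) with hh
  have hint := fun k => integrable_cycProd_mul_cos (n := n + 1) hN hAc hc θ (k + 1)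
  have hhi : ∀ k, Integrable (h k) volume := fun k => (hint k).integral_prod_left
  have hval : ∀ k, ∫ t, h k t = -(4 * (Real.pi : ℂ) ^ 2) *
      cycMean (n + 1) (𝓕⁻ a) fun v => |psum (dirCoord θ v) (k + 1)| := fun k => by
    have h1 := integral_integral_swap (f := fun (t : ℝ) (v : Fin (n + 1) → Euc d) =>
      cycProd (𝓕⁻ a) v * ((2 * (Real.cos (2 * Real.pi *
        (t * psum (dirCoord θ v) (k + 1))) - 1) / t ^ 2 : ℝ) : ℂ)) (hint k)
    refine h1.trans ?_
    rw [cycMean, ← integral_const_mul]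
    refine integral_congr_ae (.of_forall fun v => ?_)
    beta_reduce
    rw [integral_const_mul, integral_complex_ofReal, integral_cos_sub_one]
    push_cast
    ring
  have hlim : Tendsto (fun ε => ∑ k ∈ Finset.range (n + 1), 1 / ((k : ℂ) + 1) *
      ∫ t in {t : ℝ | ε < |t|}, h k t) (𝓝[>] 0) (𝓝 (∑ k ∈ Finset.range (n + 1),
        1 / ((k : ℂ) + 1) * ∫ t, h k t)) :=
    tendsto_finsetSum _ fun k _ => (tendsto_setIntegral_lt_abs (hhi k)).const_mul _
  -- Spitzer's weights `1 / (2(k + 1))` times `-8π²` are exactly `-4π² / (k + 1)`.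
  have hv : ∑ k ∈ Finset.range (n + 1), 1 / ((k : ℂ) + 1) * ∫ t, h k t = -(8 * (Real.pi : ℂ) ^ 2) *
      cycMean (n + 1) (𝓕⁻ a) fun v => runMax (dirCoord θ v) (n + 1) := by
    rw [cycMean_runMax (by omega : 1 + d < N) hAc hc, Finset.mul_sum]
    refine Finset.sum_congr rfl fun k _ => ?_
    rw [hval]
    have : (k : ℂ) + 1 ≠ 0 := by exact_mod_cast Nat.succ_ne_zero k
    field_simp
    ring
  rw [hv] at hlim
  -- The `t`-integrands `h k` are integrable on the whole line, so removing `|t| ≤ ε` is harmless in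
  -- the limit.
  refine hlim.congr' ?_
  filter_upwards [self_mem_nhdsWithin] with ε hε
  rw [truncA_eq hac hai hB θ hε]
  simp_rw [← integral_const_mul]
  rw [← integral_finsetSum _ fun k _ => ((hhi k).const_mul _).integrableOn]
  refine integral_congr_ae (.of_forall fun t => ?_)
  beta_reduce
  rw [integral_coeffU hac hai hB hA hAB, Finset.sum_div]
  refine Finset.sum_congr rfl fun k _ => ?_
  rw [mul_div_assoc, cycMean, ← integral_div]
  simp only [h]
  congr 1
  refine integral_congr_ae (.of_forall fun v => ?_)
  push_cast
  ring

/-- The prefactor cancels the `8π²` of the principal value. This is the form in which the boundary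
layer produces the coefficient. -/
theorem coeffA_eq (hac : Continuous a) (hai : Integrable a volume) {B : ℝ}
    (hB : ∀ x, ‖a x‖ ≤ B) {N : ℕ} (hN : 2 + d < N) {c : ℝ}
    (hc : ∀ z, ‖𝓕⁻ a z‖ ≤ c * decay N z) (θ : Euc d) :
    coeffA a θ (gPow (n + 2)) =
      -cycMean (n + 1) (𝓕⁻ a) fun v => runMax (dirCoord θ v) (n + 1) := by
  rw [coeffA, (tendsto_truncA hac hai hB hN hc θ).limUnder_eq]
  have : (Real.pi : ℂ) ≠ 0 := by exact_mod_cast Real.pi_ne_zero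
  field_simp

/-- The sign of the direction is irrelevant. -/
theorem cycMean_runMax_neg {N : ℕ} (hN : 1 + d < N) {K : Euc d → ℂ} (hKc : Continuous K)
    {c : ℝ} (hK : ∀ z, ‖K z‖ ≤ c * decay N z) (θ : Euc d) :
    cycMean (n + 1) K (fun v => runMax (dirCoord (-θ) v) (n + 1)) =
      cycMean (n + 1) K fun v => runMax (dirCoord θ v) (n + 1) := by
  rw [cycMean_runMax hN hKc hK, cycMean_runMax hN hKc hK]
  simp only [psum_dirCoord, inner_neg_right, abs_neg]

end coefficient

/-! ### Coordinates adapted to an epigraph -/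

section coordinates

variable {m : ℕ}

theorem hat_withLast (x : Euc m) (t : ℝ) : hat (withLast x t) = x := by
  ext i
  simp [hat, withLast]

theorem withLast_last (x : Euc m) (t : ℝ) : withLast x t (Fin.last m) = t := by
  simp [withLast]

theorem hat_add (x y : Euc (m + 1)) : hat (x + y) = hat x + hat y := by
  ext i
  simp [hat]

theorem hat_smul (c : ℝ) (x : Euc (m + 1)) : hat (c • x) = c • hat x := by
  ext i
  simp [hat]

theorem inner_withLast (x : Euc m) (t : ℝ) (w : Euc (m + 1)) :
    inner ℝ w (withLast x t) = inner ℝ (hat w) x + w (Fin.last m) * t := by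
  simp [PiLp.inner_apply, Fin.sum_univ_castSucc, withLast, hat, mul_comm]

theorem norm_hat_le (w : Euc (m + 1)) : ‖hat w‖ ≤ ‖w‖ := by
  rw [EuclideanSpace.norm_eq, EuclideanSpace.norm_eq, Fin.sum_univ_castSucc]
  refine Real.sqrt_le_sqrt ?_
  simp only [hat]
  linarith [sq_nonneg ‖w (Fin.last m)‖]

theorem abs_last_le (w : Euc (m + 1)) : |w (Fin.last m)| ≤ ‖w‖ := by
  simpa using PiLp.norm_apply_le w (Fin.last m)

theorem continuous_hat : Continuous (hat : Euc (m + 1) → Euc m) := by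
  unfold hat
  fun_prop

theorem continuous_withLast : Continuous fun p : Euc m × ℝ => withLast p.1 p.2 := by
  unfold withLast
  refine (PiLp.continuous_toLp 2 _).comp (continuous_pi fun i => ?_)
  refine Fin.lastCases ?_ (fun i => ?_) i
  · simpa using continuous_snd
  · simp only [Fin.snoc_castSucc]
    fun_prop

theorem measurePreserving_withLast :
    MeasurePreserving (fun p : Euc m × ℝ => withLast p.1 p.2) (volume.prod volume) volume := by
  have h1 := (PiLp.volume_preserving_toLp (Fin (m + 1)))
  have h2 := measurePreserving_snoc (V := ℝ) m
  have h3 := (PiLp.volume_preserving_ofLp (Fin m))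
  have h4 := Measure.measurePreserving_swap (μ := (volume : Measure (Fin m → ℝ)))
    (ν := (volume : Measure ℝ))
  exact h1.comp (h2.comp (h4.comp (h3.prod (MeasurePreserving.id volume))))

theorem measurePreserving_affineIsometry {d : ℕ} (e : Euc d ≃ᵃⁱ[ℝ] Euc d) :
    MeasurePreserving e volume volume := by
  have h1 := (measurePreserving_add_right volume (e 0)).comp e.linearIsometryEquiv.measurePreserving
  have h2 : ⇑e = (fun x => x + e 0) ∘ e.linearIsometryEquiv := by
    ext1 x
    have := e.map_vadd (0 : Euc d) x
    simpa only [vadd_eq_add, add_zero, Function.comp_apply] using this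
  rw [h2]
  exact h1

theorem e_symm_add {d : ℕ} (e : Euc d ≃ᵃⁱ[ℝ] Euc d) (w u : Euc d) :
    e (e.symm w + u) = w + e.linearIsometryEquiv u := by
  have := e.map_vadd (e.symm w) u
  rw [AffineIsometryEquiv.apply_symm_apply] at this
  rw [add_comm, add_comm w]
  simpa using this

variable {e : Euc (m + 1) ≃ᵃⁱ[ℝ] Euc (m + 1)} {Φ : Euc m → ℝ}

theorem measurableSet_epigraph (hΦ : Continuous Φ) : MeasurableSet (epigraph e Φ) := by
  refine measurableSet_lt ?_ ?_
  · exact (hΦ.comp (continuous_hat.comp e.continuous)).measurable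
  · exact ((continuous_apply _).comp ((PiLp.continuous_ofLp 2 _).comp e.continuous)).measurable

/-- The height over the boundary point above `x'`, in the scale `κ⁻¹`, from which on the
translation by `κ⁻¹ σ` leads to a point of the epigraph. -/
noncomputable def height (e : Euc (m + 1) ≃ᵃⁱ[ℝ] Euc (m + 1)) (Φ : Euc m → ℝ) (κ : ℝ) (x' : Euc m)
    (σ : Euc (m + 1)) : ℝ :=
  κ * (Φ (x' + κ⁻¹ • hat (e.linearIsometryEquiv σ)) - Φ x') -
    e.linearIsometryEquiv σ (Fin.last m)

/-- The limit of `height` for `κ → ∞`. -/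
noncomputable def limitHeight (e : Euc (m + 1) ≃ᵃⁱ[ℝ] Euc (m + 1)) (Φ : Euc m → ℝ) (x' : Euc m)
    (σ : Euc (m + 1)) : ℝ :=
  surfaceDensity Φ x' * inner ℝ σ (-unitNormal e Φ x')

/-- The point at height `κ⁻¹ s` over the boundary point above `x'`. -/
noncomputable def layerPoint (e : Euc (m + 1) ≃ᵃⁱ[ℝ] Euc (m + 1)) (Φ : Euc m → ℝ) (κ : ℝ)
    (x' : Euc m) (s : ℝ) : Euc (m + 1) :=
  e.symm (withLast x' (Φ x' + κ⁻¹ * s))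

/-- Multiplying the defining inequality of the epigraph by `κ` isolates the rescaled height `s`. -/
theorem layerPoint_add_mem {κ : ℝ} (hκ : 0 < κ) (x' : Euc m) (s : ℝ) (σ : Euc (m + 1)) :
    layerPoint e Φ κ x' s + κ⁻¹ • σ ∈ epigraph e Φ ↔ height e Φ κ x' σ < s := by
  have h1 : e (layerPoint e Φ κ x' s + κ⁻¹ • σ) =
      withLast x' (Φ x' + κ⁻¹ * s) + κ⁻¹ • e.linearIsometryEquiv σ := by
    rw [layerPoint, e_symm_add, map_smul]
  simp only [epigraph, Set.mem_ofPred_eq, h1, hat_add, hat_smul, hat_withLast, PiLp.add_apply,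
    PiLp.smul_apply, withLast_last, height, smul_eq_mul]
  set A := Φ (x' + κ⁻¹ • hat (e.linearIsometryEquiv σ))
  set z := e.linearIsometryEquiv σ (Fin.last m)
  rw [← sub_pos, ← sub_pos (b := κ * (A - Φ x') - z)]
  have h2 : s - (κ * (A - Φ x') - z) = κ * (Φ x' + κ⁻¹ * s + κ⁻¹ * z - A) := by
    field_simp
    ring
  rw [h2, mul_pos_iff_of_pos_left hκ]

theorem layerPoint_mem {κ : ℝ} (hκ : 0 < κ) (x' : Euc m) (s : ℝ) :
    layerPoint e Φ κ x' s ∈ epigraph e Φ ↔ 0 < s := by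
  have h := layerPoint_add_mem (e := e) (Φ := Φ) hκ x' s 0
  have h0 : hat (0 : Euc (m + 1)) = 0 := rfl
  simpa [height, h0] using h

theorem surfaceDensity_pos (x' : Euc m) : 0 < surfaceDensity Φ x' := by
  unfold surfaceDensity
  positivity

/-- The surface density undoes the normalization of the unit normal, leaving a directional
derivative of `Φ` minus a vertical displacement. -/
theorem limitHeight_eq (x' : Euc m) (σ : Euc (m + 1)) :
    limitHeight e Φ x' σ = inner ℝ (gradient Φ x') (hat (e.linearIsometryEquiv σ)) -
      e.linearIsometryEquiv σ (Fin.last m) := by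
  have h := (surfaceDensity_pos (Φ := Φ) x').ne'
  rw [limitHeight, unitNormal, inner_neg_right,
    ← e.linearIsometryEquiv.inner_map_map σ, LinearIsometryEquiv.apply_symm_apply, inner_smul_right,
    inner_withLast, inner_neg_right, real_inner_comm]
  field_simp
  ring

theorem tendsto_height {x' : Euc m} (hx : DifferentiableAt ℝ Φ x') (σ : Euc (m + 1)) :
    Tendsto (fun κ => height e Φ κ x' σ) atTop (𝓝 (limitHeight e Φ x' σ)) := by
  rw [limitHeight_eq]
  refine Tendsto.sub_const ?_ _
  have h := hx.hasGradientAt.hasFDerivAt.lim_real (hat (e.linearIsometryEquiv σ))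
  simpa using h

/-- The difference quotient is controlled by the Lipschitz constant uniformly in `κ` and `x'`, which
supplies the domination. -/
theorem abs_height_le {K : NNReal} (hΦ : LipschitzWith K Φ) {κ : ℝ} (hκ : 0 < κ) (x' : Euc m)
    (σ : Euc (m + 1)) : |height e Φ κ x' σ| ≤ (K + 1) * ‖σ‖ := by
  have h1 := hΦ.dist_le_mul (x' + κ⁻¹ • hat (e.linearIsometryEquiv σ)) x'
  rw [dist_self_add_left, Real.dist_eq, norm_smul, Real.norm_of_nonneg (by positivity)] at h1
  have h2 := norm_hat_le (e.linearIsometryEquiv σ)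
  have h3 := abs_last_le (e.linearIsometryEquiv σ)
  rw [LinearIsometryEquiv.norm_map] at h2 h3
  refine (abs_sub _ _).trans ?_
  rw [abs_mul, abs_of_pos hκ]
  have h4 : κ * |Φ (x' + κ⁻¹ • hat (e.linearIsometryEquiv σ)) - Φ x'| ≤ K * ‖σ‖ := by
    calc _ ≤ κ * (K * (κ⁻¹ * ‖hat (e.linearIsometryEquiv σ)‖)) := by gcongr
      _ = K * ‖hat (e.linearIsometryEquiv σ)‖ := by field_simp
      _ ≤ K * ‖σ‖ := by gcongr
  linarith

theorem tendsto_layerPoint (x' : Euc m) (s : ℝ) :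
    Tendsto (fun κ => layerPoint e Φ κ x' s) atTop (𝓝 (bdryPoint e Φ x')) := by
  have h1 : Tendsto (fun κ : ℝ => Φ x' + κ⁻¹ * s) atTop (𝓝 (Φ x')) := by
    simpa using (tendsto_inv_atTop_zero.mul_const s).const_add (Φ x')
  exact (e.symm.continuous.tendsto _).comp
    ((continuous_withLast.tendsto (x', Φ x')).comp (tendsto_const_nhds.prodMk_nhds h1))

theorem continuous_layerPoint (hΦ : Continuous Φ) (κ : ℝ) :
    Continuous fun p : Euc m × ℝ => layerPoint e Φ κ p.1 p.2 := by
  have h : Continuous fun p : Euc m × ℝ => (p.1, Φ p.1 + κ⁻¹ * p.2) := by fun_prop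
  exact e.symm.continuous.comp (continuous_withLast.comp h)

theorem measurable_gradient : Measurable (gradient Φ) := by
  unfold gradient
  exact (LinearIsometryEquiv.continuous _).measurable.comp (measurable_fderiv ℝ Φ)

/-- The change of variables `(x', s) ↦ layerPoint x' s`. -/
theorem integral_layerPoint (hΦ : Continuous Φ) {κ : ℝ} (hκ : 0 < κ) {f : Euc (m + 1) → ℂ}
    (hf : Integrable f volume) :
    ∫ x, f x = (κ : ℂ)⁻¹ * ∫ x' : Euc m, ∫ s, f (layerPoint e Φ κ x' s) := by
  have h1 : MeasurePreserving (fun p : Euc m × ℝ => (p.1, Φ p.1 + p.2))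
      (volume.prod volume) (volume.prod volume) := by
    refine (MeasurePreserving.id volume).skew_product (g := fun x' t => Φ x' + t) ?_ ?_
    · fun_prop
    · exact .of_forall fun x' => (measurePreserving_add_left volume (Φ x')).map_eq
  have h2 := (measurePreserving_affineIsometry e.symm).comp (measurePreserving_withLast.comp h1)
  have h3 := h2.integrable_comp_of_integrable hf
  rw [← h2.map_eq, integral_map h2.measurable.aemeasurable (by rw [h2.map_eq]; exact hf.1)]
  rw [← integral_const_mul]
  refine (integral_prod _ h3).trans ?_
  refine integral_congr_ae (.of_forall fun x' => ?_)
  have h4 := Measure.integral_comp_mul_left (fun t => f (e.symm (withLast x' (Φ x' + t)))) κ⁻¹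
  simp only [layerPoint, h4, inv_inv, abs_of_pos hκ, Complex.real_smul, Function.comp_apply]
  rw [inv_mul_cancel_left₀ (by exact_mod_cast hκ.ne')]

end coordinates

/-! ### The boundary layer -/

theorem le_runMax_iff {n : ℕ} (w : Fin n → ℝ) {s : ℝ} (hs : 0 < s) (m : ℕ) :
    s ≤ runMax w m ↔ ∃ j < m, s ≤ psum w (j + 1) := by
  induction m with
  | zero => simpa [runMax] using hs
  | succ m ih =>
    rw [runMax, le_max_iff, ih]
    constructor
    · rintro (⟨j, hj, h⟩ | h)
      · exact ⟨j, by omega, h⟩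
      · exact ⟨m, by omega, h⟩
    · rintro ⟨j, hj, h⟩
      rcases Nat.lt_succ_iff_lt_or_eq.1 hj with h1 | rfl
      · exact Or.inl ⟨j, h1, h⟩
      · exact Or.inr h

section layer

variable {d n : ℕ}

open Classical in
/-- The value `-φ x` where `0 < s` and `s` is below one of the thresholds `T j`, and `0`
elsewhere. -/
noncomputable def layer (φ : Euc d → ℂ) (x : Euc d) (T : Fin n → ℝ) (s : ℝ) : ℂ :=
  if 0 < s ∧ ∃ j, s ≤ T j then -φ x else 0

/-- The layer lives on `0 < s ≤ A`, where `1 + s² ≤ (1 + A)²`. Trading the support for the weight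
`(1 + s²)⁻¹` separates `s` from the increments. -/
theorem norm_layer_le (φ : Euc d → ℂ) (x : Euc d) {T : Fin n → ℝ} (s : ℝ) {A : ℝ} (hA : 0 ≤ A)
    (hT : ∀ j, |T j| ≤ A) : ‖layer φ x T s‖ ≤ ‖φ x‖ * ((1 + A) ^ 2 * (1 + s ^ 2)⁻¹) := by
  unfold layer
  split_ifs with h
  · obtain ⟨h0, j, hj⟩ := h
    have h1 : s ≤ A := hj.trans ((le_abs_self _).trans (hT j))
    rw [norm_neg]
    refine le_mul_of_one_le_right (norm_nonneg _) ?_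
    rw [← div_eq_mul_inv, one_le_div (by positivity)]
    nlinarith
  · rw [norm_zero]
    positivity

theorem measurable_layer {Y : Type*} [MeasurableSpace Y] {φ : Euc d → ℂ} (hφ : Measurable φ)
    {x : Y → Euc d} (hx : Measurable x) {T : Y → Fin n → ℝ} (hT : ∀ j, Measurable fun y => T y j)
    {s : Y → ℝ} (hs : Measurable s) : Measurable fun y => layer φ (x y) (T y) (s y) := by
  unfold layer
  refine Measurable.ite ?_ (hφ.comp hx).neg measurable_const
  refine (measurableSet_lt measurable_const hs).inter ?_
  have : {y | ∃ j, s y ≤ T y j} = ⋃ j, {y | s y ≤ T y j} := by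
    ext
    simp
  change MeasurableSet {y | ∃ j, s y ≤ T y j}
  rw [this]
  exact MeasurableSet.iUnion fun j => measurableSet_le hs (hT j)

theorem integral_layer (φ : Euc d → ℂ) (x : Euc d) {ρ : ℝ} (hρ : 0 < ρ) (w : Fin n → ℝ) :
    ∫ s, layer φ x (fun j : Fin n => ρ * psum w (j + 1)) s = -(φ x * ρ * (runMax w n : ℝ)) := by
  have h1 : layer φ x (fun j : Fin n => ρ * psum w (j + 1)) =
      (Set.Ioc 0 (ρ * runMax w n)).indicator fun _ => -φ x := by
    ext s
    rw [layer, Set.indicator_apply]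
    congr 1
    rw [Set.mem_Ioc, eq_iff_iff, and_congr_right_iff]
    intro hs
    rw [← div_le_iff₀' hρ, le_runMax_iff w (by positivity)]
    simp only [div_le_iff₀' hρ]
    constructor
    · rintro ⟨j, hj⟩
      exact ⟨j, j.2, hj⟩
    · rintro ⟨j, hj, h⟩
      exact ⟨⟨j, hj⟩, h⟩
  rw [h1, integral_indicator measurableSet_Ioc, setIntegral_const, measureReal_def,
    Real.volume_Ioc, sub_zero, ENNReal.toReal_ofReal (mul_nonneg hρ.le (runMax_nonneg _ _)),
    Complex.real_smul]
  push_cast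
  ring

/-- Away from the limiting thresholds all comparisons with `s` are eventually constant, so only the
argument of `φ` still varies. -/
theorem tendsto_layer {φ : Euc d → ℂ} (hφ : Continuous φ) {x : ℝ → Euc d} {x₀ : Euc d}
    (hx : Tendsto x atTop (𝓝 x₀)) {T : ℝ → Fin n → ℝ} {T₀ : Fin n → ℝ}
    (hT : ∀ j, Tendsto (fun κ => T κ j) atTop (𝓝 (T₀ j))) {s : ℝ} (hs : ∀ j, s ≠ T₀ j) :
    Tendsto (fun κ => layer φ (x κ) (T κ) s) atTop (𝓝 (layer φ x₀ T₀ s)) := by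
  have h1 : ∀ᶠ κ in atTop, ∀ j, s ≤ T κ j ↔ s ≤ T₀ j := by
    rw [eventually_all]
    intro j
    rcases lt_or_gt_of_ne (hs j) with h | h
    · filter_upwards [(hT j).eventually (lt_mem_nhds h)] with κ hκ
      exact iff_of_true hκ.le h.le
    · filter_upwards [(hT j).eventually (gt_mem_nhds h)] with κ hκ
      exact iff_of_false hκ.not_ge h.not_ge
  by_cases h : 0 < s ∧ ∃ j, s ≤ T₀ j
  · rw [layer, if_pos h]
    refine ((hφ.tendsto _).comp hx).neg.congr' ?_
    filter_upwards [h1] with κ hκ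
    rw [layer, if_pos (by simpa only [hκ] using h)]
    rfl
  · rw [layer, if_neg h]
    refine tendsto_const_nhds.congr' ?_
    filter_upwards [h1] with κ hκ
    rw [layer, if_neg (by simpa only [hκ] using h)]

end layer

/-! ### Domination and convergence of the boundary layer of an epigraph -/

section epigraph

variable {m n : ℕ} {e : Euc (m + 1) ≃ᵃⁱ[ℝ] Euc (m + 1)} {Φ : Euc m → ℝ} {φ : Euc (m + 1) → ℂ}

/-- The boundary layer of the epigraph of `Φ` at the scale `κ⁻¹`. -/
noncomputable def epiLayer (φ : Euc (m + 1) → ℂ) (e : Euc (m + 1) ≃ᵃⁱ[ℝ] Euc (m + 1))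
    (Φ : Euc m → ℝ) (κ : ℝ) (y : ((Fin n → Euc (m + 1)) × Euc m) × ℝ) : ℂ :=
  layer φ (layerPoint e Φ κ y.1.2 y.2)
    (fun j : Fin n => height e Φ κ y.1.2 (psum y.1.1 (j + 1))) y.2

/-- The boundary layer of the tangential half-spaces. -/
noncomputable def limitLayer (φ : Euc (m + 1) → ℂ) (e : Euc (m + 1) ≃ᵃⁱ[ℝ] Euc (m + 1))
    (Φ : Euc m → ℝ) (y : ((Fin n → Euc (m + 1)) × Euc m) × ℝ) : ℂ :=
  layer φ (bdryPoint e Φ y.1.2)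
    (fun j : Fin n => limitHeight e Φ y.1.2 (psum y.1.1 (j + 1))) y.2

theorem continuous_last : Continuous fun w : Euc (m + 1) => w (Fin.last m) := by
  fun_prop

/-- For `s > 0` the bracket is `-1` as soon as one vertex of the walk has left the epigraph, that
is, as soon as `s` is at most one of the thresholds. -/
theorem chi_prod_eq_layer {κ : ℝ} (hκ : 0 < κ) (v : Fin n → Euc (m + 1)) (x' : Euc m) (s : ℝ) :
    φ (layerPoint e Φ κ x' s) * chi (epigraph e Φ) (layerPoint e Φ κ x' s) *
      (∏ j : Fin n, chi (epigraph e Φ) (layerPoint e Φ κ x' s + κ⁻¹ • psum v (j + 1)) - 1) =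
      epiLayer φ e Φ κ ((v, x'), s) := by
  classical
  simp only [chi, Set.indicator_apply, layerPoint_add_mem hκ, layerPoint_mem hκ, Pi.one_apply,
    epiLayer, layer]
  by_cases hs : 0 < s
  · by_cases h : ∃ j : Fin n, s ≤ height e Φ κ x' (psum v (j + 1))
    · obtain ⟨j, hj⟩ := h
      rw [if_pos hs, if_pos ⟨hs, j, hj⟩, Finset.prod_eq_zero (Finset.mem_univ j)
        (if_neg hj.not_gt)]
      ring
    · rw [if_neg fun h1 : 0 < s ∧ ∃ j : Fin n, _ => h h1.2]
      push Not at h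
      rw [Finset.prod_eq_one fun j _ => if_pos (h j)]
      ring
  · rw [if_neg hs, if_neg fun h => hs h.1]
    ring

theorem abs_limitHeight_le {K : NNReal} (hΦ : LipschitzWith K Φ) (x' : Euc m)
    (σ : Euc (m + 1)) : |limitHeight e Φ x' σ| ≤ (K + 1) * ‖σ‖ := by
  have h1 : ‖gradient Φ x'‖ ≤ K := by
    rw [gradient, LinearIsometryEquiv.norm_map]
    exact norm_fderiv_le_of_lipschitz ℝ hΦ
  have h2 := norm_hat_le (e.linearIsometryEquiv σ)
  have h3 := abs_last_le (e.linearIsometryEquiv σ)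
  rw [LinearIsometryEquiv.norm_map] at h2 h3
  rw [limitHeight_eq]
  have h4 := abs_real_inner_le_norm (gradient Φ x') (hat (e.linearIsometryEquiv σ))
  have h5 : ‖gradient Φ x'‖ * ‖hat (e.linearIsometryEquiv σ)‖ ≤ K * ‖σ‖ := by gcongr
  linarith [abs_sub (inner ℝ (gradient Φ x') (hat (e.linearIsometryEquiv σ)))
    (e.linearIsometryEquiv σ (Fin.last m))]

theorem measurable_epiLayer (hΦ : Continuous Φ) (hφ : Continuous φ) (κ : ℝ) :
    Measurable (epiLayer φ e Φ κ : ((Fin n → Euc (m + 1)) × Euc m) × ℝ → ℂ) := by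
  refine measurable_layer hφ.measurable ?_ (fun j => ?_) measurable_snd
  · exact ((continuous_layerPoint hΦ κ).comp
      ((continuous_snd.comp continuous_fst).prodMk continuous_snd)).measurable
  · have h1 : Continuous fun y : ((Fin n → Euc (m + 1)) × Euc m) × ℝ =>
        e.linearIsometryEquiv (psum y.1.1 (j + 1)) :=
      e.linearIsometryEquiv.continuous.comp
        ((continuous_psum _).comp (continuous_fst.comp continuous_fst))
    have h2 := continuous_hat.comp h1
    have h3 := continuous_last.comp h1
    have h4 : Continuous fun y : ((Fin n → Euc (m + 1)) × Euc m) × ℝ => y.1.2 := by fun_prop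
    unfold height
    exact ((continuous_const.mul ((hΦ.comp (h4.add (h2.const_smul κ⁻¹))).sub
      (hΦ.comp h4))).sub h3).measurable

theorem measurable_limitHeight :
    Measurable fun p : Euc m × Euc (m + 1) => limitHeight e Φ p.1 p.2 := by
  simp only [limitHeight_eq]
  have h1 : Continuous fun p : Euc m × Euc (m + 1) => e.linearIsometryEquiv p.2 :=
    e.linearIsometryEquiv.continuous.comp continuous_snd
  have h2 := continuous_hat.comp h1
  have h3 := continuous_last.comp h1
  exact ((measurable_gradient.comp measurable_fst).inner h2.measurable).sub h3.measurable

theorem measurable_limitHeight_psum (j : ℕ) :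
    Measurable fun y : ((Fin n → Euc (m + 1)) × Euc m) × ℝ =>
      limitHeight e Φ y.1.2 (psum y.1.1 j) := by
  have h1 : Measurable fun y : ((Fin n → Euc (m + 1)) × Euc m) × ℝ =>
      (y.1.2, psum y.1.1 j) :=
    (measurable_snd.comp measurable_fst).prodMk
      ((measurable_psum j).comp (measurable_fst.comp measurable_fst))
  have h2 : Measurable fun p : Euc m × Euc (m + 1) => limitHeight e Φ p.1 p.2 :=
    measurable_limitHeight
  generalize limitHeight e Φ = F at h2 ⊢
  exact h2.comp h1

theorem continuous_bdryPoint (hΦ : Continuous Φ) : Continuous (bdryPoint e Φ) :=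
  e.symm.continuous.comp (continuous_withLast.comp (continuous_id.prodMk hΦ))

theorem measurable_limitLayer (hΦ : Continuous Φ) (hφ : Continuous φ) :
    Measurable (limitLayer φ e Φ : ((Fin n → Euc (m + 1)) × Euc m) × ℝ → ℂ) :=
  measurable_layer hφ.measurable ((continuous_bdryPoint hΦ).measurable.comp
    (measurable_snd.comp measurable_fst)) (fun _ => measurable_limitHeight_psum _) measurable_snd

/-- The horizontal coordinates of the support of `φ` stay in a ball, whatever the height `t`; the
bound is thus integrable in `x'` and serves all `κ` at once. -/
theorem exists_integrable_bound (hφ : Continuous φ) (hφc : HasCompactSupport φ) :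
    ∃ h : Euc m → ℝ, Integrable h volume ∧ (∀ x', 0 ≤ h x') ∧
      ∀ x' t, ‖φ (e.symm (withLast x' t))‖ ≤ h x' := by
  obtain ⟨B, hB⟩ := hφc.exists_bound_of_continuous hφ
  have hB0 : 0 ≤ B := (norm_nonneg _).trans (hB 0)
  obtain ⟨r, hr⟩ := hφc.isCompact.isBounded.exists_norm_le
  refine ⟨(Metric.closedBall 0 (r + ‖e 0‖)).indicator fun _ => B, ?_,
    Set.indicator_nonneg fun _ _ => hB0, fun x' t => ?_⟩
  · exact (integrable_indicator_iff Metric.isClosed_closedBall.measurableSet).2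
      (integrableOn_const measure_closedBall_lt_top.ne)
  · by_cases h : φ (e.symm (withLast x' t)) = 0
    · rw [h, norm_zero]
      exact Set.indicator_nonneg (fun _ _ => hB0) _
    · rw [Set.indicator_of_mem]
      · exact hB _
      · have h1 := hr _ (subset_tsupport _ h)
        have h2 := norm_hat_le (withLast x' t)
        rw [hat_withLast] at h2
        have h3 := dist_triangle (withLast x' t) (e 0) 0
        have h4 : dist (withLast x' t) (e 0) = ‖e.symm (withLast x' t)‖ := by
          have := e.dist_map (e.symm (withLast x' t)) 0
          rwa [AffineIsometryEquiv.apply_symm_apply, dist_zero_right] at this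
        rw [h4, dist_zero_right, dist_zero_right] at h3
        rw [mem_closedBall_zero_iff]
        linarith

theorem norm_layer_thresholds_le {K : NNReal} {x : Euc (m + 1)} {T : Euc (m + 1) → ℝ}
    (hT : ∀ σ, |T σ| ≤ (K + 1) * ‖σ‖) (v : Fin n → Euc (m + 1)) (s : ℝ) :
    ‖layer φ x (fun j : Fin n => T (psum v (j + 1))) s‖ ≤
      (K + 1) ^ 2 * (1 + ∑ i, ‖v i‖) ^ 2 * ‖φ x‖ * (1 + s ^ 2)⁻¹ := by
  have h0 : 0 ≤ ∑ i, ‖v i‖ := Finset.sum_nonneg fun i _ => norm_nonneg _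
  refine (norm_layer_le φ x s (A := (K + 1) * ∑ i, ‖v i‖) (by positivity) fun j => ?_).trans ?_
  · refine (hT _).trans ?_
    gcongr
    exact norm_psum_le _ _
  · have h1 : 1 + (K + 1) * ∑ i, ‖v i‖ ≤ ((K : ℝ) + 1) * (1 + ∑ i, ‖v i‖) := by
      linarith [K.coe_nonneg]
    calc _ ≤ ‖φ x‖ * ((((K : ℝ) + 1) * (1 + ∑ i, ‖v i‖)) ^ 2 * (1 + s ^ 2)⁻¹) := by gcongr
      _ = _ := by ring

/-- One integrable majorant, a product of functions of `v`, `x'` and `s`, serves every scale and the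
limit. Two powers of decay pay for the squared threshold bound. -/
theorem exists_layer_bound {K : NNReal} (hΦ : LipschitzWith K Φ) (hφ : Continuous φ)
    (hφc : HasCompactSupport φ) {N : ℕ} (hN : 2 + (m + 1) < N) {c : ℝ} (hc : 0 ≤ c) :
    ∃ D : ((Fin n → Euc (m + 1)) × Euc m) × ℝ → ℝ, Integrable D (volume.prod volume) ∧
      ∀ y, (∀ κ : ℝ, 0 < κ →
          c * (∏ i, decay N (y.1.1 i)) * ‖epiLayer φ e Φ κ y‖ ≤ D y) ∧
        c * (∏ i, decay N (y.1.1 i)) * ‖limitLayer φ e Φ y‖ ≤ D y := by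
  obtain ⟨h, hi, h0, hh⟩ := exists_integrable_bound (e := e) hφ hφc
  obtain ⟨N, rfl⟩ : ∃ N', N = 2 + N' := ⟨N - 2, by omega⟩
  have h1 := integrable_prod_decay (d := m + 1) (n := n) (N := N) (by omega)
  refine ⟨fun y => c * (K + 1) ^ 2 * ((∏ i, decay N (y.1.1 i)) * h y.1.2 * (1 + y.2 ^ 2)⁻¹),
    ((h1.mul_prod hi).mul_prod integrable_inv_one_add_sq).const_mul _, fun y => ?_⟩
  have key : ∀ (x : Euc (m + 1)) (t : ℝ) (T : Euc (m + 1) → ℝ), x = e.symm (withLast y.1.2 t) →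
      (∀ σ, |T σ| ≤ (K + 1) * ‖σ‖) →
      c * (∏ i, decay (2 + N) (y.1.1 i)) *
          ‖layer φ x (fun j : Fin n => T (psum y.1.1 (j + 1))) y.2‖ ≤
        c * (K + 1) ^ 2 * ((∏ i, decay N (y.1.1 i)) * h y.1.2 * (1 + y.2 ^ 2)⁻¹) := by
    intro x t T hx hT
    have h2 := hh y.1.2 t
    rw [← hx] at h2
    have h3 := norm_layer_thresholds_le (φ := φ) (x := x) hT y.1.1 y.2
    have h4 : 0 ≤ ∏ i, decay (2 + N) (y.1.1 i) :=
      Finset.prod_nonneg fun i _ => (decay_pos _ _).le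
    have h5 := pow_mul_prod_decay_le 2 N y.1.1
    calc _ ≤ c * (∏ i, decay (2 + N) (y.1.1 i)) *
          ((K + 1) ^ 2 * (1 + ∑ i, ‖y.1.1 i‖) ^ 2 * ‖φ x‖ * (1 + y.2 ^ 2)⁻¹) := by gcongr
      _ = c * (K + 1) ^ 2 * (((1 + ∑ i, ‖y.1.1 i‖) ^ 2 * ∏ i, decay (2 + N) (y.1.1 i)) *
          ‖φ x‖ * (1 + y.2 ^ 2)⁻¹) := by ring
      _ ≤ _ := by
        have := h0 y.1.2
        have : 0 ≤ ∏ i, decay N (y.1.1 i) := Finset.prod_nonneg fun i _ => (decay_pos _ _).le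
        gcongr
  exact ⟨fun κ hκ => key _ _ _ rfl (abs_height_le hΦ hκ y.1.2),
    key _ _ _ rfl (abs_limitHeight_le hΦ y.1.2)⟩

/-- Two null sets are excluded: points where `Φ` is not differentiable (Rademacher), and the graphs
on which `s` equals a limiting threshold. -/
theorem ae_tendsto_epiLayer {K : NNReal} (hΦ : LipschitzWith K Φ) (hφ : Continuous φ) :
    ∀ᵐ y : ((Fin n → Euc (m + 1)) × Euc m) × ℝ ∂(volume.prod volume),
      Tendsto (fun κ => epiLayer φ e Φ κ y) atTop (𝓝 (limitLayer φ e Φ y)) := by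
  have h1 : ∀ᵐ y : ((Fin n → Euc (m + 1)) × Euc m) × ℝ ∂(volume.prod volume),
      DifferentiableAt ℝ Φ y.1.2 :=
    Measure.quasiMeasurePreserving_fst.ae
      (Measure.quasiMeasurePreserving_snd.ae hΦ.ae_differentiableAt)
  have h2 : ∀ᵐ y : ((Fin n → Euc (m + 1)) × Euc m) × ℝ ∂(volume.prod volume),
      ∀ j : Fin n, y.2 ≠ limitHeight e Φ y.1.2 (psum y.1.1 (j + 1)) := by
    rw [ae_all_iff]
    intro j
    have h3 : MeasurableSet {y : ((Fin n → Euc (m + 1)) × Euc m) × ℝ |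
        y.2 ≠ limitHeight e Φ y.1.2 (psum y.1.1 (j + 1))} :=
      (measurableSet_eq_fun measurable_snd (measurable_limitHeight_psum _)).compl
    rw [Measure.ae_prod_iff_ae_ae h3]
    exact .of_forall fun z =>
      Measure.ae_ne volume (limitHeight e Φ z.2 (psum z.1 (j + 1)))
  filter_upwards [h1, h2] with y hy1 hy2
  exact tendsto_layer hφ (tendsto_layerPoint _ _) (fun j => tendsto_height hy1 _) hy2

theorem exists_layer_sub_bound {L : NNReal} (hΦ : LipschitzWith L Φ) (hφ : Continuous φ)
    (hφc : HasCompactSupport φ) {N : ℕ} (hN : 2 + (m + 1) < N) {c : ℝ} (hc : 0 ≤ c) :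
    ∃ D : ((Fin n → Euc (m + 1)) × Euc m) × ℝ → ℝ, Integrable D (volume.prod volume) ∧
      (∀ κ, Measurable fun y : ((Fin n → Euc (m + 1)) × Euc m) × ℝ =>
        c * (∏ i, decay N (y.1.1 i)) * ‖epiLayer φ e Φ κ y - limitLayer φ e Φ y‖) ∧
      ∀ κ : ℝ, 0 < κ → ∀ y,
        ‖c * (∏ i, decay N (y.1.1 i)) * ‖epiLayer φ e Φ κ y - limitLayer φ e Φ y‖‖ ≤ D y := by
  obtain ⟨D, hD, h⟩ := exists_layer_bound (n := n) (e := e) hΦ hφ hφc hN hc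
  have hm : Measurable fun y : ((Fin n → Euc (m + 1)) × Euc m) × ℝ =>
      c * ∏ i, decay N (y.1.1 i) := by
    have h1 : Continuous fun v : Fin n → Euc (m + 1) => ∏ i, decay N (v i) :=
      continuous_finsetProd _ fun i _ => (continuous_decay N).comp (continuous_apply i)
    exact (h1.measurable.comp (measurable_fst.comp measurable_fst)).const_mul c
  refine ⟨fun y => D y + D y, hD.add hD, fun κ => hm.mul ((measurable_epiLayer hΦ.continuous hφ κ).sub
    (measurable_limitLayer hΦ.continuous hφ)).norm, fun κ hκ y => ?_⟩
  have h0 : 0 ≤ c * ∏ i, decay N (y.1.1 i) :=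
    mul_nonneg hc (Finset.prod_nonneg fun i _ => (decay_pos _ _).le)
  rw [Real.norm_of_nonneg (mul_nonneg h0 (norm_nonneg _))]
  refine (mul_le_mul_of_nonneg_left (norm_sub_le _ _) h0).trans ?_
  rw [mul_add]
  exact add_le_add ((h y).1 κ hκ) (h y).2

/-- The weight is the common majorant of all cyclic products with decay constant determined by `c`.
No symbol occurs, so this single limit controls the whole class. -/
theorem tendsto_integral_layer_sub {L : NNReal} (hΦ : LipschitzWith L Φ) (hφ : Continuous φ)
    (hφc : HasCompactSupport φ) {N : ℕ} (hN : 2 + (m + 1) < N) {c : ℝ} (hc : 0 ≤ c) :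
    Tendsto (fun κ => ∫ y : ((Fin n → Euc (m + 1)) × Euc m) × ℝ,
      c * (∏ i, decay N (y.1.1 i)) * ‖epiLayer φ e Φ κ y - limitLayer φ e Φ y‖
        ∂(volume.prod volume)) atTop (𝓝 0) := by
  obtain ⟨D, hD, hm, h⟩ := exists_layer_sub_bound (n := n) (e := e) hΦ hφ hφc hN hc
  have h2 := tendsto_integral_filter_of_dominated_convergence (l := atTop)
    (μ := (volume : Measure ((Fin n → Euc (m + 1)) × Euc m)).prod (volume : Measure ℝ))
    (F := fun κ y => c * (∏ i, decay N (y.1.1 i)) * ‖epiLayer φ e Φ κ y - limitLayer φ e Φ y‖)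
    (f := fun _ => 0) D (.of_forall fun κ => (hm κ).aestronglyMeasurable) ?_ hD ?_
  · simpa using h2
  · filter_upwards [eventually_gt_atTop 0] with κ hκ using .of_forall (h κ hκ)
  · filter_upwards [ae_tendsto_epiLayer (e := e) hΦ hφ] with y hy
    have h3 := ((hy.sub_const (limitLayer φ e Φ y)).norm).const_mul
      (c * ∏ i, decay N (y.1.1 i))
    simpa using h3

end epigraph

/-! ### The asymptotic formula -/

section asymptotics

variable {m n : ℕ} {e : Euc (m + 1) ≃ᵃⁱ[ℝ] Euc (m + 1)} {Φ : Euc m → ℝ} {φ : Euc (m + 1) → ℂ}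
  {K : Euc (m + 1) → ℂ} {N : ℕ} {c : ℝ}

theorem integrable_cycProd_layer {L : NNReal} (hΦ : LipschitzWith L Φ) (hφ : Continuous φ)
    (hφc : HasCompactSupport φ) (hN : 2 + (m + 1) < N) (hKc : Continuous K)
    (hK : ∀ z, ‖K z‖ ≤ c * decay N z) :
    (∀ κ : ℝ, 0 < κ → Integrable (fun y : ((Fin n → Euc (m + 1)) × Euc m) × ℝ =>
      cycProd K y.1.1 * epiLayer φ e Φ κ y) (volume.prod volume)) ∧
    Integrable (fun y : ((Fin n → Euc (m + 1)) × Euc m) × ℝ =>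
      cycProd K y.1.1 * limitLayer φ e Φ y) (volume.prod volume) := by
  have hc : 0 ≤ c := nonneg_of_mul_nonneg_left ((norm_nonneg _).trans (hK 0)) (decay_pos N 0)
  obtain ⟨D, hD, h⟩ := exists_layer_bound (n := n) (e := e) hΦ hφ hφc hN (pow_nonneg hc (n + 1))
  have hm : Measurable fun y : ((Fin n → Euc (m + 1)) × Euc m) × ℝ => cycProd K y.1.1 :=
    (continuous_cycProd hKc).measurable.comp (measurable_fst.comp measurable_fst)
  constructor
  · intro κ hκ
    refine hD.mono' (hm.mul (measurable_epiLayer hΦ.continuous hφ κ)).aestronglyMeasurable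
      (.of_forall fun y => ?_)
    rw [norm_mul]
    exact (mul_le_mul_of_nonneg_right (norm_cycProd_le hK _) (norm_nonneg _)).trans
      ((h y).1 κ hκ)
  · refine hD.mono' (hm.mul (measurable_limitLayer hΦ.continuous hφ)).aestronglyMeasurable
      (.of_forall fun y => ?_)
    rw [norm_mul]
    exact (mul_le_mul_of_nonneg_right (norm_cycProd_le hK _) (norm_nonneg _)).trans (h y).2

theorem integral_cycProd_eq_integral_epiLayer {L : NNReal} (hΦ : LipschitzWith L Φ)
    (hφ : Continuous φ) (hφc : HasCompactSupport φ) (hN : 2 + (m + 1) < N) (hKc : Continuous K)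
    (hK : ∀ z, ‖K z‖ ≤ c * decay N z) {κ : ℝ} (hκ : 0 < κ) :
    ∫ v : Fin n → Euc (m + 1), cycProd K v * ∫ x, φ x * chi (epigraph e Φ) x *
        (∏ j : Fin n, chi (epigraph e Φ) (x + κ⁻¹ • psum v (j + 1)) - 1) =
      (κ : ℂ)⁻¹ * ∫ y : ((Fin n → Euc (m + 1)) × Euc m) × ℝ,
        cycProd K y.1.1 * epiLayer φ e Φ κ y ∂(volume.prod volume) := by
  have hi := (integrable_cycProd_layer (n := n) (e := e) hΦ hφ hφc hN hKc hK).1 κ hκ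
  have hS := measurableSet_epigraph (e := e) hΦ.continuous
  rw [integral_prod _ hi]
  have h1 := integral_prod _ hi.integral_prod_left
  refine Eq.trans ?_ (congrArg _ h1.symm)
  rw [← integral_const_mul]
  refine integral_congr_ae (.of_forall fun v => ?_)
  have h2 : Integrable (fun x => φ x * (chi (epigraph e Φ) x *
      (∏ j : Fin n, chi (epigraph e Φ) (x + κ⁻¹ • psum v (j + 1)) - 1))) volume := by
    refine (hφ.integrable_of_hasCompactSupport hφc).mul_bdd (c := 1 + 1) ?_ ?_
    · have h3 : Measurable fun x => ∏ j : Fin n,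
          chi (epigraph e Φ) (x + κ⁻¹ • psum v (j + 1)) :=
        Finset.measurable_prod _ fun j _ =>
          (measurable_chi hS).comp (measurable_id.add_const _)
      exact ((measurable_chi hS).mul (h3.sub_const 1)).aestronglyMeasurable
    · refine .of_forall fun x => ?_
      rw [norm_mul]
      refine (mul_le_of_le_one_left (norm_nonneg _) (norm_chi_le _ _)).trans ?_
      refine (norm_sub_le _ _).trans (add_le_add ?_ norm_one.le)
      exact norm_prod_le_one _ fun j => norm_chi_le _ _
  simp only [← mul_assoc] at h2
  simp only
  rw [integral_layerPoint (e := e) hΦ.continuous hκ h2, mul_left_comm]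
  simp only [chi_prod_eq_layer hκ, integral_const_mul]

/-- Integrating first over `s` gives `-φ` times the surface density times the running maximum.
Integrating next over `v` turns the maximum into its mean, which is minus the coefficient. Absolute
convergence of the boundary integral comes from the same Fubini argument. -/
theorem integral_limitLayer {L : NNReal} (hΦ : LipschitzWith L Φ) (hφ : Continuous φ)
    (hφc : HasCompactSupport φ) {a : Euc (m + 1) → ℂ} (hac : Continuous a)
    (hai : Integrable a volume) {B : ℝ} (hB : ∀ x, ‖a x‖ ≤ B) (hN : 2 + (m + 1) < N)
    (hc : ∀ z, ‖𝓕⁻ a z‖ ≤ c * decay N z) :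
    Integrable (bdryIntegrand a φ e Φ (gPow (n + 2))) volume ∧
    ∫ y : ((Fin (n + 1) → Euc (m + 1)) × Euc m) × ℝ,
        cycProd (𝓕⁻ a) y.1.1 * limitLayer φ e Φ y ∂(volume.prod volume) =
      ∫ x', bdryIntegrand a φ e Φ (gPow (n + 2)) x' := by
  have hKc := continuous_fourierInv hai
  have hi := (integrable_cycProd_layer (n := n + 1) (e := e) hΦ hφ hφc hN hKc hc).2
  have h1 : ∀ x', ∫ v : Fin (n + 1) → Euc (m + 1), ∫ s,
      cycProd (𝓕⁻ a) v * limitLayer φ e Φ ((v, x'), s) =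
        bdryIntegrand a φ e Φ (gPow (n + 2)) x' := fun x' => by
    have h2 : ∀ v : Fin (n + 1) → Euc (m + 1), ∫ s,
        cycProd (𝓕⁻ a) v * limitLayer φ e Φ ((v, x'), s) =
          -(φ (bdryPoint e Φ x') * surfaceDensity Φ x') * (cycProd (𝓕⁻ a) v *
            (runMax (dirCoord (-unitNormal e Φ x') v) (n + 1) : ℝ)) := fun v => by
      rw [integral_const_mul]
      simp only [limitLayer, limitHeight, ← psum_dirCoord]
      rw [integral_layer _ _ (surfaceDensity_pos x')]
      ring
    simp only [h2, integral_const_mul]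
    -- A walk leaves the domain along `-n_x`, since `unitNormal` points into the epigraph; the mean
    -- maximum is even in the direction.
    have h3 := cycMean_runMax_neg (n := n) (by omega : 1 + (m + 1) < N) hKc hc (unitNormal e Φ x')
    rw [bdryIntegrand, coeffA_eq hac hai hB hN hc]
    rw [← h3, cycMean]
    ring
  have h4 := hi.integral_prod_left
  constructor
  · refine h4.integral_prod_right.congr (.of_forall fun x' => ?_)
    exact h1 x'
  · rw [integral_prod _ hi]
    refine (integral_prod_symm _ h4).trans ?_
    exact integral_congr_ae (.of_forall h1)

/-- The remainder in the asymptotic formula for the trace. -/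
theorem opTrace_sub_coeffB {L : NNReal} (hΦ : LipschitzWith L Φ) (hφ : Continuous φ)
    (hφc : HasCompactSupport φ) {β : ℝ} (hβ : ((m + 1 : ℕ) : ℝ) < β) {C : ℕ → ℝ}
    {a : Euc (m + 1) → ℂ} (ha : a ∈ symbolClass (m + 1) β C) (hN : 2 + (m + 1) < N)
    (hc : ∀ z, ‖𝓕⁻ a z‖ ≤ c * decay N z) {α : ℝ} (hα : 0 < α) :
    ‖opTrace (mulOp φ ∘L diffOp α a (epigraph e Φ) (n + 2)) -
        (α : ℂ) ^ m * coeffB a φ e Φ (gPow (n + 2))‖ ≤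
      (∫ y : ((Fin (n + 1) → Euc (m + 1)) × Euc m) × ℝ,
        c ^ (n + 2) * (∏ i, decay N (y.1.1 i)) *
          ‖epiLayer φ e Φ (α / (2 * Real.pi)) y - limitLayer φ e Φ y‖ ∂(volume.prod volume)) *
        (α / (2 * Real.pi)) ^ m := by
  set κ := α / (2 * Real.pi) with hκ
  have hκ0 : 0 < κ := by positivity
  have hκC : (κ : ℂ) ≠ 0 := by exact_mod_cast hκ0.ne'
  have hβ0 : 0 ≤ β := (Nat.cast_nonneg _).trans hβ.le
  have hai := symbolClass.integrable hβ ha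
  have hKc := continuous_fourierInv hai
  have hi := integrable_cycProd_layer (n := n + 1) (e := e) hΦ hφ hφc hN hKc hc
  rw [(trace_diffOp hβ hφ hφc (measurableSet_epigraph hΦ.continuous) hα hκ ha n).2,
    integral_cycProd_eq_integral_epiLayer hΦ hφ hφc hN hKc hc hκ0, coeffB,
    ← (integral_limitLayer hΦ hφ hφc (symbolClass.continuous ha) hai
      (symbolClass.norm_le_const hβ0 ha) hN hc).2]
  have h1 : (α : ℂ) ^ m * (1 / (2 * (Real.pi : ℂ)) ^ m) = (κ : ℂ) ^ m := by
    rw [hκ]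
    push_cast
    rw [div_pow]
    ring
  -- The `κ^(m+1)` of the trace loses one power to the thickness `κ⁻¹` of the layer, and `α^m /
  -- (2π)^m = κ^m`, so both terms carry `κ^m`.
  rw [← mul_assoc, ← mul_assoc, h1, pow_succ, mul_inv_cancel_right₀ hκC, ← mul_sub,
    ← integral_sub (hi.1 κ hκ0) hi.2, norm_mul, norm_pow, Complex.norm_real,
    Real.norm_of_nonneg hκ0.le, mul_comm]
  refine mul_le_mul_of_nonneg_right ?_ (by positivity)
  have hc0 : 0 ≤ c := nonneg_of_mul_nonneg_left ((norm_nonneg _).trans (hc 0)) (decay_pos N 0)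
  obtain ⟨D, hD, hm, h⟩ := exists_layer_sub_bound (n := n + 1) (e := e) hΦ hφ hφc hN
    (pow_nonneg hc0 (n + 2))
  refine norm_integral_le_of_norm_le
    (hD.mono' (hm κ).aestronglyMeasurable (.of_forall (h κ hκ0))) (.of_forall fun y => ?_)
  rw [← mul_sub, norm_mul]
  exact mul_le_mul_of_nonneg_right (norm_cycProd_le hc _) (norm_nonneg _)

end asymptotics

/-! ### The trivial case `p = 1` -/

section powerOne

variable {d : ℕ}

theorem gPow_one_comp (a : Euc d → ℂ) : gPow 1 ∘ a = a := by
  ext x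
  simp [gPow]

theorem diffOp_one (α : ℝ) (a : Euc d → ℂ) {S : Set (Euc d)} (hS : MeasurableSet S) :
    diffOp α a S 1 = 0 := by
  have h1 : mulOp (chi S) ∘L mulOp (chi S) = mulOp (chi S) := by
    simp only [mulOp_comp (memLp_top_chi hS) (memLp_top_chi hS), chi_mul_chi]
  rw [diffOp, pow_one, gPow_one_comp, sub_eq_zero, wienerHopf]
  calc _ = (mulOp (chi S) ∘L mulOp (chi S)) ∘L pdo α a ∘L (mulOp (chi S) ∘L mulOp (chi S)) := rfl
    _ = _ := by rw [h1]

theorem coeffU_gPow_one (s t : ℂ) : coeffU (gPow 1) s t = 0 := by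
  simp [coeffU, gPow]

theorem truncA_gPow_one (a : Euc d → ℂ) (θ : Euc d) : truncA a θ (gPow 1) = 0 := by
  ext
  simp [truncA, coeffU_gPow_one]

theorem coeffA_gPow_one (a : Euc d → ℂ) (θ : Euc d) : coeffA a θ (gPow 1) = 0 := by
  rw [coeffA, truncA_gPow_one]
  have h : Tendsto (0 : ℝ → ℂ) (𝓝[>] 0) (𝓝 0) := tendsto_const_nhds
  rw [h.limUnder_eq, mul_zero]

theorem bdryIntegrand_gPow_one {m : ℕ} (a φ : Euc (m + 1) → ℂ)
    (e : Euc (m + 1) ≃ᵃⁱ[ℝ] Euc (m + 1)) (Φ : Euc m → ℝ) :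
    bdryIntegrand a φ e Φ (gPow 1) = 0 := by
  ext
  simp [bdryIntegrand, coeffA_gPow_one]

theorem isTraceClass_zero : IsTraceClass (0 : L2 d →L[ℂ] L2 d) :=
  ⟨0, 0, by simp [IsNuclearDecomposition]⟩

end powerOne

/-! ### The theorem -/

theorem mainTheorem5 (k : ℕ) (β : ℝ) (hβ : ((k + 2 : ℕ) : ℝ) < β) (C : ℕ → ℝ)
    (e : Euc (k + 2) ≃ᵃⁱ[ℝ] Euc (k + 2)) (Φ : Euc (k + 1) → ℝ)
    (hΦ : IsBasicC1 Φ ∨ IsBasicPiecewiseC1 Φ)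
    (φ : Euc (k + 2) → ℂ) (hφ : ContDiff ℝ ∞ φ) (hφc : HasCompactSupport φ)
    (p : ℕ) (hp : 1 ≤ p) :
    (∀ a ∈ symbolClass (k + 2) β C,
      (∀ θ : Euc (k + 2), ‖θ‖ = 1 →
        ∃ l : ℂ, Tendsto (truncA a θ (gPow p)) (𝓝[>] (0 : ℝ)) (𝓝 l)) ∧
      Integrable (bdryIntegrand a φ e Φ (gPow p)) ∧
      ∀ α : ℝ, 0 < α → IsTraceClass (mulOp φ ∘L diffOp α a (epigraph e Φ) p)) ∧
    ∀ ε : ℝ, 0 < ε → ∃ α₀ : ℝ, 0 < α₀ ∧ ∀ α : ℝ, α₀ ≤ α → ∀ a ∈ symbolClass (k + 2) β C,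
      ‖opTrace (mulOp φ ∘L diffOp α a (epigraph e Φ) p) -
          (α : ℂ) ^ (k + 1) * coeffB a φ e Φ (gPow p)‖ ≤ ε * α ^ (k + 1) := by
  obtain ⟨L, hL⟩ : ∃ L, LipschitzWith L Φ := hΦ.elim And.left And.left
  have hS := measurableSet_epigraph (e := e) hL.continuous
  obtain rfl | ⟨q, rfl⟩ : p = 1 ∨ ∃ q, p = q + 2 := by
    rcases Nat.lt_or_ge p 2 with h | h
    · exact Or.inl (by omega)
    · exact Or.inr ⟨p - 2, by omega⟩
  · simp only [diffOp_one _ _ hS, ContinuousLinearMap.comp_zero, truncA_gPow_one,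
      bdryIntegrand_gPow_one, coeffB]
    refine ⟨fun a _ => ⟨fun _ _ => ⟨0, tendsto_const_nhds⟩, integrable_zero _ _ _,
      fun _ _ => isTraceClass_zero⟩, fun ε hε => ⟨1, one_pos, fun α hα a _ => ?_⟩⟩
    have hα0 : 0 < α := one_pos.trans_le hα
    simp only [opTrace, zero_apply, inner_zero_right, tsum_zero,
      Pi.zero_apply, integral_zero, mul_zero, sub_zero, norm_zero]
    positivity
  have hβ0 : 0 ≤ β := (Nat.cast_nonneg _).trans hβ.le
  -- In dimension `k + 2` decay must exceed the dimension, plus two for the quadratic growth in the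
  -- increments; `k + 5` is the least such exponent.
  have hN : 2 + (k + 2) < k + 5 := by omega
  obtain ⟨c, hc0, hc⟩ := symbolClass.norm_fourierInv_le hβ C (k + 5)
  refine ⟨fun a ha => ⟨fun θ _ => ⟨_, tendsto_truncA (symbolClass.continuous ha)
    (symbolClass.integrable hβ ha) (symbolClass.norm_le_const hβ0 ha) hN (hc a ha) θ⟩,
    (integral_limitLayer hL hφ.continuous hφc (symbolClass.continuous ha)
      (symbolClass.integrable hβ ha) (symbolClass.norm_le_const hβ0 ha) hN (hc a ha)).1,
    fun α hα => (trace_diffOp hβ hφ.continuous hφc hS hα rfl ha q).1⟩, fun ε hε => ?_⟩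
  -- The limit is taken along `κ = α / (2π)`. Since `c` is common to the class, the resulting `α₁`
  -- serves all symbols.
  have h1 := (tendsto_integral_layer_sub (n := q + 1) (e := e) hL hφ.continuous hφc hN
    (pow_nonneg hc0 (q + 2))).comp (tendsto_id.atTop_div_const Real.two_pi_pos)
  obtain ⟨α₁, hα₁⟩ := eventually_atTop.1 (h1.eventually (gt_mem_nhds hε))
  refine ⟨max α₁ 1, by positivity, fun α hα a ha => ?_⟩
  have hα0 : 0 < α := one_pos.trans_le ((le_max_right _ _).trans hα)
  refine (opTrace_sub_coeffB hL hφ.continuous hφc hβ ha hN (hc a ha) hα0).trans ?_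
  gcongr
  · exact (hα₁ α ((le_max_left _ _).trans hα)).le
  -- The factor `(2π)^(-(k+1))` is simply dropped.
  · refine div_le_self hα0.le ?_
    linarith [Real.two_le_pi]
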